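/- Let $T$ be a forest (a finite acyclic simple graph) of order $n$ with maximum degree $\Delta$ satisfying $\Delta\ge\frac{n+2}{3}$. A harmonious colouring of a graph is a proper vertex colouring in which every unordered pair of colours appears on at most one edge, and the harmonious chromatic number $h(T)$ is the minimum number of colours in a harmonious colouring of $T$. Then $$h(T)=\begin{cases}\Delta+2,&\text{if } T \text{ has two distinct non-adjacent vertices of degree } \Delta,\\ \Delta+1,&\text{otherwise.}\end{cases}$$ Moreover, there is a polynomial-time algorithm that finds an optimal harmonious colouring of such a forest: there are a program for a random access machine (with addition and truncated subtraction of natural numbers as its arithmetic operations, at unit cost) and a polynomial $p$ such that for every $n$ and every forest $T$ on the vertex set $\{0,\dots,n-1\}$ with $\Delta(T)\ge\frac{n+2}{3}$, the program, given $n$ and the adjacency matrix of $T$, halts after at most $p(n)$ steps and outputs a harmonious colouring of $T$ with colours from $\{0,\dots,h(T)-1\}$. -/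

import Mathlib

/-! ### Harmonious colourings -/

/-- A proper vertex colouring is harmonious if every (unordered) pair of colours appears on at
most one edge. -/
def SimpleGraph.Coloring.IsHarmonious {V α : Type*} {G : SimpleGraph V} (C : G.Coloring α) :
    Prop :=
  ∀ e ∈ G.edgeSet, ∀ e' ∈ G.edgeSet, Sym2.map C e = Sym2.map C e' → e = e'

/-- The harmonious chromatic number of a finite graph: the least number of colours in a
harmonious colouring. -/
noncomputable def SimpleGraph.harmoniousNumber {V : Type*} (G : SimpleGraph V) : ℕ :=
  sInf {k : ℕ | ∃ C : G.Coloring (Fin k), C.IsHarmonious}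

/-- `G` has two distinct non-adjacent vertices of maximum degree. -/
def SimpleGraph.HasNonadjacentMaxDegree {V : Type*} [Fintype V] (G : SimpleGraph V)
    [DecidableRel G.Adj] : Prop :=
  ∃ u v : V, u ≠ v ∧ ¬ G.Adj u v ∧ G.degree u = G.maxDegree ∧ G.degree v = G.maxDegree

/-! ### A random access machine with a step count

The memory consists of arrays of natural numbers; a program mentions only finitely many of them,
while the cells of an array are addressed by computed indices. The only arithmetic operations are
addition and truncated subtraction, so that unit cost is polynomially related to the running time
of a Turing machine. -/

namespace RAM

/-- The memory: `s a i` is the content of cell `i` of array `a`. -/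
abbrev State : Type := ℕ → ℕ → ℕ

/-- Arithmetic expressions. -/
inductive Expr : Type
  | const (k : ℕ) : Expr
  | get (a : ℕ) (i : Expr) : Expr
  | add (x y : Expr) : Expr
  | sub (x y : Expr) : Expr

/-- The value of an expression. -/
def Expr.eval (s : State) : Expr → ℕ
  | .const k => k
  | .get a i => s a (i.eval s)
  | .add x y => x.eval s + y.eval s
  | .sub x y => x.eval s - y.eval s

/-- The number of steps needed to evaluate an expression: one for each constant, each memory
access and each arithmetic operation. -/
def Expr.cost : Expr → ℕ
  | .const _ => 1
  | .get _ i => i.cost + 1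
  | .add x y => x.cost + y.cost + 1
  | .sub x y => x.cost + y.cost + 1

/-- Programs. A condition is true if its value is not zero. -/
inductive Program : Type
  | skip : Program
  | set (a : ℕ) (i x : Expr) : Program
  | seq (P Q : Program) : Program
  | ite (b : Expr) (P Q : Program) : Program
  | while (b : Expr) (P : Program) : Program

/-- Write `x` into cell `i` of array `a`. -/
def State.write (s : State) (a i x : ℕ) : State :=
  Function.update s a (Function.update (s a) i x)

/-- `Runs P s t s'`: the program `P`, started in the memory state `s`, halts after exactly `t`
steps in the memory state `s'`. -/
inductive Runs : Program → State → ℕ → State → Prop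
  | skip (s : State) : Runs .skip s 1 s
  | set (a : ℕ) (i x : Expr) (s : State) :
      Runs (.set a i x) s (i.cost + x.cost + 1) (s.write a (i.eval s) (x.eval s))
  | seq {P Q : Program} {s s' s'' : State} {t t' : ℕ} :
      Runs P s t s' → Runs Q s' t' s'' → Runs (.seq P Q) s (t + t') s''
  | ite_true {b : Expr} {P Q : Program} {s s' : State} {t : ℕ} :
      b.eval s ≠ 0 → Runs P s t s' → Runs (.ite b P Q) s (b.cost + 1 + t) s'
  | ite_false {b : Expr} {P Q : Program} {s s' : State} {t : ℕ} :
      b.eval s = 0 → Runs Q s t s' → Runs (.ite b P Q) s (b.cost + 1 + t) s'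
  | while_true {b : Expr} {P : Program} {s s' s'' : State} {t t' : ℕ} :
      b.eval s ≠ 0 → Runs P s t s' → Runs (.while b P) s' t' s'' →
        Runs (.while b P) s (b.cost + 1 + t + t') s''
  | while_false {b : Expr} {P : Program} {s : State} :
      b.eval s = 0 → Runs (.while b P) s (b.cost + 1) s

open Classical in
/-- The initial memory that encodes a graph on the vertices `0, …, n - 1`: cell `0` of array `0`
holds `n`, array `1` holds the adjacency matrix, row by row (the entry in row `i` and column `j`
is in cell `n * i + j`), and all the other cells are zero. -/
noncomputable def graphInput {n : ℕ} (G : SimpleGraph (Fin n)) : State := fun a k =>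
  if a = 0 ∧ k = 0 then n
  else if a = 1 ∧ ∃ i j : Fin n, G.Adj i j ∧ k = n * (i : ℕ) + (j : ℕ) then 1
  else 0

/-- Within `t` steps, `P` computes from the graph `G` an optimal harmonious colouring of `G`: the
colour of the vertex `i`, one of `0, …, h - 1` where `h` is the harmonious chromatic number, is
left in cell `i` of array `2`. -/
def ComputesOptimalHarmoniousColoring (P : Program) {n : ℕ} (G : SimpleGraph (Fin n)) (t : ℕ) :
    Prop :=
  ∃ t' ≤ t, ∃ s' : State, Runs P (graphInput G) t' s' ∧
    ∃ C : G.Coloring (Fin G.harmoniousNumber), C.IsHarmonious ∧ ∀ i : Fin n, s' 2 i = C i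

end RAM

namespace RAM

/-! Lower bound. In a harmonious colouring the neighbours of a vertex have distinct colours, so at
least `Δ + 1` colours are needed. If there are only `Δ + 1`, a vertex of degree `Δ` sees every
colour but its own. Two non-adjacent vertices of degree `Δ` then yield two different edges with the
same pair of colours, whether or not the two vertices share a colour (`add_two_le`).

Upper bound. Root the forest at a vertex `v` of degree `Δ`; if some other vertex of degree `Δ` is
not adjacent to `v`, attach one extra leaf to `v`. Let `d` be the resulting degree of `v`. The
colours are `0, …, d`, and `0` is used at `v` only. The predicate `IsGood` is what the induction on
`d` preserves; since there are at most `3d - 2` vertices, at most `2d - 3` of them have a parent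
other than `v`. Let `N` be the number of vertices other than `v` that have children.

If `N ≤ d`, these vertices get distinct colours, and so do the children of `v`
(`IsInitial.isPartial`). What remains uncoloured are leaves, which are coloured greedily. Each
colour `X` must meet at most `d - 1` edges outside the root, where an uncoloured leaf already counts
at its parent's colour. Always serving a leaf whose parent's colour meets the most edges keeps this
true (`IsPartial.update`), because two colours that meet `d - 1` edges each and share none would
need `2d - 2` edges.

If `N > d`, counting gives a child `u` of `v` with at most one descendant, and a vertex `a`, not
adjacent to `v`, all of whose children are leaves; moreover every vertex other than `v` has at most
`d - 3` children. Removing `u`, `a` and their children costs at least three vertices and one child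
of `v`, so the rest is good for `d - 1` (`IsGood.prune`). Afterwards `u` and `a` get the new colour
`d`, and their at most `d - 2` children get distinct colours among `1, …, d - 1` other than that of
the parent of `a` (`IsHarm.extend`).

Algorithm. The construction is written with loops of exactly `n + 1` rounds, so that polynomial
running time follows from the syntax (`runs_compile`). The recursion is unrolled: the removals are
recorded by levels and undone in reverse order. The correctness proof of this program also serves as
the proof that the colouring exists. -/

theorem State.write_self (s : State) (a i x : ℕ) :
    s.write a i x a = Function.update (s a) i x := by
  simp [State.write]

theorem State.write_of_ne (s : State) {a b : ℕ} (i x : ℕ) (h : b ≠ a) :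
    s.write a i x b = s b := by
  simp [State.write, h]

/-! ### A structured language of programs with bounded loops -/

/-- Commands: programs whose only loops are bounded. The loop `loop a P` runs `P` for the values
`0, …, n` of cell `0` of array `a`, where `n` is the content of cell `0` of array `0`. -/
inductive Cmd : Type
  | skip : Cmd
  | set (a : ℕ) (i x : Expr) : Cmd
  | seq (P Q : Cmd) : Cmd
  | ite (b : Expr) (P Q : Cmd) : Cmd
  | loop (a : ℕ) (P : Cmd) : Cmd

/-- The scalar variable stored in cell `0` of array `a`. -/
def Expr.var (a : ℕ) : Expr := .get a (.const 0)

/-- An expression used as a condition holds if its value is not zero. -/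
def Expr.Holds (b : Expr) (s : State) : Prop := b.eval s ≠ 0

instance (b : Expr) (s : State) : Decidable (b.Holds s) := inferInstanceAs (Decidable (_ ≠ _))

/-- Negation of a condition. -/
def Expr.not (b : Expr) : Expr := .sub (.const 1) b

/-- Conjunction of conditions. -/
def Expr.and (b c : Expr) : Expr := .not (.add b.not c.not)

/-- Disjunction of conditions. -/
def Expr.or (b c : Expr) : Expr := .add b c

/-- The condition `x < y`. -/
def Expr.lt (x y : Expr) : Expr := .sub y x

/-- The condition `x = y`. -/
def Expr.eq (x y : Expr) : Expr := .not (.add (.sub x y) (.sub y x))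

section
variable (s : State) (b c x y : Expr)

@[simp] theorem Expr.eval_const (k : ℕ) : (Expr.const k).eval s = k := rfl
@[simp] theorem Expr.eval_get (a : ℕ) : (Expr.get a x).eval s = s a (x.eval s) := rfl
@[simp] theorem Expr.eval_add : (Expr.add x y).eval s = x.eval s + y.eval s := rfl
@[simp] theorem Expr.eval_sub : (Expr.sub x y).eval s = x.eval s - y.eval s := rfl
@[simp] theorem Expr.eval_var (a : ℕ) : (Expr.var a).eval s = s a 0 := rfl

theorem Expr.eval_not : b.not.eval s = if b.Holds s then 0 else 1 := by
  by_cases h : b.eval s = 0 <;> simp [Expr.not, Expr.Holds, h]; omega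

@[simp] theorem Expr.holds_not : b.not.Holds s ↔ ¬ b.Holds s := by
  rw [Expr.Holds, Expr.eval_not]; split_ifs <;> simp_all

@[simp] theorem Expr.holds_or : (b.or c).Holds s ↔ b.Holds s ∨ c.Holds s := by
  simp only [Expr.or, Expr.Holds, Expr.eval_add]; omega

@[simp] theorem Expr.holds_and : (b.and c).Holds s ↔ b.Holds s ∧ c.Holds s := by
  have := Expr.holds_or s b.not c.not
  simp only [Expr.or] at this
  rw [Expr.and, Expr.holds_not, this]; simp

theorem Expr.eval_and : (b.and c).eval s = if b.Holds s ∧ c.Holds s then 1 else 0 := by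
  have := Expr.holds_and s b c
  have h : (b.and c).eval s ≤ 1 := by simp [Expr.and, Expr.not]
  unfold Expr.Holds at this ⊢
  split_ifs <;> omega

@[simp] theorem Expr.holds_lt : (x.lt y).Holds s ↔ x.eval s < y.eval s := by
  simp only [Expr.lt, Expr.Holds, Expr.eval_sub]; omega

@[simp] theorem Expr.holds_eq : (x.eq y).Holds s ↔ x.eval s = y.eval s := by
  rw [Expr.eq, Expr.holds_not]; simp only [Expr.Holds, Expr.eval_add, Expr.eval_sub]; omega

@[simp] theorem Expr.holds_get (a : ℕ) : (Expr.get a x).Holds s ↔ s a (x.eval s) ≠ 0 := Iff.rfl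

@[simp] theorem Expr.holds_var (a : ℕ) : (Expr.var a).Holds s ↔ s a 0 ≠ 0 := Iff.rfl

end

namespace Cmd

/-- The arrays that a command may modify. -/
def writes : Cmd → List ℕ
  | skip => []
  | set a _ _ => [a]
  | seq P Q => P.writes ++ Q.writes
  | ite _ P Q => P.writes ++ Q.writes
  | loop a P => a :: P.writes

/-- No loop modifies its own counter, and array `0` is never modified. -/
def Valid : Cmd → Prop
  | skip => True
  | set a _ _ => a ≠ 0
  | seq P Q => P.Valid ∧ Q.Valid
  | ite _ P Q => P.Valid ∧ Q.Valid
  | loop a P => a ≠ 0 ∧ a ∉ P.writes ∧ P.Valid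

/-- The memory state in which a command halts. -/
def run : Cmd → State → State
  | skip, s => s
  | set a i x, s => s.write a (i.eval s) (x.eval s)
  | seq P Q, s => Q.run (P.run s)
  | ite b P Q, s => if b.Holds s then P.run s else Q.run s
  | loop a P, s =>
    (fun s => (P.run s).write a 0 (P.run s a 0 + 1))^[s 0 0 + 1] (s.write a 0 0)

section
variable (s : State)
theorem run_skip : skip.run s = s := rfl
theorem run_set (a : ℕ) (i x : Expr) : (set a i x).run s = s.write a (i.eval s) (x.eval s) := rfl
theorem run_seq (P Q : Cmd) : (seq P Q).run s = Q.run (P.run s) := rfl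
theorem run_ite (b : Expr) (P Q : Cmd) :
    (ite b P Q).run s = if b.Holds s then P.run s else Q.run s := rfl
end

/-- Translation into programs. -/
def compile : Cmd → Program
  | skip => .skip
  | set a i x => .set a i x
  | seq P Q => .seq P.compile Q.compile
  | ite b P Q => .ite b P.compile Q.compile
  | loop a P => .seq (.set a (.const 0) (.const 0))
      (.while (.sub (.add (.var 0) (.const 1)) (.var a))
        (.seq P.compile (.set a (.const 0) (.add (.var a) (.const 1)))))

open Polynomial in
/-- A bound for the number of steps, in terms of the content of cell `0` of array `0`. -/
noncomputable def time : Cmd → ℕ[X]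
  | skip => 1
  | set _ i x => C (i.cost + x.cost + 1)
  | seq P Q => P.time + Q.time
  | ite b P Q => C (b.cost + 1) + P.time + Q.time
  | loop _ P => C 20 + (X + 1) * (P.time + C 20)

/-- The frame rule. With the concrete lists of written arrays, `decide` can discharge its
hypothesis, and this is how all later specifications carry arrays unchanged across commands. -/
theorem run_frame (P : Cmd) (s : State) {b : ℕ} (h : b ∉ P.writes) : P.run s b = s b := by
  induction P generalizing s with
  | skip => rfl
  | set a i x => exact State.write_of_ne _ _ _ (by simpa [writes] using h)
  | seq P Q hP hQ =>
    simp only [writes, List.mem_append, not_or] at h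
    simp [run, hP _ h.1, hQ _ h.2]
  | ite c P Q hP hQ =>
    simp only [writes, List.mem_append, not_or] at h
    simp only [run]; split_ifs
    exacts [hP _ h.1, hQ _ h.2]
  | loop a P hP =>
    simp only [writes, List.mem_cons, not_or] at h
    simp only [run]
    generalize s 0 0 + 1 = m
    induction m with
    | zero => simp [State.write_of_ne _ _ _ h.1]
    | succ m ih => rw [Function.iterate_succ_apply', State.write_of_ne _ _ _ h.1, hP _ h.2, ih]

theorem Valid.zero_notMem {P : Cmd} (h : P.Valid) : 0 ∉ P.writes := by
  induction P with
  | skip => simp [writes]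
  | set a i x => simp only [Valid] at h; simp [writes, h.symm]
  | seq P Q hP hQ => simp [writes, hP h.1, hQ h.2]
  | ite c P Q hP hQ => simp [writes, hP h.1, hQ h.2]
  | loop a P hP => simp [writes, hP h.2.2, h.1.symm]

/-- The states that occur in a loop. -/
theorem iterate_spec {a : ℕ} {P : Cmd} (h : (loop a P).Valid) (s : State) (m : ℕ) :
    let s' := (fun s => (P.run s).write a 0 (P.run s a 0 + 1))^[m] (s.write a 0 0)
    s' a 0 = m ∧ ∀ b, b ∉ a :: P.writes → s' b = s b := by
  induction m with
  | zero =>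
    refine ⟨by simp [State.write_self], fun b hb => ?_⟩
    simp only [List.mem_cons, not_or] at hb
    simp [State.write_of_ne _ _ _ hb.1]
  | succ m ih =>
    simp only [Function.iterate_succ_apply'] at ih ⊢
    refine ⟨?_, fun b hb => ?_⟩
    · rw [State.write_self, Function.update_self, run_frame _ _ h.2.1, ih.1]
    · rw [← ih.2 b hb]
      simp only [List.mem_cons, not_or] at hb
      rw [State.write_of_ne _ _ _ hb.1, run_frame _ _ hb.2]

/-- The proof rule behind all loop specifications. The step may assume that arrays not written by
the loop still have their contents from before the loop, so an invariant need only speak of the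
arrays that change. -/
theorem loop_inv {a : ℕ} {P : Cmd} (h : (loop a P).Valid) (s : State) (I : ℕ → State → Prop)
    (h0 : I 0 (s.write a 0 0))
    (hs : ∀ j s', j ≤ s 0 0 → (∀ b, b ∉ a :: P.writes → s' b = s b) → s' a 0 = j → I j s' →
      I (j + 1) ((P.run s').write a 0 (j + 1))) :
    I (s 0 0 + 1) ((loop a P).run s) := by
  simp only [run]
  have key : ∀ m ≤ s 0 0 + 1,
      I m ((fun s => (P.run s).write a 0 (P.run s a 0 + 1))^[m] (s.write a 0 0)) := by
    intro m
    induction m with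
    | zero => intro _; exact h0
    | succ m ih =>
      intro hm
      obtain ⟨h1, h2⟩ := iterate_spec h s m
      have := hs m _ (by omega) h2 h1 (ih (by omega))
      rw [Function.iterate_succ_apply', run_frame _ _ h.2.1, h1]
      exact this
  exact key _ le_rfl

/-- Validity keeps the loop bound in array `0` and the counter of each loop out of reach of the loop
body. Hence every loop makes exactly `n + 1` rounds, and nesting finitely many loops multiplies
polynomials in `n`. -/
theorem runs_compile {P : Cmd} (h : P.Valid) (s : State) :
    ∃ t ≤ P.time.eval (s 0 0), Runs P.compile s t (P.run s) := by
  induction P generalizing s with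
  | skip => exact ⟨1, by simp [time], .skip s⟩
  | set a i x => exact ⟨_, by simp [time], .set a i x s⟩
  | seq P Q hP hQ =>
    obtain ⟨t, ht, hr⟩ := hP h.1 s
    obtain ⟨t', ht', hr'⟩ := hQ h.2 (P.run s)
    rw [run_frame _ _ h.1.zero_notMem] at ht'
    exact ⟨t + t', by simp [time]; omega, .seq hr hr'⟩
  | ite c P Q hP hQ =>
    by_cases hc : c.Holds s
    · obtain ⟨t, ht, hr⟩ := hP h.1 s
      refine ⟨c.cost + 1 + t, by simp [time]; omega, ?_⟩
      simp only [run, hc, if_true]; exact .ite_true hc hr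
    · obtain ⟨t, ht, hr⟩ := hQ h.2 s
      refine ⟨c.cost + 1 + t, by simp [time]; omega, ?_⟩
      simp only [run, hc, if_false]; exact .ite_false (not_not.1 hc) hr
  | loop a P hP =>
    have h0 : 0 ∉ a :: P.writes := by simpa [writes] using h.zero_notMem
    set f : State → State := fun s => (P.run s).write a 0 (P.run s a 0 + 1) with hf
    -- Here `k` is the number of rounds left. The constant `8` is the cost of the failing test; a
    -- round costs `8` for the test and `6` for the counter besides the body, which `20` covers.
    have key : ∀ k m, m + k = s 0 0 + 1 → ∃ t ≤ 8 + k * (P.time.eval (s 0 0) + 20),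
        Runs (.while (.sub (.add (.var 0) (.const 1)) (.var a))
          (.seq P.compile (.set a (.const 0) (.add (.var a) (.const 1)))))
          (f^[m] (s.write a 0 0)) t (f^[s 0 0 + 1] (s.write a 0 0)) := by
      intro k
      induction k with
      | zero =>
        intro m hm
        obtain ⟨h1, h2⟩ := iterate_spec h s m
        obtain rfl : m = s 0 0 + 1 := by omega
        refine ⟨_, ?_, .while_false ?_⟩
        · simp [Expr.cost, Expr.var]
        · simp only [Expr.eval_sub, Expr.eval_add, Expr.eval_var, Expr.eval_const]
          rw [h1, h2 0 h0]; simp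
      | succ k ih =>
        intro m hm
        obtain ⟨h1, h2⟩ := iterate_spec h s m
        obtain ⟨t, ht, hr⟩ := ih (m + 1) (by omega)
        obtain ⟨t', ht', hr'⟩ := hP h.2.2 (f^[m] (s.write a 0 0))
        rw [Function.iterate_succ_apply'] at hr
        rw [h2 0 h0] at ht'
        refine ⟨_, ?_, .while_true ?_ (.seq hr' (.set _ _ _ _)) hr⟩
        · simp only [Expr.cost, Expr.var]
          rw [add_mul]; omega
        · simp only [Expr.eval_sub, Expr.eval_add, Expr.eval_var, Expr.eval_const]
          rw [h1, h2 0 h0]; omega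
    obtain ⟨t, ht, hr⟩ := key (s 0 0 + 1) 0 (by omega)
    refine ⟨_, ?_, .seq (.set a _ _ s) hr⟩
    simp only [Expr.cost, time, Polynomial.eval_add, Polynomial.eval_mul, Polynomial.eval_C,
      Polynomial.eval_X, Polynomial.eval_one]
    omega

/-! ### Common loops -/

theorem loop_sum {a c : ℕ} {P : Cmd} (h : (loop a P).Valid) (hac : c ≠ a) (s : State)
    (f : ℕ → ℕ)
    (hP : ∀ j s', j ≤ s 0 0 → (∀ b, b ∉ a :: P.writes → s' b = s b) → s' a 0 = j →
      P.run s' c 0 = s' c 0 + f j) :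
    (loop a P).run s c 0 = s c 0 + ∑ j ∈ Finset.range (s 0 0 + 1), f j := by
  refine loop_inv h s (fun m t => t c 0 = s c 0 + ∑ j ∈ Finset.range m, f j) ?_ ?_
  · simp [State.write_of_ne _ _ _ hac]
  · intro j s' hj hb ha hi
    rw [State.write_of_ne _ _ _ hac, hP j s' hj hb ha, hi, Finset.sum_range_succ, add_assoc]

/-- A loop that searches for the last index with a given property. -/
theorem loop_find {a c : ℕ} {P : Cmd} (h : (loop a P).Valid) (hac : c ≠ a) (s : State)
    (p : ℕ → Prop) (hc : s c 0 = 0)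
    (hP : ∀ j s', j ≤ s 0 0 → (∀ b, b ∉ a :: P.writes → s' b = s b) → s' a 0 = j →
      (p j → P.run s' c 0 = j + 1) ∧ (¬ p j → P.run s' c 0 = s' c 0)) :
    ((loop a P).run s c 0 = 0 ∧ ∀ j ≤ s 0 0, ¬ p j) ∨
      ∃ j ≤ s 0 0, p j ∧ (loop a P).run s c 0 = j + 1 := by
  have := loop_inv h s (fun m t => (t c 0 = 0 ∧ ∀ j < m, ¬ p j) ∨
    ∃ j < m, p j ∧ t c 0 = j + 1) ?_ ?_
  · simpa only [Nat.lt_succ_iff] using this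
  · left; simp [State.write_of_ne _ _ _ hac, hc]
  · intro j s' hj hb ha hi
    rw [State.write_of_ne _ _ _ hac]
    obtain ⟨h1, h2⟩ := hP j s' hj hb ha
    by_cases hp : p j
    · exact .inr ⟨j, by omega, hp, h1 hp⟩
    · rw [h2 hp]
      rcases hi with ⟨hi, hi'⟩ | ⟨k, hk, hpk, hi⟩
      · refine .inl ⟨hi, fun k hk => ?_⟩
        rcases Nat.lt_succ_iff_lt_or_eq.1 hk with hk | rfl
        exacts [hi' k hk, hp]
      · exact .inr ⟨k, by omega, hpk, hi⟩

/-- A loop that fills an array. -/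
theorem loop_map {a c : ℕ} {P : Cmd} (h : (loop a P).Valid) (hac : c ≠ a) (s : State)
    (f : ℕ → ℕ)
    (hP : ∀ j s', j ≤ s 0 0 → (∀ b, b ∉ a :: P.writes → s' b = s b) → s' a 0 = j →
      s' c j = s c j → P.run s' c = Function.update (s' c) j (f j)) :
    (loop a P).run s c = fun k => if k ≤ s 0 0 then f k else s c k := by
  have := loop_inv h s (fun m t => ∀ k, t c k = if k < m then f k else s c k) ?_ ?_
  · ext k; simpa only [Nat.lt_succ_iff] using this k
  · simp [State.write_of_ne _ _ _ hac]
  · intro j s' hj hb ha hi k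
    rw [State.write_of_ne _ _ _ hac, hP j s' hj hb ha (by simp [hi])]
    rcases lt_trichotomy k j with hk | rfl | hk
    · rw [Function.update_of_ne hk.ne, hi, if_pos hk, if_pos (by omega)]
    · simp
    · rw [Function.update_of_ne hk.ne', hi, if_neg (by omega), if_neg (by omega)]

end Cmd

end RAM

/-! ### Rooted forests given by parents

A finite rooted forest on natural numbers is given by its set `A` of vertices and a function `par`,
where `par i = w + 1` if `w` is the parent of `i`, and `par i = 0` if `i` has no parent. -/

namespace ParentForest

open Finset

/-- The children of `w`. -/
def children (par : ℕ → ℕ) (A : Finset ℕ) (w : ℕ) : Finset ℕ := {i ∈ A | par i = w + 1}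

/-- The number of grandchildren of `w`. -/
def grand (par : ℕ → ℕ) (A : Finset ℕ) (w : ℕ) : ℕ :=
  ∑ i ∈ children par A w, #(children par A i)

/-- The vertices other than `v` that have a child. -/
def inner (par : ℕ → ℕ) (v : ℕ) (A : Finset ℕ) : Finset ℕ :=
  {w ∈ A | w ≠ v ∧ 1 ≤ #(children par A w)}

/-- The vertices whose parent is not `v`. -/
def low (par : ℕ → ℕ) (v : ℕ) (A : Finset ℕ) : Finset ℕ :=
  {i ∈ A | par i ≠ 0 ∧ par i ≠ v + 1}

/-- A rooted forest on `A` with a root `v` of degree `d`, where all other degrees are at most `d`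
and those of the vertices not adjacent to `v` at most `d - 1`, with at most `3 * d - 2` vertices. -/
structure IsGood (par r : ℕ → ℕ) (v : ℕ) (A : Finset ℕ) (d : ℕ) : Prop where
  root_mem : v ∈ A
  par_root : par v = 0
  closed : ∀ i ∈ A, par i ≠ 0 → par i - 1 ∈ A
  rank : ∀ i ∈ A, par i ≠ 0 → r (par i - 1) < r i
  card_root : #(children par A v) = d
  card_le : #A + 2 ≤ 3 * d
  deg_low : ∀ w ∈ low par v A, #(children par A w) + 2 ≤ d
  deg_le : ∀ w ∈ A, w ≠ v → #(children par A w) + 1 ≤ d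

/-- A harmonious colouring with colours `0, …, d` where only the root `v` has colour `0`. -/
structure IsHarm (par : ℕ → ℕ) (v : ℕ) (A : Finset ℕ) (d : ℕ) (col : ℕ → ℕ) : Prop where
  root : col v = 0
  pos : ∀ i ∈ A, i ≠ v → 1 ≤ col i
  le : ∀ i ∈ A, col i ≤ d
  proper : ∀ i ∈ A, par i ≠ 0 → col i ≠ col (par i - 1)
  inj : ∀ i ∈ A, ∀ j ∈ A, par i ≠ 0 → par j ≠ 0 →
    s(col i, col (par i - 1)) = s(col j, col (par j - 1)) → i = j

variable {par r : ℕ → ℕ} {v d : ℕ} {A : Finset ℕ}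

@[simp] theorem mem_children {i w : ℕ} : i ∈ children par A w ↔ i ∈ A ∧ par i = w + 1 := by
  simp [children]

theorem children_disjoint {w w' : ℕ} (h : w ≠ w') :
    Disjoint (children par A w) (children par A w') := by
  rw [Finset.disjoint_left]; intro i hi hi'; simp at hi hi'; omega

/-- Sets of children of different vertices are disjoint, and a child of a vertex other than `v` lies
in `low`. -/
theorem sum_children_le (par : ℕ → ℕ) (v : ℕ) (A : Finset ℕ) :
    ∑ w ∈ A.erase v, #(children par A w) ≤ #(low par v A) := by
  rw [← card_biUnion fun w _ w' _ hww => children_disjoint hww]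
  refine card_le_card fun i hi => ?_
  simp only [mem_biUnion, mem_children, mem_erase] at hi
  obtain ⟨w, ⟨hwv, hw⟩, hi, hp⟩ := hi
  simp [low, hi, hp, hwv]

namespace IsGood

variable (h : IsGood par r v A d)
include h

/-- The root, its `d` children and the vertices of `low` are pairwise different. -/
theorem card_low_add : #(low par v A) + d + 1 ≤ #A := by
  have h1 : Disjoint (low par v A) (insert v (children par A v)) := by
    rw [Finset.disjoint_left]; intro i hi hi'
    simp only [low, mem_filter] at hi
    simp only [mem_insert, mem_children] at hi'
    rcases hi' with rfl | hi'
    · exact hi.2.1 h.par_root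
    · exact hi.2.2 hi'.2
  have h2 : v ∉ children par A v := by simp [h.par_root]
  have h3 : low par v A ∪ insert v (children par A v) ⊆ A := by
    intro i hi
    simp only [low, mem_union, mem_filter, mem_insert, mem_children] at hi
    rcases hi with hi | rfl | hi
    exacts [hi.1, h.root_mem, hi.1]
  have := card_le_card h3
  rw [card_union_of_disjoint h1, card_insert_of_notMem h2, h.card_root] at this
  omega

theorem card_low_le : #(low par v A) + 3 ≤ 2 * d := by
  have := h.card_low_add; have := h.card_le; omega

/-- More than `d` vertices share at most `2d - 3` children, each having at least one. If `w` is
among them, the at least `d` others use up `d` children, which leaves at most `d - 3` for `w`. -/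
theorem children_le_of_lt_inner (hN : d < #(inner par v A)) {w : ℕ} (hw : w ∈ A) (hwv : w ≠ v) :
    #(children par A w) + 3 ≤ d := by
  have h1 := sum_children_le par v A
  have h2 := h.card_low_le
  have h3 : inner par v A ⊆ A.erase v := fun i hi => by
    simp only [inner, mem_filter] at hi; simp [hi.1, hi.2.1]
  have h4 : ∀ i ∈ inner par v A, 1 ≤ #(children par A i) := fun i hi => by
    simp only [inner, mem_filter] at hi; exact hi.2.2
  have h5 : ∑ w ∈ inner par v A, #(children par A w) ≤ ∑ w ∈ A.erase v, #(children par A w) :=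
    sum_le_sum_of_subset h3
  have h6 : #(inner par v A) ≤ ∑ w ∈ inner par v A, #(children par A w) := by
    simpa using card_nsmul_le_sum _ _ _ h4
  by_cases hw' : w ∈ inner par v A
  · rw [← add_sum_erase _ _ hw'] at h5
    have h7 : #((inner par v A).erase w) ≤ ∑ w ∈ (inner par v A).erase w, #(children par A w) := by
      simpa using card_nsmul_le_sum _ _ _ fun i hi => h4 i (mem_of_mem_erase hi)
    rw [card_erase_of_mem hw'] at h7
    omega
  · have : #(children par A w) = 0 := by
      by_contra h0
      exact hw' (by simp only [inner, mem_filter]; exact ⟨hw, hwv, by omega⟩)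
    omega

/-- Otherwise each of the `d` children of `v` has at least two children and grandchildren in total.
These `2d` vertices would all be non-children of `v` that have a parent, of which there are at most
`2d - 3`. -/
theorem exists_small_branch :
    ∃ u ∈ children par A v, #(children par A u) + grand par A u ≤ 1 := by
  by_contra! hc
  have h1 : 2 * d ≤ ∑ u ∈ children par A v, (#(children par A u) + grand par A u) := by
    have := card_nsmul_le_sum (children par A v)
      (fun u => #(children par A u) + grand par A u) 2 fun u hu => hc u hu
    rw [h.card_root] at this
    simpa [mul_comm] using this
  have h2 := sum_children_le par v A
  have h3 := h.card_low_le
  rw [sum_add_distrib] at h1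
  simp only [grand] at h1
  -- The double sum becomes one sum of numbers of children, over the disjoint union of the children
  -- and the grandchildren of `v`; all of these differ from `v`.
  rw [← sum_biUnion fun w _ w' _ hww => children_disjoint hww, ← sum_union] at h1
  · refine absurd (h1.trans (sum_le_sum_of_subset (t := A.erase v) ?_)) (by omega)
    intro i hi
    simp only [mem_union, mem_biUnion, mem_children, mem_erase] at hi ⊢
    have : i = v → par i = 0 := fun h' => h' ▸ h.par_root
    rcases hi with hi | ⟨w, hw, hi⟩
    · exact ⟨fun h' => by have := this h'; omega, hi.1⟩
    · exact ⟨fun h' => by have := this h'; omega, hi.1⟩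
  · rw [Finset.disjoint_left]
    intro i hi hi'
    simp only [mem_biUnion, mem_children] at hi hi'
    obtain ⟨w, hw, hi'⟩ := hi'
    obtain rfl : w = v := by omega
    have := h.par_root
    omega

/-- As `v` has only `d` children, some vertex with children is neither `v` nor a child of `v`. One
of maximal rank works: a child of it that had children would be another such vertex, of larger rank.
-/
theorem exists_bottom (hN : d < #(inner par v A)) :
    ∃ a ∈ A, a ≠ v ∧ par a ≠ v + 1 ∧ 1 ≤ #(children par A a) ∧ grand par A a = 0 := by
  have hne : (inner par v A \ children par A v).Nonempty := by
    rw [nonempty_iff_ne_empty, Ne, sdiff_eq_empty_iff_subset]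
    intro hs
    have := card_le_card hs
    rw [h.card_root] at this
    omega
  obtain ⟨a, ha, hmax⟩ := exists_max_image _ r hne
  simp only [inner, mem_sdiff, mem_filter, mem_children, not_and] at ha hmax
  refine ⟨a, ha.1.1, ha.1.2.1, ha.2 ha.1.1, ha.1.2.2, ?_⟩
  refine sum_eq_zero fun i hi => ?_
  by_contra h0
  rw [mem_children] at hi
  have h1 := h.rank i hi.1 (by omega)
  rw [hi.2, Nat.add_sub_cancel] at h1
  have h2 := hmax i ⟨⟨hi.1, fun h' => ?_, by omega⟩, fun _ h' => ?_⟩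
  · omega
  · have := h.par_root; rw [h'] at hi; omega
  · exact ha.1.2.1 (by omega)

end IsGood

/-- The vertices that remain after the removal of `u`, `a` and their children. -/
def prune (par : ℕ → ℕ) (u a : ℕ) (A : Finset ℕ) : Finset ℕ :=
  {i ∈ A | ¬ (i = u ∨ i = a ∨ par i = u + 1 ∨ par i = a + 1)}

/-- The vertex `u` is a neighbour of the root `v` with at most one descendant, and `a` is a vertex,
not adjacent to `v`, that has children but no grandchildren. -/
structure IsPair (par : ℕ → ℕ) (v : ℕ) (A : Finset ℕ) (u a : ℕ) : Prop where
  mem_u : u ∈ A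
  par_u : par u = v + 1
  small_u : #(children par A u) + grand par A u ≤ 1
  mem_a : a ∈ A
  ne_a : a ≠ v
  par_a : par a ≠ v + 1
  inner_a : 1 ≤ #(children par A a)
  bottom_a : grand par A a = 0

variable {u a : ℕ}

/-- The removed set is closed under taking children: a child of `u` has no children because `u` has
at most one child and grandchild in total, and a child of `a` has none because `a` has no
grandchildren. -/
theorem IsGood.parent_mem_prune (h : IsGood par r v A d) (hp : IsPair par v A u a) {i : ℕ}
    (hi : i ∈ A) (hiu : par i ≠ u + 1) (hia : par i ≠ a + 1) (h0 : par i ≠ 0) :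
    par i - 1 ∈ prune par u a A := by
  have hm := h.closed i hi h0
  have hc : 1 ≤ #(children par A (par i - 1)) :=
    card_pos.2 ⟨i, by simp only [mem_children]; exact ⟨hi, by omega⟩⟩
  simp only [prune, mem_filter]
  refine ⟨hm, ?_⟩
  rintro (h' | h' | h' | h')
  · omega
  · omega
  · have h1 : par i - 1 ∈ children par A u := mem_children.2 ⟨hm, h'⟩
    have h2 : #(children par A (par i - 1)) ≤ grand par A u :=
      single_le_sum (f := fun i => #(children par A i)) (fun _ _ => Nat.zero_le _) h1
    have h3 : 1 ≤ #(children par A u) := card_pos.2 ⟨_, h1⟩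
    have := hp.small_u
    omega
  · have h1 : par i - 1 ∈ children par A a := mem_children.2 ⟨hm, h'⟩
    have h2 : #(children par A (par i - 1)) ≤ grand par A a :=
      single_le_sum (f := fun i => #(children par A i)) (fun _ _ => Nat.zero_le _) h1
    have := hp.bottom_a
    omega

theorem IsPair.ne (hp : IsPair par v A u a) : u ≠ a := fun h => hp.par_a (h ▸ hp.par_u)

/-- The three vertices lost for certain are `u`, `a` and some child of `a`. -/
theorem IsGood.card_prune (hp : IsPair par v A u a) (h : IsGood par r v A d) :
    #(prune par u a A) + 3 ≤ #A := by
  obtain ⟨c, hc⟩ := card_pos.1 hp.inner_a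
  rw [mem_children] at hc
  have hca : c ≠ a := by
    rintro rfl
    have := h.rank c hc.1 (by omega)
    rw [hc.2] at this; simp at this
  have hcu : c ≠ u := by
    rintro rfl
    have := hp.par_u; have := hp.ne_a; omega
  have h1 : prune par u a A ⊆ ((A.erase u).erase a).erase c := by
    intro i hi
    simp only [prune, mem_filter, mem_erase] at hi ⊢
    refine ⟨?_, by tauto, by tauto, hi.1⟩
    rintro rfl; tauto
  have h2 := card_le_card h1
  have m1 := hp.mem_u
  have m2 : a ∈ A.erase u := mem_erase.2 ⟨hp.ne.symm, hp.mem_a⟩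
  have m3 : c ∈ (A.erase u).erase a := by simp [hca, hcu, hc.1]
  have e1 := card_erase_add_one m1
  have e2 := card_erase_add_one m2
  have e3 := card_erase_add_one m3
  omega

/-- The size bound survives because `3d` drops by three and at least three vertices go. The degree
bounds for `d - 1` follow from the bound `d - 3` on numbers of children that `N > d` provides. The
root loses the child `u` only. -/
theorem IsGood.prune (h : IsGood par r v A d) (hN : d < #(inner par v A))
    (hp : IsPair par v A u a) : IsGood par r v (prune par u a A) (d - 1) := by
  have hsub : ParentForest.prune par u a A ⊆ A := filter_subset _ _
  have hch : ∀ w, #(children par (ParentForest.prune par u a A) w) ≤ #(children par A w) := by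
    intro w
    refine card_le_card fun i hi => ?_
    rw [mem_children] at hi ⊢
    exact ⟨hsub hi.1, hi.2⟩
  have h3 := h.card_prune hp
  have hd := h.children_le_of_lt_inner hN hp.mem_a hp.ne_a
  have hvu : v ≠ u := by
    rintro rfl
    have := h.par_root; have := hp.par_u; omega
  refine ⟨?_, h.par_root, ?_, fun i hi => h.rank i (hsub hi), ?_, ?_, ?_, ?_⟩
  · simp [ParentForest.prune, h.root_mem, h.par_root, hvu, hp.ne_a.symm]
  · intro i hi h0
    have hi' := hi
    simp only [ParentForest.prune, mem_filter] at hi'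
    exact h.parent_mem_prune hp hi'.1 (by tauto) (by tauto) h0
  · have : children par (ParentForest.prune par u a A) v = (children par A v).erase u := by
      ext i
      simp only [mem_children, mem_erase, ParentForest.prune, mem_filter]
      have := hp.par_a
      have := hp.ne_a
      constructor
      · tauto
      · rintro ⟨h1, h2, h3⟩
        refine ⟨⟨h2, ?_⟩, h3⟩
        rintro (h | rfl | h | h)
        · exact h1 h
        · tauto
        · omega
        · omega
    rw [this, card_erase_of_mem (mem_children.2 ⟨hp.mem_u, hp.par_u⟩), h.card_root]
  · have := h.card_le
    omega
  · intro w hw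
    simp only [low, mem_filter] at hw
    have h4 := h.children_le_of_lt_inner hN (hsub hw.1) (by
      rintro rfl; exact hw.2.1 h.par_root)
    have := hch w
    omega
  · intro w hw hwv
    have h4 := h.children_le_of_lt_inner hN (hsub hw) hwv
    have := hch w
    omega

/-- The children of `u` and `a`. -/
def freed (par : ℕ → ℕ) (u a : ℕ) (A : Finset ℕ) : Finset ℕ := children par A u ∪ children par A a

/-- At most one child of `u` and at most `d - 3` children of `a`. This is just few enough for the `d
- 1` colours `1, …, d - 1` with one of them forbidden. -/
theorem IsGood.card_freed (h : IsGood par r v A d) (hN : d < #(inner par v A))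
    (hp : IsPair par v A u a) : #(freed par u a A) + 2 ≤ d := by
  have := card_union_le (children par A u) (children par A a)
  have := h.children_le_of_lt_inner hN hp.mem_a hp.ne_a
  have := hp.small_u
  rw [freed]; omega

/-- Every new edge contains the new colour `d` and no old edge does, so only the other ends of new
edges have to be compared: these are `0` at `u`, the colour of the parent at `a`, and the colours of
the freed vertices. If `a` has no parent, `par a - 1` is `0`, and avoiding the colour of vertex `0`
does no harm. -/
theorem IsHarm.extend {col col' : ℕ → ℕ} (h : IsGood par r v A d)
    (hp : IsPair par v A u a) (hc : IsHarm par v (prune par u a A) (d - 1) col) (hd : 1 ≤ d)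
    (hcol : ∀ i ∈ prune par u a A, col' i = col i) (hu : col' u = d) (ha : col' a = d)
    (hpos : ∀ i ∈ freed par u a A, 1 ≤ col' i)
    (hle : ∀ i ∈ freed par u a A, col' i + 1 ≤ d)
    (hne : ∀ i ∈ freed par u a A, col' i ≠ col (par a - 1))
    (hinj : ∀ i ∈ freed par u a A, ∀ j ∈ freed par u a A, col' i = col' j → i = j) :
    IsHarm par v A d col' := by
  have hvu : v ≠ u := by
    rintro rfl
    have := h.par_root; have := hp.par_u; omega
  have hv : v ∈ prune par u a A := by
    simp [prune, h.root_mem, h.par_root, hvu, hp.ne_a.symm]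
  have hv0 : col' v = 0 := by rw [hcol v hv, hc.root]
  have cases : ∀ i ∈ A, i ∈ prune par u a A ∨ i = u ∨ i = a ∨ i ∈ freed par u a A := by
    intro i hi
    simp only [prune, freed, mem_filter, mem_union, mem_children]
    tauto
  -- the colours of an edge
  have edge : ∀ i ∈ A, par i ≠ 0 →
      (i ∈ prune par u a A ∧ par i - 1 ∈ prune par u a A ∧ col' i = col i ∧
        col' (par i - 1) = col (par i - 1) ∧ col' i + 1 ≤ d ∧ col' (par i - 1) + 1 ≤ d) ∨
      (i = u ∧ col' i = d ∧ col' (par i - 1) = 0) ∨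
      (i = a ∧ col' i = d ∧ col' (par i - 1) = col (par a - 1) ∧ 1 ≤ col (par a - 1) ∧
        col (par a - 1) + 1 ≤ d) ∨
      (i ∈ freed par u a A ∧ col' (par i - 1) = d) := by
    intro i hi h0
    rcases cases i hi with h1 | rfl | rfl | h1
    · left
      have h1' := h1
      simp only [prune, mem_filter] at h1'
      have h2 := h.parent_mem_prune hp hi (by tauto) (by tauto) h0
      have := hc.le _ h1
      have := hc.le _ h2
      rw [hcol _ h1, hcol _ h2]
      refine ⟨h1, h2, rfl, rfl, by omega, by omega⟩
    · right; left
      rw [hp.par_u]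
      exact ⟨rfl, hu, hv0⟩
    · right; right; left
      -- The parent of `a` is not removed: were it `u`, the children of `a` would be grandchildren
      -- of `u`, and `u` would have two descendants; and `a` is not its own parent because of the
      -- ranks.
      have h2 := h.parent_mem_prune hp hi (fun h' => ?_) (fun h' => ?_) h0
      · have := hp.par_a
        have := hc.le _ h2
        exact ⟨rfl, ha, hcol _ h2, hc.pos _ h2 (by omega), by omega⟩
      · have h1 : i ∈ children par A u := mem_children.2 ⟨hi, h'⟩
        have h2 : #(children par A i) ≤ grand par A u :=
          single_le_sum (f := fun i => #(children par A i)) (fun _ _ => Nat.zero_le _) h1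
        have h3 : 1 ≤ #(children par A u) := card_pos.2 ⟨_, h1⟩
        have := hp.small_u
        have := hp.inner_a
        omega
      · have := h.rank i hi h0
        rw [h'] at this; simp at this
    · right; right; right
      refine ⟨h1, ?_⟩
      simp only [freed, mem_union, mem_children] at h1
      rcases h1 with h1 | h1
      · rw [h1.2]; exact hu
      · rw [h1.2]; exact ha
  refine ⟨hv0, ?_, ?_, ?_, ?_⟩
  · intro i hi hiv
    rcases cases i hi with h1 | rfl | rfl | h1
    · rw [hcol i h1]; exact hc.pos i h1 hiv
    · omega
    · omega
    · exact hpos i h1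
  · intro i hi
    rcases cases i hi with h1 | rfl | rfl | h1
    · rw [hcol i h1]; have := hc.le i h1; omega
    · omega
    · omega
    · have := hle i h1; omega
  · intro i hi h0
    rcases edge i hi h0 with h1 | h1 | h1 | h1
    · rw [h1.2.2.1, h1.2.2.2.1]; exact hc.proper i h1.1 h0
    · omega
    · omega
    · have := hle i h1.1; omega
  · intro i hi j hj hi0 hj0 hij
    rw [Sym2.eq_iff] at hij
    -- Each edge is old, the one above `u`, the one above `a`, or one above a freed vertex. Only
    -- pairs of the same kind can agree in colours, and then they are equal.
    rcases edge i hi hi0 with h1 | h1 | h1 | h1 <;> rcases edge j hj hj0 with h2 | h2 | h2 | h2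
    · refine hc.inj i h1.1 j h2.1 hi0 hj0 ?_
      rwa [← h1.2.2.1, ← h1.2.2.2.1, ← h2.2.2.1, ← h2.2.2.2.1, Sym2.eq_iff]
    · omega
    · omega
    · omega
    · omega
    · rw [h1.1, h2.1]
    · omega
    · have := hpos j h2.1; have := hle j h2.1; omega
    · omega
    · omega
    · rw [h1.1, h2.1]
    · have := hne j h2.1; have := hle j h2.1; omega
    · omega
    · have := hpos i h1.1; have := hle i h1.1; omega
    · have := hne i h1.1; have := hle i h1.1; omega
    · have := hle i h1.1; have := hle j h2.1
      exact hinj i h1.1 j h2.1 (by omega)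

end ParentForest

/-! ### Greedy colouring of the remaining leaves -/

namespace ParentForest

open Finset

/-- The vertices of `low par v A` whose edge to the parent meets the colour `X`; vertices of
colour `0` are not yet coloured. -/
def meets (par : ℕ → ℕ) (v : ℕ) (A : Finset ℕ) (col : ℕ → ℕ) (X : ℕ) : Finset ℕ :=
  {j ∈ low par v A | col j = X ∨ col (par j - 1) = X}

/-- A partial harmonious colouring, where colour `0` stands for an uncoloured vertex (unless the
vertex is the root), with room to colour the remaining leaves. -/
structure IsPartial (par : ℕ → ℕ) (v : ℕ) (A : Finset ℕ) (d : ℕ) (col : ℕ → ℕ) : Prop where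
  root : col v = 0
  le : ∀ i ∈ A, col i ≤ d
  parent : ∀ i ∈ low par v A, col (par i - 1) ≠ 0
  pos : ∀ i ∈ A, i ≠ v → i ∉ low par v A → col i ≠ 0
  proper : ∀ i ∈ A, col i ≠ 0 → par i ≠ 0 → col i ≠ col (par i - 1)
  inj : ∀ i ∈ A, ∀ j ∈ A, col i ≠ 0 → col j ≠ 0 → par i ≠ 0 → par j ≠ 0 →
    s(col i, col (par i - 1)) = s(col j, col (par j - 1)) → i = j
  room : ∀ X, 1 ≤ X → X ≤ d → #(meets par v A col X) + 1 ≤ d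

/-- The pair of colours `X`, `Y` appears on no edge outside the root. -/
def IsUnused (par : ℕ → ℕ) (v : ℕ) (A : Finset ℕ) (col : ℕ → ℕ) (X Y : ℕ) : Prop :=
  ∀ j ∈ low par v A, ¬ (col j = X ∧ col (par j - 1) = Y) ∧ ¬ (col j = Y ∧ col (par j - 1) = X)

variable {par r : ℕ → ℕ} {v d : ℕ} {A : Finset ℕ} {col : ℕ → ℕ}

theorem IsPartial.isHarm (hc : IsPartial par v A d col)
    (hall : ∀ i ∈ A, i ≠ v → col i ≠ 0) (h : IsGood par r v A d) :
    IsHarm par v A d col := by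
  have hv : ∀ i ∈ A, par i ≠ 0 → col i ≠ 0 := fun i hi h0 => hall i hi (by
    rintro rfl; exact h0 h.par_root)
  exact ⟨hc.root, fun i hi hiv => Nat.one_le_iff_ne_zero.2 (hall i hi hiv), hc.le,
    fun i hi h0 => hc.proper i hi (hv i hi h0) h0,
    fun i hi j hj hi0 hj0 => hc.inj i hi j hj (hv i hi hi0) (hv j hj hj0) hi0 hj0⟩

/-- Distinct neighbours of a colour. -/
theorem card_used {X : ℕ} {T : Finset ℕ}
    (hT : ∀ Y ∈ T, ¬ IsUnused par v A col X Y) (hX : X ≠ 0) (hXT : X ∉ T) (h0 : 0 ∉ T) :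
    #T ≤ #{j ∈ meets par v A col X | col j ≠ 0} := by
  have : ∀ Y ∈ T, ∃ j ∈ low par v A, (col j = X ∧ col (par j - 1) = Y) ∨
      (col j = Y ∧ col (par j - 1) = X) := by
    intro Y hY
    have := hT Y hY
    simp only [IsUnused] at this
    push Not at this
    obtain ⟨j, hj, h⟩ := this
    refine ⟨j, hj, ?_⟩
    tauto
  choose! f hf hf' using this
  refine card_le_card_of_injOn f (fun Y hY => ?_) (fun Y hY Z hZ hYZ => ?_)
  · have h1 := hf Y hY
    have hY0 : Y ≠ 0 := fun h => h0 (h ▸ hY)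
    simp only [coe_filter, Set.mem_ofPred_eq, meets, mem_filter]
    rcases hf' Y hY with h2 | h2
    · exact ⟨⟨h1, .inl h2.1⟩, by omega⟩
    · exact ⟨⟨h1, .inr h2.2⟩, by omega⟩
  · have h1 := hf' Y hY
    have h2 := hf' Z hZ
    rw [hYZ] at h1
    have hY : Y ≠ X := fun h => hXT (h ▸ hY)
    have hZ : Z ≠ X := fun h => hXT (h ▸ hZ)
    omega

/-- Colour `X` of the parent meets at most `d - 1` edges, and the edge above `i`, not yet coloured,
is one of them. So at most `d - 2` of the `d - 1` possible partners of `X` are used. -/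
theorem IsPartial.exists_unused (hc : IsPartial par v A d col) (h : IsGood par r v A d) {i : ℕ}
    (hi : i ∈ low par v A) (hi0 : col i = 0) :
    ∃ Y, 1 ≤ Y ∧ Y ≤ d ∧ Y ≠ col (par i - 1) ∧ IsUnused par v A col (col (par i - 1)) Y := by
  by_contra! hcon
  set X := col (par i - 1) with hX
  have hX0 : X ≠ 0 := hc.parent i hi
  have hXd : X ≤ d := hc.le _ (h.closed i (mem_filter.1 hi).1 (mem_filter.1 hi).2.1)
  have h1 : ∀ Y ∈ (Icc 1 d).erase X, ¬ IsUnused par v A col X Y := by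
    intro Y hY
    rw [mem_erase, mem_Icc] at hY
    exact hcon Y hY.2.1 hY.2.2 hY.1
  have h2 := card_used h1 hX0 (by simp) (by simp)
  have h3 : {j ∈ meets par v A col X | col j ≠ 0} ⊆ (meets par v A col X).erase i := by
    intro j hj
    simp only [mem_filter, mem_erase] at hj ⊢
    exact ⟨fun h => hj.2 (h ▸ hi0), hj.1⟩
  have h4 : i ∈ meets par v A col X := by simp [meets, hi, hX]
  have h5 := card_le_card h3
  have h6 := card_erase_add_one h4
  have h7 := hc.room X (by omega) hXd
  rw [card_erase_of_mem (by simp; omega), Nat.card_Icc] at h2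
  omega

/-- Only the colour `Y` gains an edge, so the point is that `Y` meets at most `d - 2` edges
beforehand. The maximality in `hmax` is needed only when some uncoloured vertex has a parent of
colour `Y`. -/
theorem IsPartial.update (hc : IsPartial par v A d col) (h : IsGood par r v A d) {i Y : ℕ}
    (hi : i ∈ low par v A) (hi0 : col i = 0)
    (hmax : ∀ j ∈ low par v A, col j = 0 →
      #(meets par v A col (col (par j - 1))) ≤ #(meets par v A col (col (par i - 1))))
    (hY1 : 1 ≤ Y) (hYd : Y ≤ d) (hYX : Y ≠ col (par i - 1))
    (hYu : IsUnused par v A col (col (par i - 1)) Y) :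
    IsPartial par v A d (Function.update col i Y) := by
  have hiA : i ∈ A := (mem_filter.1 hi).1
  have hip : par i ≠ 0 ∧ par i ≠ v + 1 := (mem_filter.1 hi).2
  have hlow : low par v A ⊆ A := filter_subset _ _
  have hiv : i ≠ v := by rintro rfl; exact hip.1 h.par_root
  -- an uncoloured vertex has no children
  have hpar : ∀ j ∈ A, par j ≠ 0 → par j - 1 ≠ i := by
    intro j hj h0 hji
    have : par j ≠ v + 1 := by omega
    exact hc.parent j (by simp [low, hj, h0, this]) (hji ▸ hi0)
  have hup : ∀ j ∈ A, par j ≠ 0 → Function.update col i Y (par j - 1) = col (par j - 1) :=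
    fun j hj h0 => Function.update_of_ne (hpar j hj h0) _ _
  have hX0 := hc.parent i hi
  set X := col (par i - 1) with hX
  have hXd : X ≤ d := hc.le _ (h.closed i hiA hip.1)
  have hroot : ∀ j ∈ A, par j ≠ 0 → par j - 1 = v ∨ j ∈ low par v A := by
    intro j hj h0
    by_cases hv : par j = v + 1
    · left; omega
    · right; simp [low, hj, h0, hv]
  have key : #(meets par v A col Y) + 2 ≤ d := by
    have hY2 := hc.room Y hY1 hYd
    by_contra hcon
    have hYeq : #(meets par v A col Y) + 1 = d := by omega
    -- If a leaf still waits at colour `Y`, maximality makes `X` meet `d - 1` edges too. No edge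
    -- meets both colours, as the pair is unused, so there would be `2d - 2` edges outside the root,
    -- against at most `2d - 3`. If none waits, the `d - 1` edges at `Y` are coloured and need
    -- distinct partners other than `X` and `Y`, of which there are `d - 2`.
    by_cases hex : ∃ j ∈ low par v A, col j = 0 ∧ col (par j - 1) = Y
    · obtain ⟨j, hj, hj0, hjY⟩ := hex
      have h1 := hmax j hj hj0
      rw [hjY] at h1
      have hdis : Disjoint (meets par v A col X) (meets par v A col Y) := by
        rw [Finset.disjoint_left]
        intro k hk hk'
        simp only [meets, mem_filter] at hk hk'
        have := hYu k hk.1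
        omega
      have h2 : meets par v A col X ∪ meets par v A col Y ⊆ low par v A :=
        union_subset (filter_subset _ _) (filter_subset _ _)
      have h3 := card_le_card h2
      rw [card_union_of_disjoint hdis] at h3
      have := h.card_low_le
      omega
    · push Not at hex
      have h1 : {j ∈ meets par v A col Y | col j ≠ 0} = meets par v A col Y := by
        refine filter_true_of_mem fun j hj h0 => ?_
        simp only [meets, mem_filter] at hj
        rcases hj.2 with h2 | h2
        · omega
        · exact hex j hj.1 h0 h2
      have h2 : meets par v A col Y ≤ {j ∈ low par v A | col j ≠ 0} := by
        rw [← h1]; exact filter_subset_filter _ (filter_subset _ _)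
      -- the other ends of the edges meeting `Y` have pairwise distinct colours
      have h3 : #(meets par v A col Y) ≤ #(((Icc 1 d).erase Y).erase X) := by
        -- One of the two colours is `Y`, so subtracting `Y` from the sum gives the other one.
        refine card_le_card_of_injOn (fun j => col j + col (par j - 1) - Y) ?_ ?_
        · intro j hj
          have hj' := (mem_filter.1 (h2 hj))
          simp only [mem_coe, meets, mem_filter] at hj
          have h4 := hc.le j (hlow hj.1)
          have h5 := hc.le _ (h.closed j (hlow hj.1) (by simp only [low, mem_filter] at hj; tauto))
          have h6 := hc.parent j hj.1
          have h7 := hYu j hj.1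
          have h8 := hc.proper j (hlow hj.1) hj'.2 (by simp only [low, mem_filter] at hj; tauto)
          simp only [coe_erase, Set.mem_sdiff, Set.mem_singleton_iff, mem_coe, mem_Icc]
          omega
        · intro j hj k hk hjk
          have hj' := (mem_filter.1 (h2 hj))
          have hk' := (mem_filter.1 (h2 hk))
          simp only [mem_coe, meets, mem_filter] at hj hk hjk
          refine hc.inj j (hlow hj.1) k (hlow hk.1) hj'.2 hk'.2
            (by simp only [low, mem_filter] at hj; tauto)
            (by simp only [low, mem_filter] at hk; tauto) ?_
          rw [Sym2.eq_iff]
          omega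
      rw [card_erase_of_mem (by simp; omega), card_erase_of_mem (by simp; omega),
        Nat.card_Icc] at h3
      omega
  refine ⟨?_, ?_, ?_, ?_, ?_, ?_, ?_⟩
  · rw [Function.update_of_ne hiv.symm, hc.root]
  · intro j hj
    rw [Function.update_apply]
    split_ifs
    exacts [hYd, hc.le j hj]
  · intro j hj
    have := (mem_filter.1 hj).2.1
    rw [hup j (hlow hj) this]
    exact hc.parent j hj
  · intro j hj hjv hjl
    rw [Function.update_of_ne (fun h' => hjl (by rw [h']; exact hi))]
    exact hc.pos j hj hjv hjl
  · intro j hj hj0 hjp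
    rw [hup j hj hjp]
    rw [Function.update_apply] at hj0 ⊢
    split_ifs at hj0 ⊢ with hji
    · rw [hji]; exact hYX
    · exact hc.proper j hj hj0 hjp
  · have new : ∀ k ∈ A, k ≠ i → par k ≠ 0 → s(Y, X) ≠ s(col k, col (par k - 1)) := by
      intro k hk hki hk0 heq
      rw [Sym2.eq_iff] at heq
      rcases hroot k hk hk0 with hv | hv
      · rw [hv, hc.root] at heq; omega
      · have := hYu k hv; omega
    intro j hj k hk hj0 hk0 hjp hkp
    rw [hup j hj hjp, hup k hk hkp]
    by_cases hji : j = i <;> by_cases hki : k = i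
    · intro _; rw [hji, hki]
    · rw [hji, Function.update_self, Function.update_of_ne hki]
      intro heq; exact absurd heq (new k hk hki hkp)
    · rw [hki, Function.update_self, Function.update_of_ne hji]
      intro heq; exact absurd heq.symm (new j hj hji hjp)
    · rw [Function.update_of_ne hji] at hj0 ⊢
      rw [Function.update_of_ne hki] at hk0 ⊢
      exact hc.inj j hj k hk hj0 hk0 hjp hkp
  · intro Z hZ1 hZd
    by_cases hZY : Z = Y
    · have h1 : meets par v A (Function.update col i Y) Z ⊆ insert i (meets par v A col Y) := by
        intro j hj
        simp only [meets, mem_filter, mem_insert] at hj ⊢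
        rw [hup j (hlow hj.1) (mem_filter.1 hj.1).2.1, Function.update_apply] at hj
        split_ifs at hj with hji
        · exact .inl hji
        · exact .inr (hZY ▸ hj)
      have h2 := card_le_card h1
      have := card_insert_le i (meets par v A col Y)
      omega
    · have h1 : meets par v A (Function.update col i Y) Z ⊆ meets par v A col Z := by
        intro j hj
        simp only [meets, mem_filter] at hj ⊢
        rw [hup j (hlow hj.1) (mem_filter.1 hj.1).2.1, Function.update_apply] at hj
        split_ifs at hj with hji
        · exact ⟨hj.1, .inr (hj.2.resolve_left fun h' => hZY h'.symm)⟩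
        · exact hj
      have h2 := card_le_card h1
      have := hc.room Z hZ1 hZd
      omega

end ParentForest

/-! ### The initial colouring of the vertices with children -/

namespace ParentForest

open Finset

/-- The position of `i` in the increasing enumeration of `S`, counted from `1`. -/
def pos (S : Finset ℕ) (i : ℕ) : ℕ := #{k ∈ S | k ≤ i}

theorem pos_le (S : Finset ℕ) (i : ℕ) : pos S i ≤ #S := card_le_card (filter_subset _ _)

theorem one_le_pos {S : Finset ℕ} {i : ℕ} (hi : i ∈ S) : 1 ≤ pos S i :=
  card_pos.2 ⟨i, by simp [hi]⟩

theorem pos_lt_pos {S : Finset ℕ} {i j : ℕ} (hj : j ∈ S) (hij : i < j) : pos S i < pos S j := by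
  refine card_lt_card ⟨fun k hk => ?_, fun hs => ?_⟩
  · simp only [mem_filter] at hk ⊢; exact ⟨hk.1, by omega⟩
  · have : j ∈ {k ∈ S | k ≤ i} := hs (by simp [hj])
    simp only [mem_filter] at this; omega

theorem pos_inj {S : Finset ℕ} {i j : ℕ} (hi : i ∈ S) (hj : j ∈ S) (h : pos S i = pos S j) :
    i = j := by
  rcases lt_trichotomy i j with h' | h' | h'
  · have := pos_lt_pos hj h'; omega
  · exact h'
  · have := pos_lt_pos hi h'; omega

/-- The children of the root that have children. -/
def innerRoots (par : ℕ → ℕ) (v : ℕ) (A : Finset ℕ) : Finset ℕ :=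
  {w ∈ children par A v | 1 ≤ #(children par A w)}

/-- The children of the root that have no children. -/
def leafRoots (par : ℕ → ℕ) (v : ℕ) (A : Finset ℕ) : Finset ℕ :=
  {w ∈ children par A v | #(children par A w) = 0}

/-- The vertices with children that are neither the root nor children of the root. -/
def deepInner (par : ℕ → ℕ) (v : ℕ) (A : Finset ℕ) : Finset ℕ :=
  {w ∈ A | w ≠ v ∧ par w ≠ v + 1 ∧ 1 ≤ #(children par A w)}

/-- The colouring of the vertices with children from which a harmonious colouring is built. -/
structure IsInitial (par : ℕ → ℕ) (v : ℕ) (A : Finset ℕ) (col : ℕ → ℕ) : Prop where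
  root : col v = 0
  innerRoots : ∀ i ∈ innerRoots par v A, col i = pos (innerRoots par v A) i
  leafRoots : ∀ i ∈ leafRoots par v A,
    col i = #(ParentForest.innerRoots par v A) + pos (leafRoots par v A) i
  deepInner : ∀ i ∈ deepInner par v A,
    col i = #(ParentForest.innerRoots par v A) + pos (deepInner par v A) i
  orphan : ∀ i ∈ A, i ≠ v → par i = 0 → #(children par A i) = 0 → col i = 1
  leaf : ∀ i ∈ low par v A, #(children par A i) = 0 → col i = 0

variable {par r : ℕ → ℕ} {v d : ℕ} {A : Finset ℕ} {col : ℕ → ℕ}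

/-- The families `leafRoots` and `deepInner` use the same colours. This is harmless, since a leaf
attached to the root lies on no edge but the one to the root, whose colour `0` marks that edge. Thus
vertices with children have distinct colours, and so do the children of the root. -/
theorem IsInitial.isPartial (hc : IsInitial par v A col) (h : IsGood par r v A d)
    (hN : #(inner par v A) ≤ d) : IsPartial par v A d col := by
  have hlow : low par v A ⊆ A := filter_subset _ _
  have hneRoot : ∀ i, par i ≠ 0 → i ≠ v := fun i hi hiv => hi (hiv ▸ h.par_root)
  have cardRoots : #(ParentForest.innerRoots par v A) + #(ParentForest.leafRoots par v A) = d := by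
    rw [← h.card_root, ← card_filter_add_card_filter_not (s := children par A v)
      (fun w => 1 ≤ #(children par A w))]
    congr 2
    ext i
    simp only [ParentForest.leafRoots, mem_filter]
    have : #(children par A i) = 0 ↔ ¬ 1 ≤ #(children par A i) := by omega
    rw [this]
  have cardInner : #(ParentForest.innerRoots par v A) + #(ParentForest.deepInner par v A) ≤ d := by
    rw [← card_union_of_disjoint]
    · refine (card_le_card fun i hi => ?_).trans hN
      simp only [ParentForest.innerRoots, ParentForest.deepInner, mem_union, mem_filter,
        mem_children, inner] at hi ⊢
      rcases hi with hi | hi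
      · exact ⟨hi.1.1, hneRoot i (by omega), hi.2⟩
      · exact ⟨hi.1, hi.2.1, hi.2.2.2⟩
    · rw [Finset.disjoint_left]
      intro i hi hi'
      simp only [ParentForest.innerRoots, ParentForest.deepInner, mem_filter,
        mem_children] at hi hi'
      exact hi'.2.2.1 hi.1.2
  have hd : 1 ≤ d := by have := h.card_le; omega
  have cases : ∀ i ∈ A, i = v ∨ i ∈ ParentForest.innerRoots par v A ∨
      i ∈ ParentForest.leafRoots par v A ∨ i ∈ ParentForest.deepInner par v A ∨
      (i ≠ v ∧ par i = 0 ∧ #(children par A i) = 0) ∨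
      (i ∈ low par v A ∧ #(children par A i) = 0) := by
    intro i hi
    have : 1 ≤ #(children par A i) ∨ #(children par A i) = 0 := by omega
    simp only [ParentForest.innerRoots, ParentForest.leafRoots, ParentForest.deepInner, mem_filter,
      mem_children, low]
    tauto
  -- vertices with children have pairwise distinct colours
  have bounds : ∀ i ∈ inner par v A, (i ∈ ParentForest.innerRoots par v A ∧
        1 ≤ col i ∧ col i ≤ #(ParentForest.innerRoots par v A)) ∨
      (i ∈ ParentForest.deepInner par v A ∧ #(ParentForest.innerRoots par v A) < col i ∧
        col i ≤ d) := by
    intro i hi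
    simp only [inner, mem_filter] at hi
    by_cases hr : par i = v + 1
    · have h1 : i ∈ ParentForest.innerRoots par v A := by
        simp only [ParentForest.innerRoots, mem_filter, mem_children]; exact ⟨⟨hi.1, hr⟩, hi.2.2⟩
      left
      rw [hc.innerRoots i h1]
      exact ⟨h1, one_le_pos h1, pos_le _ _⟩
    · have h1 : i ∈ ParentForest.deepInner par v A := by
        simp only [ParentForest.deepInner, mem_filter]; exact ⟨hi.1, hi.2.1, hr, hi.2.2⟩
      right
      rw [hc.deepInner i h1]
      have := one_le_pos h1
      have := pos_le (ParentForest.deepInner par v A) i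
      exact ⟨h1, by omega, by omega⟩
  have innerInj : ∀ i ∈ inner par v A, ∀ j ∈ inner par v A, col i = col j → i = j := by
    intro i hi j hj hij
    rcases bounds i hi with h1 | h1 <;> rcases bounds j hj with h2 | h2
    · rw [hc.innerRoots i h1.1, hc.innerRoots j h2.1] at hij
      exact pos_inj h1.1 h2.1 hij
    · omega
    · omega
    · rw [hc.deepInner i h1.1, hc.deepInner j h2.1] at hij
      exact pos_inj h1.1 h2.1 (by omega)
  have rootInj : ∀ i ∈ children par A v, ∀ j ∈ children par A v, col i = col j → i = j := by
    have rcases' : ∀ i ∈ children par A v, i ∈ ParentForest.innerRoots par v A ∨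
        i ∈ ParentForest.leafRoots par v A := by
      intro i hi
      simp only [ParentForest.innerRoots, ParentForest.leafRoots, mem_filter, hi, true_and]
      omega
    intro i hi j hj hij
    rcases rcases' i hi with h1 | h1 <;> rcases rcases' j hj with h2 | h2
    · rw [hc.innerRoots i h1, hc.innerRoots j h2] at hij
      exact pos_inj h1 h2 hij
    · rw [hc.innerRoots i h1, hc.leafRoots j h2] at hij
      have := pos_le (ParentForest.innerRoots par v A) i
      have := one_le_pos h2
      omega
    · rw [hc.leafRoots i h1, hc.innerRoots j h2] at hij
      have := pos_le (ParentForest.innerRoots par v A) j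
      have := one_le_pos h1
      omega
    · rw [hc.leafRoots i h1, hc.leafRoots j h2] at hij
      exact pos_inj h1 h2 (by omega)
  have parentInner : ∀ i ∈ low par v A, par i - 1 ∈ inner par v A := by
    intro i hi
    simp only [low, mem_filter] at hi
    simp only [inner, mem_filter]
    refine ⟨h.closed i hi.1 hi.2.1, by omega, card_pos.2 ⟨i, mem_children.2 ⟨hi.1, by omega⟩⟩⟩
  have innerPos : ∀ i ∈ inner par v A, col i ≠ 0 := fun i hi => by
    rcases bounds i hi with h1 | h1 <;> omega
  have lowInner : ∀ i ∈ low par v A, col i ≠ 0 → i ∈ inner par v A := by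
    intro i hi hi0
    have h1 : #(children par A i) ≠ 0 := fun h0 => hi0 (hc.leaf i hi h0)
    simp only [low, mem_filter] at hi
    simp only [inner, mem_filter]
    exact ⟨hi.1, hneRoot i hi.2.1, by omega⟩
  have pcases : ∀ i ∈ A, par i ≠ 0 → (i ∈ children par A v ∧ par i - 1 = v) ∨ i ∈ low par v A := by
    intro i hi h0
    by_cases hv : par i = v + 1
    · left; exact ⟨mem_children.2 ⟨hi, hv⟩, by omega⟩
    · right; simp [low, hi, h0, hv]
  refine ⟨hc.root, ?_, fun i hi => innerPos _ (parentInner i hi), ?_, ?_, ?_, ?_⟩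
  · intro i hi
    rcases cases i hi with rfl | h1 | h1 | h1 | h1 | h1
    · rw [hc.root]; omega
    · rw [hc.innerRoots i h1]
      have := pos_le (ParentForest.innerRoots par v A) i; omega
    · rw [hc.leafRoots i h1]
      have := pos_le (ParentForest.leafRoots par v A) i; omega
    · rw [hc.deepInner i h1]
      have := pos_le (ParentForest.deepInner par v A) i; omega
    -- An isolated vertex lies on no edge and may take any colour except `0`.
    · rw [hc.orphan i hi h1.1 h1.2.1 h1.2.2]; exact hd
    · rw [hc.leaf i h1.1 h1.2]; omega
  · intro i hi hiv hil
    rcases cases i hi with h1 | h1 | h1 | h1 | h1 | h1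
    · exact absurd h1 hiv
    · rw [hc.innerRoots i h1]
      have := one_le_pos h1; omega
    · rw [hc.leafRoots i h1]
      have := one_le_pos h1; omega
    · rw [hc.deepInner i h1]
      have := one_le_pos h1; omega
    · rw [hc.orphan i hi h1.1 h1.2.1 h1.2.2]; omega
    · exact absurd h1.1 hil
  · intro i hi hi0 hp heq
    rcases pcases i hi hp with h1 | h1
    · rw [h1.2, hc.root] at heq; omega
    · have h2 := innerInj i (lowInner i h1 hi0) _ (parentInner i h1) heq
      have := h.rank i hi hp
      rw [← h2] at this
      omega
  · intro i hi j hj hi0 hj0 hip hjp heq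
    rw [Sym2.eq_iff] at heq
    rcases pcases i hi hip with h1 | h1 <;> rcases pcases j hj hjp with h2 | h2
    · rw [h1.2, h2.2, hc.root] at heq
      exact rootInj i h1.1 j h2.1 (by omega)
    · rw [h1.2, hc.root] at heq
      have := innerPos _ (parentInner j h2)
      omega
    · rw [h2.2, hc.root] at heq
      have := innerPos _ (parentInner i h1)
      omega
    · have ii := lowInner i h1 hi0
      have jj := lowInner j h2 hj0
      have pi := parentInner i h1
      have pj := parentInner j h2
      rcases heq with heq | heq
      · exact innerInj i ii j jj heq.1
      -- If the colours agree crosswise, `i` and `j` are each other's parents, which the ranks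
      -- forbid.
      · have e1 := innerInj i ii _ pj heq.1
        have e2 := innerInj _ pi j jj heq.2
        have r1 := h.rank i hi hip
        have r2 := h.rank j hj hjp
        rw [e2] at r1
        rw [← e1] at r2
        omega
  · intro X hX1 hXd
    -- A colour meets edges outside the root only at the one vertex `w` with children that carries
    -- it: the edges to the children of `w`, and the edge above `w` if `w` is not adjacent to the
    -- root. The two degree bounds of `IsGood` cover these two cases.
    by_cases hex : ∃ w ∈ inner par v A, col w = X
    · obtain ⟨w, hw, hwX⟩ := hex
      have hw' := hw
      simp only [inner, mem_filter] at hw'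
      have h1 : ∀ j ∈ meets par v A col X, j = w ∧ w ∈ low par v A ∨ j ∈ children par A w := by
        intro j hj
        simp only [meets, mem_filter] at hj
        rcases hj.2 with h2 | h2
        · left
          have := innerInj j (lowInner j hj.1 (by omega)) w hw (by omega)
          exact ⟨this, this ▸ hj.1⟩
        · right
          have := innerInj _ (parentInner j hj.1) w hw (by omega)
          rw [mem_children]
          exact ⟨hlow hj.1, by have := (mem_filter.1 hj.1).2.1; omega⟩
      by_cases hwl : w ∈ low par v A
      · have h2 : meets par v A col X ⊆ insert w (children par A w) := fun j hj => by
          rw [mem_insert]; exact (h1 j hj).imp And.left id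
        have := card_le_card h2
        have := card_insert_le w (children par A w)
        have := h.deg_low w hwl
        omega
      · have h2 : meets par v A col X ⊆ children par A w := fun j hj =>
          (h1 j hj).resolve_left fun h' => hwl h'.2
        have := card_le_card h2
        have := h.deg_le w hw'.1 hw'.2.1
        omega
    · have : meets par v A col X = ∅ := by
        rw [meets, filter_eq_empty_iff]
        rintro j hj (h1 | h1)
        · exact hex ⟨j, lowInner j hj (by omega), h1⟩
        · exact hex ⟨_, parentInner j hj, h1⟩
      rw [this]
      simpa using hd

end ParentForest

/-! ### Graph-theoretic facts -/

namespace SimpleGraph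

variable {V : Type*} {G : SimpleGraph V}

theorem Coloring.IsHarmonious.injOn_neighborSet {α : Type*} {C : G.Coloring α}
    (hC : C.IsHarmonious) (u : V) : Set.InjOn C (G.neighborSet u) := by
  intro x hx y hy hxy
  have := hC s(u, x) hx s(u, y) hy (by simp [hxy])
  rw [Sym2.eq_iff] at this
  rcases this with h | h
  · exact h.2
  · rw [h.2, ← h.1]

theorem Coloring.IsHarmonious.degree_lt [Fintype V] [DecidableRel G.Adj] {k : ℕ}
    {C : G.Coloring (Fin k)} (hC : C.IsHarmonious) (u : V) : G.degree u < k := by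
  classical
  have h1 : ((G.neighborFinset u).image C) ⊆ Finset.univ.erase (C u) := by
    intro c hc
    simp only [Finset.mem_image, mem_neighborFinset] at hc
    obtain ⟨x, hx, rfl⟩ := hc
    simpa using (C.valid hx).symm
  have h2 := Finset.card_le_card h1
  rw [Finset.card_image_of_injOn (by simpa using hC.injOn_neighborSet u),
    Finset.card_erase_of_mem (Finset.mem_univ _), Finset.card_univ, Fintype.card_fin,
    card_neighborFinset_eq_degree] at h2
  have : 0 < k := (C u).pos
  omega

/-- The neighbours of `u` have distinct colours other than that of `u`; by counting, they exhaust
these. -/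
theorem Coloring.IsHarmonious.exists_adj [Fintype V] [DecidableRel G.Adj] {k : ℕ}
    {C : G.Coloring (Fin k)} (hC : C.IsHarmonious) {u : V} (hu : k ≤ G.degree u + 1) {c : Fin k}
    (hc : c ≠ C u) : ∃ x, G.Adj u x ∧ C x = c := by
  classical
  have h1 : ((G.neighborFinset u).image C) ⊆ Finset.univ.erase (C u) := by
    intro c hc
    simp only [Finset.mem_image, mem_neighborFinset] at hc
    obtain ⟨x, hx, rfl⟩ := hc
    simpa using (C.valid hx).symm
  have h2 := Finset.eq_of_subset_of_card_le h1 (by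
    rw [Finset.card_image_of_injOn (by simpa using hC.injOn_neighborSet u),
      Finset.card_erase_of_mem (Finset.mem_univ _), Finset.card_univ, Fintype.card_fin,
      card_neighborFinset_eq_degree]
    omega)
  have h3 : c ∈ (G.neighborFinset u).image C := by rw [h2]; simpa using hc
  simpa using h3

/-- With `d + 1` colours both vertices see all colours but their own. If their colours agree, any
neighbour of `v` has a counterpart of its colour at `u`; if they differ, each vertex has a neighbour
with the colour of the other. Either way two edges share a pair of colours, and edges at `u` and at
`v` are different. -/
theorem Coloring.IsHarmonious.add_two_le [Fintype V] [DecidableRel G.Adj] {k d : ℕ}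
    {C : G.Coloring (Fin k)} (hC : C.IsHarmonious) {u v : V} (huv : u ≠ v) (hadj : ¬ G.Adj u v)
    (hu : G.degree u = d) (hv : G.degree v = d) (hd : 0 < d) : d + 2 ≤ k := by
  by_contra hk
  have h1 := hC.degree_lt u
  have hsame : ∀ x y, G.Adj u x → G.Adj v y → s(C u, C x) ≠ s(C v, C y) := by
    intro x y hx hy heq
    have := hC s(u, x) hx s(v, y) hy (by simpa using heq)
    rw [Sym2.eq_iff] at this
    rcases this with h | ⟨rfl, rfl⟩
    · exact huv h.1
    · exact hadj hx
  by_cases hc : C u = C v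
  · obtain ⟨y, hy⟩ := (G.degree_pos_iff_exists_adj v).1 (by omega)
    obtain ⟨x, hx, hxy⟩ := hC.exists_adj (u := u) (c := C y) (by omega)
      (by rw [hc]; exact (C.valid hy).symm)
    exact hsame x y hx hy (by rw [hc, hxy])
  · obtain ⟨x, hx, hxv⟩ := hC.exists_adj (u := u) (c := C v) (by omega) (Ne.symm hc)
    obtain ⟨y, hy, hyu⟩ := hC.exists_adj (u := v) (c := C u) (by omega) hc
    exact hsame x y hx hy (by rw [hxv, hyu, Sym2.eq_swap])

/-- Every set of vertices of a finite forest that contains more than the vertex `v` contains a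
vertex other than `v` with at most one neighbour in the set. -/
theorem IsAcyclic.exists_subsingleton_neighbors [Finite V] (hG : G.IsAcyclic) (v : V) {U : Set V}
    (hU : ∃ w ∈ U, w ≠ v) :
    ∃ w ∈ U, w ≠ v ∧ ∀ x ∈ U, ∀ y ∈ U, G.Adj w x → G.Adj w y → x = y := by
  classical
  have : Nonempty V := ⟨v⟩
  -- Embedding the forest in a spanning tree makes distances and unique paths available. The wanted
  -- vertex is one of the set farthest from `v` in the tree.
  obtain ⟨T, hGT, -, hT⟩ := (connected_top (V := V)).exists_isTree_le_of_le_of_isAcyclic le_top hG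
  obtain ⟨w, ⟨hwU, hwv⟩, hmax⟩ := Set.exists_max_image {w | w ∈ U ∧ w ≠ v} (fun w => T.dist v w)
    (Set.toFinite _) hU
  refine ⟨w, hwU, hwv, ?_⟩
  obtain ⟨p, hp, hpu⟩ := hT.existsUnique_path v w
  -- A neighbour `x` of `w` in the set is nearer to `v`. A shortest path to `x`, prolonged by `w`,
  -- is then the unique path from `v` to `w`, which determines `x`.
  have key : ∀ x ∈ U, T.Adj w x → x = p.penultimate := by
    intro x hx hwx
    have hlt : T.dist v x < T.dist v w := by
      refine lt_of_le_of_ne ?_ (hT.dist_ne_of_adj v hwx).symm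
      by_cases hxv : x = v
      · subst hxv; simp
      · exact hmax x ⟨hx, hxv⟩
    obtain ⟨q, hq, hql⟩ := hT.connected.exists_path_of_dist v x
    have hwq : w ∉ q.support := by
      intro hw
      have h1 := T.dist_le (q.takeUntil w hw)
      have h2 := q.length_takeUntil_le_length hw
      omega
    rw [← hpu (q.concat hwx.symm) (hq.concat hwq hwx.symm)]; simp
  intro x hx y hy hwx hwy
  rw [key x hx (hGT hwx), key y hy (hGT hwy)]

end SimpleGraph

/-! ### From a graph with parents to a good rooted forest -/

namespace ParentForest

open Finset

/-- Here `f` is `0` or `1` and says whether the extra leaf `n` is attached to `v`. Without it every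
vertex of degree `D` is `v` or adjacent to `v`; with it `v` has degree `D + 1`. In both cases a
non-neighbour of `v` has degree less than that of `v`. -/
theorem isGood_of_adj {n v D f : ℕ} {adj : ℕ → ℕ → Prop} [∀ i j, Decidable (adj i j)]
    {par r : ℕ → ℕ} {A : Finset ℕ}
    (hv : v < n) (hpv : par v = 0)
    (hadj : ∀ i < n, ∀ j < n, adj i j ↔ par i = j + 1 ∨ par j = i + 1)
    (hpar : ∀ i < n, par i ≠ 0 → par i - 1 < n ∧ r (par i - 1) < r i)
    (hA : ∀ i, i ∈ A ↔ i < n + f) (hf : f ≤ 1) (hfn : f = 1 → par n = v + 1)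
    (hdv : #{j ∈ range n | adj v j} = D) (hD : ∀ i < n, #{j ∈ range n | adj i j} ≤ D)
    (hf0 : f = 0 → ∀ i < n, i ≠ v → #{j ∈ range n | adj i j} = D → adj v i)
    (hn : n + 2 ≤ 3 * D) :
    IsGood par (Function.update r n (r v + 1)) v A (D + f) := by
  have hAr : A = range (n + f) := by ext i; simp [hA]
  -- Neighbours are the children together with the parent, if any; ranks exclude that a vertex is
  -- both.
  have hdeg : ∀ i < n, #{j ∈ range n | adj i j} =
      #{j ∈ range n | par j = i + 1} + if par i = 0 then 0 else 1 := by
    intro i hi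
    have h1 : {j ∈ range n | adj i j} =
        {j ∈ range n | par j = i + 1} ∪ {j ∈ range n | par i = j + 1} := by
      ext j
      simp only [mem_filter, mem_union, mem_range]
      constructor
      · rintro ⟨hj, h⟩
        have := (hadj i hi j hj).1 h; tauto
      · rintro (h | h)
        · exact ⟨h.1, (hadj i hi j h.1).2 (.inr h.2)⟩
        · exact ⟨h.1, (hadj i hi j h.1).2 (.inl h.2)⟩
    rw [h1, card_union_of_disjoint]
    · congr 1
      split_ifs with h0
      · rw [card_eq_zero, filter_eq_empty_iff]; intro j _; omega
      · rw [card_eq_one]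
        refine ⟨par i - 1, ?_⟩
        ext j
        have := (hpar i hi h0).1
        simp only [mem_filter, mem_range, mem_singleton]; omega
    · rw [Finset.disjoint_left]
      intro j hj hj'
      simp only [mem_filter, mem_range] at hj hj'
      have h2 := (hpar i hi (by omega)).2
      have h3 := (hpar j hj.1 (by omega)).2
      rw [hj.2] at h3; rw [hj'.2] at h2
      simp at h2 h3; omega
  have hch : ∀ w, w ≠ v → #(children par A w) ≤ #{j ∈ range n | par j = w + 1} := by
    intro w hw
    refine card_le_card fun j hj => ?_
    simp only [mem_children, hA, mem_filter, mem_range] at hj ⊢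
    refine ⟨?_, hj.2⟩
    by_contra hjn
    obtain rfl : j = n := by omega
    have := hfn (by omega); omega
  have hchv : #(children par A v) = #{j ∈ range n | par j = v + 1} + f := by
    interval_cases f
    · rw [hAr]; rfl
    · have : children par A v = insert n {j ∈ range n | par j = v + 1} := by
        ext j
        simp only [mem_children, hA, mem_insert, mem_filter, mem_range]
        have := hfn rfl
        constructor
        · rintro ⟨h1, h2⟩
          by_cases h3 : j = n
          · exact .inl h3
          · exact .inr ⟨by omega, h2⟩
        · rintro (rfl | ⟨h1, h2⟩)
          · exact ⟨by omega, this⟩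
          · exact ⟨by omega, h2⟩
      rw [this, card_insert_of_notMem (by simp)]
  have hup : ∀ i < n, Function.update r n (r v + 1) i = r i := fun i hi =>
    Function.update_of_ne (by omega) _ _
  have hlt : ∀ w < n, w ≠ v → par w ≠ v + 1 → #{j ∈ range n | adj w j} + 1 ≤ D + f := by
    intro w hw hwv hwp
    have h1 := hD w hw
    by_cases h0 : f = 0
    · have h2 : #{j ∈ range n | adj w j} ≠ D := fun h => by
        have := (hadj v hv w hw).1 (hf0 h0 w hw hwv h)
        omega
      omega
    · omega
  refine ⟨?_, hpv, ?_, ?_, ?_, ?_, ?_, ?_⟩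
  · rw [hA]; omega
  · intro i hi h0
    rw [hA] at hi ⊢
    by_cases hin : i < n
    · have := (hpar i hin h0).1; omega
    · obtain rfl : i = n := by omega
      rw [hfn (by omega)]; simp; omega
  · intro i hi h0
    rw [hA] at hi
    by_cases hin : i < n
    · obtain ⟨h1, h2⟩ := hpar i hin h0
      rw [hup i hin, hup _ h1]; exact h2
    · obtain rfl : i = n := by omega
      rw [hfn (by omega)]
      simp only [Nat.add_sub_cancel, Function.update_self]
      rw [hup v hv]; omega
  · have := hdeg v hv
    rw [if_pos hpv] at this
    omega
  · rw [hAr, card_range]; omega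
  · intro w hw
    simp only [low, mem_filter, hA] at hw
    have hwn : w < n := by
      by_contra hwn
      obtain rfl : w = n := by omega
      exact hw.2.2 (hfn (by omega))
    have hwv : w ≠ v := fun h => hw.2.1 (h ▸ hpv)
    have h1 := hdeg w hwn
    rw [if_neg hw.2.1] at h1
    have := hch w hwv
    have := hlt w hwn hwv hw.2.2
    omega
  · intro w hw hwv
    rw [hA] at hw
    by_cases hwn : w < n
    · have h1 := hdeg w hwn
      have h2 := hch w hwv
      by_cases h0 : par w = 0
      · rw [if_pos h0] at h1
        have := hlt w hwn hwv (by omega)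
        omega
      · rw [if_neg h0] at h1
        have := hD w hwn
        omega
    · obtain rfl : w = n := by omega
      have h1 : #(children par A w) = 0 := by
        refine Nat.le_zero.1 ((hch w hwv).trans (le_of_eq ?_))
        rw [card_eq_zero, filter_eq_empty_iff]
        intro j hj hjw
        have := (hpar j (mem_range.1 hj) (by omega)).1
        rw [hjw] at this
        simp at this
      omega

end ParentForest

namespace RAM

open Cmd

infixr:55 " ;; " => Cmd.seq

/-! ### The colouring program

Use of the arrays; a variable is cell `0` of an array.

* `0`: the variable `n`; `1`: the adjacency matrix; `2`: the colours; `3`: the numbers `n * i`;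
* `4`: the degrees; `5`, `6`: the root, a vertex of maximum degree, and its degree; `7`: whether
  another vertex of maximum degree is not adjacent to the root, in which case a further vertex `n`
  is attached to the root;
* `8`: the parents; `9`: the vertices that have not been removed; `10`, `11`: the numbers of
  children and of grandchildren; `12`: the number of vertices with children;
* `13`, `14`, `15`: for each colour, the pair of vertices removed with it, and for each vertex, the
  colour with which it was removed; `16`: marks; `17`, `18`: the current and the full number of
  colours other than that of the root;
* from `20` on: loop counters and auxiliary values.
-/

/-- The adjacency relation of a graph on `0, …, n - 1`, as a relation on natural numbers. -/
def natAdj {n : ℕ} (G : SimpleGraph (Fin n)) (i j : ℕ) : Prop :=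
  ∃ i' j' : Fin n, G.Adj i' j' ∧ (i' : ℕ) = i ∧ (j' : ℕ) = j

/-- Are the vertices stored in the variables `a` and `b` adjacent? -/
def adjE (a b : ℕ) : Expr :=
  .and (.and (.lt (.var a) (.var 0)) (.lt (.var b) (.var 0)))
    (.get 1 (.add (.get 3 (.var a)) (.var b)))

/-- Store the multiples of `n` in array `3`. -/
def rowsCmd : Cmd :=
  .loop 20 (.set 3 (.add (.var 20) (.const 1)) (.add (.get 3 (.var 20)) (.var 0)))

/-- Store the degrees in array `4`. -/
def degCmd : Cmd := .loop 20 (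
  .set 30 (.const 0) (.const 0) ;;
  .loop 21 (.set 30 (.const 0) (.add (.var 30) (adjE 20 21))) ;;
  .set 4 (.var 20) (.var 30))

/-- Store a vertex of maximum degree in variable `5` and its degree in variable `6`. -/
def maxCmd : Cmd := .loop 20 (
  .ite (.lt (.var 6) (.get 4 (.var 20)))
    (.set 6 (.const 0) (.get 4 (.var 20)) ;; .set 5 (.const 0) (.var 20))
    .skip)

/-- Set variable `7` to `1` if there is a second vertex of maximum degree that is not adjacent to
the first, and store the number of colours (other than `0`) in variable `17`. -/
def flagCmd : Cmd :=
  .loop 20 (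
    .ite (.and (.eq (.get 4 (.var 20)) (.var 6))
        (.and (.not (.eq (.var 20) (.var 5))) (.not (adjE 5 20))))
      (.set 7 (.const 0) (.add (.var 20) (.const 1)))
      .skip) ;;
  .ite (.var 7) (.set 7 (.const 0) (.const 1)) .skip ;;
  .set 17 (.const 0) (.add (.var 6) (.var 7))

/-- Among the vertices other than `5` not marked in array `16` find one (incremented by `1`, in
variable `31`) with at most one unmarked neighbour (incremented by `1`, in variable `32`). -/
def candCmd : Cmd := .loop 21 (
  .ite (.and (.and (.lt (.var 21) (.var 0)) (.not (.eq (.var 21) (.var 5))))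
      (.not (.get 16 (.var 21))))
    (.set 30 (.const 0) (.const 0) ;;
      .set 33 (.const 0) (.const 0) ;;
      .loop 22 (
        .ite (.and (adjE 21 22) (.not (.get 16 (.var 22))))
          (.set 30 (.const 0) (.add (.var 30) (.const 1)) ;;
            .set 33 (.const 0) (.add (.var 22) (.const 1)))
          .skip) ;;
      .ite (.lt (.var 30) (.const 2))
        (.set 31 (.const 0) (.add (.var 21) (.const 1)) ;; .set 32 (.const 0) (.var 33))
        .skip)
    .skip)

/-- Store parents (incremented by `1`) of the vertices in array `8`, for a rooted forest with the
root stored in variable `5`. -/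
def peelCmd : Cmd := .loop 20 (
  .set 31 (.const 0) (.const 0) ;;
  candCmd ;;
  .ite (.var 31)
    (.set 16 (.sub (.var 31) (.const 1)) (.const 1) ;;
      .set 8 (.sub (.var 31) (.const 1)) (.var 32))
    .skip)

/-- Mark the vertices in array `9`, and attach a new vertex to the root if variable `7` is set. -/
def aliveCmd : Cmd :=
  .loop 20 (.set 9 (.var 20) (.and (.lt (.var 20) (.var 0)) (.const 1))) ;;
  .set 9 (.var 0) (.var 7) ;;
  .ite (.var 7) (.set 8 (.var 0) (.add (.var 5) (.const 1))) .skip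

/-- The memory contains a graph and the table of multiples. -/
structure HasGraph {n : ℕ} (G : SimpleGraph (Fin n)) (s : State) : Prop where
  size : s 0 0 = n
  input : s 1 = graphInput G 1
  rows : ∀ k ≤ n, s 3 k = n * k

section
variable {n : ℕ} {G : SimpleGraph (Fin n)} {s : State}

theorem HasGraph.congr (h : HasGraph G s) {s' : State} (h0 : s' 0 = s 0) (h1 : s' 1 = s 1)
    (h3 : s' 3 = s 3) : HasGraph G s' :=
  ⟨by rw [h0, h.size], by rw [h1, h.input], by rw [h3]; exact h.rows⟩

theorem graphInput_one (i j : ℕ) (hi : i < n) (hj : j < n) :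
    graphInput G 1 (n * i + j) ≠ 0 ↔ natAdj G i j := by
  have : (∃ i' j' : Fin n, G.Adj i' j' ∧ n * i + j = n * (i' : ℕ) + (j' : ℕ)) ↔ natAdj G i j := by
    constructor
    · rintro ⟨i', j', h, he⟩
      have h1 : (n * i + j) / n = (n * (i' : ℕ) + (j' : ℕ)) / n := by rw [he]
      have hn : 0 < n := by omega
      rw [Nat.mul_add_div hn, Nat.mul_add_div hn, Nat.div_eq_of_lt hj, Nat.div_eq_of_lt j'.2] at h1
      simp only [add_zero] at h1
      refine ⟨i', j', h, h1.symm, ?_⟩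
      rw [h1] at he; omega
    · rintro ⟨i', j', h, rfl, rfl⟩
      exact ⟨i', j', h, rfl⟩
  rw [← this]
  simp only [graphInput]
  simp

/-- The range tests in `adjE` matter because loops run up to `n` inclusive: column `n` of row `i` is
the same cell as column `0` of row `i + 1`. -/
theorem HasGraph.holds_adjE (h : HasGraph G s) (a b : ℕ) :
    (adjE a b).Holds s ↔ natAdj G (s a 0) (s b 0) := by
  simp only [adjE, Expr.holds_and, Expr.holds_lt, Expr.holds_get, Expr.eval_var, Expr.eval_add,
    Expr.eval_get, h.size]
  constructor
  · rintro ⟨⟨h1, h2⟩, h3⟩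
    rwa [h.rows _ h1.le, h.input, graphInput_one _ _ h1 h2] at h3
  · intro h3
    obtain ⟨i', j', -, h1, h2⟩ := id h3
    have h1' : s a 0 < n := h1 ▸ i'.2
    have h2' : s b 0 < n := h2 ▸ j'.2
    refine ⟨⟨h1', h2'⟩, ?_⟩
    rwa [h.rows _ h1'.le, h.input, graphInput_one _ _ h1' h2']

open Classical in
theorem HasGraph.eval_adjE (h : HasGraph G s) (a b : ℕ) :
    (adjE a b).eval s = if natAdj G (s a 0) (s b 0) then 1 else 0 := by
  have := h.holds_adjE a b
  rw [adjE, Expr.holds_and] at this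
  rw [adjE, Expr.eval_and]
  simp only [this]

/-- The machine cannot multiply, so the addresses `n * i` are tabulated by repeated addition. -/
theorem rowsCmd_spec (h0 : s 0 0 = n) (h1 : s 1 = graphInput G 1) (h3 : s 3 0 = 0) :
    HasGraph G (rowsCmd.run s) := by
  refine ⟨?_, ?_, ?_⟩
  · rw [run_frame _ _ (by decide), h0]
  · rw [run_frame _ _ (by decide), h1]
  · have := loop_inv (a := 20)
      (P := .set 3 (.add (.var 20) (.const 1)) (.add (.get 3 (.var 20)) (.var 0)))
      (by simp [Valid, writes]) s (fun m t => ∀ k ≤ m, t 3 k = n * k) ?_ ?_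
    · intro k hk; exact this k (by omega)
    · intro k hk
      obtain rfl : k = 0 := by omega
      rw [State.write_of_ne _ _ _ (by decide)]; simpa using h3
    · intro j s' hj hb ha hi k hk
      rw [State.write_of_ne _ _ _ (by decide)]
      simp only [run, State.write_self, Expr.eval_add, Expr.eval_var, Expr.eval_const,
        Expr.eval_get, ha]
      rw [hb 0 (by decide), h0, Function.update_apply]
      split_ifs with hkj
      · rw [hi j le_rfl, hkj]; ring
      · exact hi k (by omega)

theorem natAdj_lt {i j : ℕ} (h : natAdj G i j) : i < n ∧ j < n := by
  obtain ⟨i', j', -, rfl, rfl⟩ := h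
  exact ⟨i'.2, j'.2⟩

theorem natAdj_symm {i j : ℕ} (h : natAdj G i j) : natAdj G j i := by
  obtain ⟨i', j', h, h1, h2⟩ := h
  exact ⟨j', i', h.symm, h2, h1⟩

theorem natAdj_ne {i j : ℕ} (h : natAdj G i j) : i ≠ j := by
  obtain ⟨i', j', h, rfl, rfl⟩ := h
  intro h'
  exact h.ne (Fin.ext h')

open Classical in
theorem sum_natAdj (k : ℕ) : ∑ j ∈ Finset.range (n + 1), (if natAdj G k j then 1 else 0) =
    ((Finset.range n).filter (natAdj G k)).card := by
  rw [Finset.sum_boole, Nat.cast_id]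
  congr 1
  ext j
  simp only [Finset.mem_filter, Finset.mem_range]
  constructor
  · rintro ⟨-, h⟩; exact ⟨(natAdj_lt h).2, h⟩
  · rintro ⟨h1, h2⟩; exact ⟨by omega, h2⟩

open Classical in
theorem degCmd_spec (h : HasGraph G s) {k : ℕ} (hk : k ≤ n) :
    degCmd.run s 4 k = ((Finset.range n).filter (natAdj G k)).card := by
  have := loop_map (a := 20) (c := 4) (P := .set 30 (.const 0) (.const 0) ;;
    .loop 21 (.set 30 (.const 0) (.add (.var 30) (adjE 20 21))) ;;
    .set 4 (.var 20) (.var 30)) (by simp [Valid, writes]) (by decide) s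
    (fun k => ((Finset.range n).filter (natAdj G k)).card) ?_
  · rw [degCmd, this]; simp [h.size, hk]
  · intro j s' hj hb ha _
    have hs' : HasGraph G (s'.write 30 0 0) := h.congr
      (by rw [State.write_of_ne _ _ _ (by decide), hb 0 (by decide)])
      (by rw [State.write_of_ne _ _ _ (by decide), hb 1 (by decide)])
      (by rw [State.write_of_ne _ _ _ (by decide), hb 3 (by decide)])
    have h2 := loop_sum (a := 21) (c := 30)
      (P := .set 30 (.const 0) (.add (.var 30) (adjE 20 21)))
      (by simp [Valid, writes]) (by decide) (s'.write 30 0 0)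
      (fun i => if natAdj G j i then 1 else 0) ?_
    · rw [State.write_self, Function.update_self, hs'.size, sum_natAdj, zero_add] at h2
      simp only [run_seq, run_set, State.write_self, Expr.eval_const, Expr.eval_var, h2]
      rw [run_frame _ _ (b := 4) (by decide), run_frame _ _ (b := 20) (by decide),
        State.write_of_ne _ _ _ (by decide), State.write_of_ne _ _ _ (by decide), ha]
    · intro i s'' hi hb' ha'
      have hs'' : HasGraph G s'' := hs'.congr (hb' 0 (by decide)) (hb' 1 (by decide))
        (hb' 3 (by decide))
      simp only [run, State.write_self, Expr.eval_add, Expr.eval_var, Expr.eval_const,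
        Function.update_self, hs''.eval_adjE, ha']
      rw [hb' 20 (by decide), State.write_of_ne _ _ _ (by decide), ha]

/-- The update happens only on a strict increase, so nothing is recorded if all degrees are `0`;
positivity of the maximum degree excludes this case later. -/
theorem maxCmd_spec (h0 : s 0 0 = n) (h5 : s 5 0 = 0) (h6 : s 6 0 = 0) :
    maxCmd.run s 5 0 ≤ n ∧ (∀ k ≤ n, s 4 k ≤ maxCmd.run s 6 0) ∧
      (maxCmd.run s 6 0 = 0 ∨ maxCmd.run s 6 0 = s 4 (maxCmd.run s 5 0)) := by
  have := loop_inv (a := 20) (P := .ite (.lt (.var 6) (.get 4 (.var 20)))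
    (.set 6 (.const 0) (.get 4 (.var 20)) ;; .set 5 (.const 0) (.var 20)) .skip)
    (by simp [Valid, writes]) s (fun m t => t 5 0 ≤ n ∧ (∀ k < m, s 4 k ≤ t 6 0) ∧
      (t 6 0 = 0 ∨ t 6 0 = s 4 (t 5 0))) ?_ ?_
  · refine ⟨this.1, fun k hk => this.2.1 k (by omega), this.2.2⟩
  · simp [State.write_of_ne, h5, h6]
  · intro j s' hj hb ha hi
    have h4 : s' 4 = s 4 := hb 4 (by decide)
    simp only [run_ite, run_seq, run_set, run_skip, Expr.holds_lt, Expr.eval_var, Expr.eval_get,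
      Expr.eval_const, ha, h4]
    split_ifs with hlt
    · simp only [State.write_self, State.write_of_ne, ne_eq,
        Nat.reduceEqDiff, not_false_eq_true, Function.update_self, ha]
      refine ⟨by omega, fun k hk => ?_, .inr trivial⟩
      rcases Nat.lt_succ_iff_lt_or_eq.1 hk with hk | rfl
      · have := hi.2.1 k hk; omega
      · exact le_rfl
    · simp only [State.write_of_ne, ne_eq, Nat.reduceEqDiff,
        not_false_eq_true]
      refine ⟨hi.1, fun k hk => ?_, hi.2.2⟩
      rcases Nat.lt_succ_iff_lt_or_eq.1 hk with hk | rfl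
      · exact hi.2.1 k hk
      · omega

open Classical in
theorem flagCmd_spec (h : HasGraph G s) (h7 : s 7 0 = 0) :
    flagCmd.run s 17 0 = s 6 0 + flagCmd.run s 7 0 ∧
    ((flagCmd.run s 7 0 = 0 ∧ ∀ k ≤ n, s 4 k = s 6 0 → k ≠ s 5 0 → natAdj G (s 5 0) k) ∨
      (flagCmd.run s 7 0 = 1 ∧ ∃ k ≤ n, s 4 k = s 6 0 ∧ k ≠ s 5 0 ∧ ¬ natAdj G (s 5 0) k)) := by
  have := loop_find (a := 20) (c := 7) (P := .ite (.and (.eq (.get 4 (.var 20)) (.var 6))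
        (.and (.not (.eq (.var 20) (.var 5))) (.not (adjE 5 20))))
      (.set 7 (.const 0) (.add (.var 20) (.const 1))) .skip)
    (by simp [Valid, writes]) (by decide) s
    (fun k => s 4 k = s 6 0 ∧ k ≠ s 5 0 ∧ ¬ natAdj G (s 5 0) k) h7 ?_
  · rw [h.size] at this
    simp only [flagCmd, run_seq]
    generalize hs1 : (Cmd.loop 20 _).run s = s1 at this ⊢
    have h6 : s1 6 = s 6 := by rw [← hs1]; exact run_frame _ _ (by decide)
    simp only [run_set, run_ite, run_skip, Expr.holds_var, Expr.eval_const, Expr.eval_add,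
      Expr.eval_var]
    rcases this with ⟨h1, h2⟩ | ⟨k, hk, hp, h1⟩
    · simp only [h1, ne_eq, not_true_eq_false, if_false, State.write_self, Function.update_self,
        State.write_of_ne, Nat.reduceEqDiff, not_false_eq_true, h6]
      refine ⟨trivial, .inl ⟨trivial, fun k hk h3 h4 => ?_⟩⟩
      by_contra h5
      exact h2 k hk ⟨h3, h4, h5⟩
    · simp only [h1, ne_eq, Nat.add_eq_zero_iff, one_ne_zero, and_false, not_false_eq_true, if_true,
        State.write_self, Function.update_self,
        State.write_of_ne, Nat.reduceEqDiff, h6]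
      exact ⟨trivial, .inr ⟨trivial, k, hk, hp⟩⟩
  · intro j s' hj hb ha
    have hs' : HasGraph G s' := h.congr (hb 0 (by decide)) (hb 1 (by decide)) (hb 3 (by decide))
    simp only [run_ite, run_set, run_skip, Expr.holds_and, Expr.holds_eq, Expr.holds_not,
      hs'.holds_adjE, Expr.eval_get, Expr.eval_var, ha, hb 4 (by decide : 4 ∉ _),
      hb 5 (by decide : 5 ∉ _), hb 6 (by decide : 6 ∉ _)]
    constructor
    · intro hp
      rw [if_pos hp]
      simp [State.write_self, ha]
    · intro hp
      rw [if_neg hp]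

end

end RAM

/-! ### Rooting the forest by peeling off vertices -/

namespace RAM

open Cmd

section
variable {n : ℕ} {G : SimpleGraph (Fin n)} {s : State}

/-- The vertex `w` is unmarked, different from the root, and has at most one unmarked neighbour. -/
def IsCand (G : SimpleGraph (Fin n)) (s : State) (w : ℕ) : Prop :=
  w < n ∧ w ≠ s 5 0 ∧ s 16 w = 0 ∧
    ∀ x y, natAdj G w x → s 16 x = 0 → natAdj G w y → s 16 y = 0 → x = y

/-- The only unmarked neighbour of `w`, incremented by `1`, or `0` if there is none. -/
def IsParent (G : SimpleGraph (Fin n)) (s : State) (w p : ℕ) : Prop :=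
  (p = 0 ∧ ∀ x, natAdj G w x → s 16 x ≠ 0) ∨
    ∃ x, p = x + 1 ∧ natAdj G w x ∧ s 16 x = 0 ∧ ∀ y, natAdj G w y → s 16 y = 0 → y = x

/-- The loop over the neighbours in `candCmd`. -/
def candInner : Cmd := .loop 22 (
  .ite (.and (adjE 21 22) (.not (.get 16 (.var 22))))
    (.set 30 (.const 0) (.add (.var 30) (.const 1)) ;;
      .set 33 (.const 0) (.add (.var 22) (.const 1)))
    .skip)

open Classical in
-- Variable `30` counts the unmarked neighbours and variable `33` remembers the last one; if the
-- count is below two, it is the only one.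
theorem candInner_spec (h : HasGraph G s) (h30 : s 30 0 = 0) (h33 : s 33 0 = 0) :
    (candInner.run s 30 0 < 2 ↔ ∀ x y, natAdj G (s 21 0) x → s 16 x = 0 →
      natAdj G (s 21 0) y → s 16 y = 0 → x = y) ∧
    (candInner.run s 30 0 < 2 → IsParent G s (s 21 0) (candInner.run s 33 0)) := by
  have body : ∀ (j : ℕ) (s' : State), (∀ b, b ∉ [22, 30, 33] → s' b = s b) → s' 22 0 = j →
      ((Expr.and (adjE 21 22) (.not (.get 16 (.var 22)))).Holds s' ↔
        natAdj G (s 21 0) j ∧ s 16 j = 0) := by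
    intro j s' hb ha
    have hs' : HasGraph G s' := h.congr (hb 0 (by decide)) (hb 1 (by decide)) (hb 3 (by decide))
    simp only [Expr.holds_and, Expr.holds_not, Expr.holds_get, Expr.eval_var, hs'.holds_adjE, ha,
      hb 16 (by decide), hb 21 (by decide), not_not]
  have h1 := loop_sum (a := 22) (c := 30)
    (P := .ite (.and (adjE 21 22) (.not (.get 16 (.var 22))))
      (.set 30 (.const 0) (.add (.var 30) (.const 1)) ;;
        .set 33 (.const 0) (.add (.var 22) (.const 1))) .skip)
    (by simp [Valid, writes]) (by decide) s
    (fun j => if natAdj G (s 21 0) j ∧ s 16 j = 0 then 1 else 0) (by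
      intro j s' hj hb ha
      rw [run_ite]
      simp only [body j s' (fun b hb' => hb b (by simpa [writes] using hb')) ha]
      split_ifs
      · simp [run_seq, run_set, State.write_of_ne, State.write_self]
      · rw [run_skip, add_zero])
  have h2 := loop_find (a := 22) (c := 33)
    (P := .ite (.and (adjE 21 22) (.not (.get 16 (.var 22))))
      (.set 30 (.const 0) (.add (.var 30) (.const 1)) ;;
        .set 33 (.const 0) (.add (.var 22) (.const 1))) .skip)
    (by simp [Valid, writes]) (by decide) s
    (fun j => natAdj G (s 21 0) j ∧ s 16 j = 0) h33 (by
      intro j s' hj hb ha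
      rw [run_ite]
      simp only [body j s' (fun b hb' => hb b (by simpa [writes] using hb')) ha]
      refine ⟨fun hp => ?_, fun hp => ?_⟩
      · rw [if_pos hp]
        simp [run_seq, run_set, State.write_of_ne, State.write_self, ha]
      · rw [if_neg hp, run_skip])
  rw [← candInner] at h1 h2
  rw [h30, zero_add, Finset.sum_boole, Nat.cast_id] at h1
  have h3 : candInner.run s 30 0 < 2 ↔ ∀ x y, natAdj G (s 21 0) x → s 16 x = 0 →
      natAdj G (s 21 0) y → s 16 y = 0 → x = y := by
    rw [h1, Nat.lt_succ_iff, Finset.card_le_one]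
    simp only [Finset.mem_filter, Finset.mem_range, h.size]
    constructor
    · intro hc x y hx hx' hy hy'
      exact hc x ⟨(natAdj_lt hx).2.trans (by omega), hx, hx'⟩ y
        ⟨(natAdj_lt hy).2.trans (by omega), hy, hy'⟩
    · intro hc x hx y hy
      exact hc x y hx.2.1 hx.2.2 hy.2.1 hy.2.2
  refine ⟨h3, fun hlt => ?_⟩
  have h4 := h3.1 hlt
  rw [h.size] at h2
  rcases h2 with ⟨h2, h5⟩ | ⟨x, hx, hp, h2⟩
  · exact .inl ⟨h2, fun x hx h0 => h5 x (natAdj_lt hx).2.le ⟨hx, h0⟩⟩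
  · exact .inr ⟨x, h2, hp.1, hp.2, fun y hy hy0 => h4 y x hy hy0 hp.1 hp.2⟩

theorem candCmd_spec (h : HasGraph G s) (h31 : s 31 0 = 0) :
    (candCmd.run s 31 0 = 0 ∧ ∀ w, ¬ IsCand G s w) ∨
      ∃ w, IsCand G s w ∧ candCmd.run s 31 0 = w + 1 ∧ IsParent G s w (candCmd.run s 32 0) := by
  have := loop_inv (a := 21) (P := .ite (.and (.and (.lt (.var 21) (.var 0))
      (.not (.eq (.var 21) (.var 5)))) (.not (.get 16 (.var 21))))
    (.set 30 (.const 0) (.const 0) ;; .set 33 (.const 0) (.const 0) ;; candInner ;;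
      .ite (.lt (.var 30) (.const 2))
        (.set 31 (.const 0) (.add (.var 21) (.const 1)) ;; .set 32 (.const 0) (.var 33)) .skip)
    .skip) (by simp [Valid, writes, candInner]) s
    (fun m t => (t 31 0 = 0 ∧ ∀ w < m, ¬ IsCand G s w) ∨
      ∃ w, IsCand G s w ∧ t 31 0 = w + 1 ∧ IsParent G s w (t 32 0)) ?_ ?_
  · rcases this with h1 | h1
    · exact .inl ⟨h1.1, fun w hw => h1.2 w (by rw [h.size]; have := hw.1; omega) hw⟩
    · exact .inr h1
  · left; simp [State.write_of_ne, h31]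
  · intro j s' hj hb ha hi
    have hb' : ∀ b, b ∉ [21, 22, 30, 33, 31, 32] → s' b = s b := fun b hb' => hb b (by
      simp only [writes, candInner, List.mem_cons, List.mem_append, List.not_mem_nil, or_false,
        not_or, List.append_nil] at hb' ⊢
      tauto)
    have hs' : HasGraph G s' := h.congr (hb' 0 (by decide)) (hb' 1 (by decide)) (hb' 3 (by decide))
    simp only [run_ite, Expr.holds_and, Expr.holds_not, Expr.holds_lt, Expr.holds_eq,
      Expr.holds_get, Expr.eval_var, ha, hs'.size, hb' 5 (by decide), hb' 16 (by decide), not_not]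
    have hno : ¬ IsCand G s j → (s'.write 21 0 (j + 1) 31 0 = 0 ∧ ∀ w < j + 1, ¬ IsCand G s w) ∨
        ∃ w, IsCand G s w ∧ s'.write 21 0 (j + 1) 31 0 = w + 1 ∧
          IsParent G s w (s'.write 21 0 (j + 1) 32 0) := by
      intro hj
      simp only [State.write_of_ne, ne_eq, Nat.reduceEqDiff, not_false_eq_true]
      refine hi.imp (fun hi => ⟨hi.1, fun w hw => ?_⟩) id
      rcases Nat.lt_succ_iff_lt_or_eq.1 hw with hw | rfl
      exacts [hi.2 w hw, hj]
    split_ifs with hc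
    · simp only [run_seq, run_set, Expr.eval_const]
      set s1 := (s'.write 30 0 0).write 33 0 0 with hs1
      have hb1 : ∀ b, b ∉ [30, 33] → s1 b = s' b := by
        intro b hb2
        simp only [List.mem_cons, List.not_mem_nil, or_false, not_or] at hb2
        rw [hs1, State.write_of_ne _ _ _ hb2.2, State.write_of_ne _ _ _ hb2.1]
      have hg1 : HasGraph G s1 :=
        hs'.congr (hb1 0 (by decide)) (hb1 1 (by decide)) (hb1 3 (by decide))
      obtain ⟨h1, h2⟩ := candInner_spec hg1 (by simp [hs1, State.write_self, State.write_of_ne])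
        (by simp [hs1, State.write_self])
      have e16 : s1 16 = s 16 := by rw [hb1 16 (by decide), hb' 16 (by decide)]
      have e21 : s1 21 0 = j := by rw [hb1 21 (by decide), ha]
      have hIP : ∀ p, IsParent G s1 j p ↔ IsParent G s j p := by
        intro p; simp only [IsParent, e16]
      rw [e21] at h1 h2
      simp only [e16] at h1
      have f21 : candInner.run s1 21 0 = j := by rw [run_frame _ _ (by decide), e21]
      have f31 : candInner.run s1 31 = s' 31 := by
        rw [run_frame _ _ (by decide), hb1 31 (by decide)]
      have f32 : candInner.run s1 32 = s' 32 := by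
        rw [run_frame _ _ (by decide), hb1 32 (by decide)]
      simp only [run_ite, Expr.holds_lt, Expr.eval_var, Expr.eval_const]
      split_ifs with h3
      · refine .inr ⟨j, ⟨hc.1.1, hc.1.2, hc.2, h1.1 h3⟩, ?_, ?_⟩
        · simp [run_seq, run_set, State.write_self, State.write_of_ne, f21]
        · simp only [run_seq, run_set, State.write_self, State.write_of_ne, Expr.eval_var,
            Expr.eval_const, ne_eq, Nat.reduceEqDiff, not_false_eq_true, Function.update_self]
          rw [← hIP]; exact h2 h3
      · have := hno (fun hcand => h3 (h1.2 hcand.2.2.2))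
        simp only [run_skip, State.write_of_ne, ne_eq, Nat.reduceEqDiff, not_false_eq_true, f31,
          f32] at this ⊢
        exact this
    · exact hno (fun hcand => hc ⟨⟨hcand.1, hcand.2.1⟩, hcand.2.2.1⟩)

theorem exists_isCand (hG : G.IsAcyclic) (hv : s 5 0 < n)
    (hex : ∃ w < n, w ≠ s 5 0 ∧ s 16 w = 0) : ∃ w, IsCand G s w := by
  obtain ⟨w, hw, hwv, hw0⟩ := hex
  obtain ⟨w, hwU, hwv, hw⟩ := hG.exists_subsingleton_neighbors ⟨s 5 0, hv⟩
    (U := {x | s 16 x = 0}) ⟨⟨w, hw⟩, hw0, fun h => hwv (congrArg Fin.val h)⟩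
  refine ⟨w, w.2, fun h => hwv (Fin.ext h), hwU, ?_⟩
  rintro x y ⟨w', x, hx, h1, rfl⟩ hx0 ⟨w'', y, hy, h2, rfl⟩ hy0
  obtain rfl := Fin.ext h1
  obtain rfl := Fin.ext h2
  rw [hw x hx0 y hy0 hx hy]

/-- The rooted forest that the parent array describes. -/
structure HasParents (G : SimpleGraph (Fin n)) (v : ℕ) (par r : ℕ → ℕ) : Prop where
  root : par v = 0
  adj : ∀ i < n, ∀ j < n, natAdj G i j ↔ par i = j + 1 ∨ par j = i + 1
  rank : ∀ i, par i ≠ 0 → par i - 1 < n ∧ r (par i - 1) < r i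

/-- The invariant of the loop `peelCmd`: the marked vertices have their parents. -/
structure PeelInv (G : SimpleGraph (Fin n)) (v : ℕ) (mark par r : ℕ → ℕ) : Prop where
  mark_lt : ∀ x, mark x ≠ 0 → x < n ∧ x ≠ v
  unmarked : ∀ x, mark x = 0 → r x = 0 ∧ par x = 0
  marked : ∀ x, mark x ≠ 0 → 1 ≤ r x
  parent : ∀ x, par x ≠ 0 → natAdj G x (par x - 1) ∧ r (par x - 1) < r x
  edge : ∀ x y, mark x ≠ 0 → natAdj G x y → par x = y + 1 ∨ (mark y ≠ 0 ∧ par y = x + 1)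

/-- A vertex peeled off takes its only remaining neighbour as parent. All its other neighbours were
peeled off earlier, and have it as their parent because it was still unmarked then. -/
theorem PeelInv.step {v : ℕ} {mark par r : ℕ → ℕ} (h : PeelInv G v mark par r) {w p : ℕ}
    (hwn : w < n) (hwv : w ≠ v) (hw0 : mark w = 0)
    (hp : (p = 0 ∧ ∀ x, natAdj G w x → mark x ≠ 0) ∨
      ∃ x, p = x + 1 ∧ natAdj G w x ∧ mark x = 0 ∧ ∀ y, natAdj G w y → mark y = 0 → y = x) :
    ∃ r', PeelInv G v (Function.update mark w 1) (Function.update par w p) r' := by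
  classical
  -- Vertices peeled off later must have smaller ranks: `w` gets rank `1`, all vertices marked
  -- before move up by one, and unmarked ones keep rank `0`.
  refine ⟨fun x => if x = w then 1 else if mark x = 0 then 0 else r x + 1, ?_, ?_, ?_, ?_, ?_⟩
  · intro x hx
    rw [Function.update_apply] at hx
    split_ifs at hx with hxw
    · exact hxw ▸ ⟨hwn, hwv⟩
    · exact h.mark_lt x hx
  · intro x hx
    rw [Function.update_apply] at hx
    split_ifs at hx with hxw
    rw [Function.update_of_ne hxw]
    exact ⟨by simp [hxw, hx], (h.unmarked x hx).2⟩
  · intro x hx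
    rw [Function.update_apply] at hx
    split_ifs at hx with hxw
    · simp [hxw]
    · simp [hxw, hx]
  · intro x hx
    by_cases hxw : x = w
    · subst hxw
      rw [Function.update_self] at hx ⊢
      rcases hp with hp | ⟨y, rfl, hy, hy0, -⟩
      · exact absurd hp.1 hx
      · have := natAdj_ne hy
        simp [hy, hy0, this.symm]
    · rw [Function.update_of_ne hxw] at hx ⊢
      obtain ⟨h1, h2⟩ := h.parent x hx
      refine ⟨h1, ?_⟩
      have hx0 : mark x ≠ 0 := fun h0 => hx (h.unmarked x h0).2
      have := h.marked x hx0
      simp only [hxw, hx0, if_false]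
      split_ifs <;> omega
  · intro x y hx hxy
    have hne := natAdj_ne hxy
    by_cases hxw : x = w
    · subst hxw
      rw [Function.update_self, Function.update_of_ne hne.symm, Function.update_of_ne hne.symm]
      by_cases hy0 : mark y = 0
      · left
        rcases hp with hp | ⟨z, rfl, hz, hz0, hz'⟩
        · exact absurd hy0 (hp.2 y hxy)
        · rw [hz' y hxy hy0]
      · right
        refine ⟨hy0, ?_⟩
        rcases h.edge y x hy0 (natAdj_symm hxy) with h1 | h1
        · exact h1
        · exact absurd hw0 h1.1
    · rw [Function.update_of_ne hxw] at hx ⊢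
      rcases h.edge x y hx hxy with h1 | h1
      · exact .inl h1
      · have hyw : y ≠ w := fun h' => h1.1 (h' ▸ hw0)
        rw [Function.update_of_ne hyw, Function.update_of_ne hyw]
        exact .inr h1

theorem PeelInv.hasParents {v : ℕ} {mark par r : ℕ → ℕ} (h : PeelInv G v mark par r)
    (hall : ∀ x < n, x ≠ v → mark x ≠ 0) : HasParents G v par r := by
  refine ⟨?_, ?_, fun i hi => ⟨(natAdj_lt (h.parent i hi).1).2, (h.parent i hi).2⟩⟩
  · exact (h.unmarked v (by by_contra h0; exact (h.mark_lt v h0).2 rfl)).2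
  · intro i hi j hj
    constructor
    · intro hij
      by_cases hiv : i = v
      · have hjv : j ≠ v := fun h' => natAdj_ne hij (hiv.trans h'.symm)
        rcases h.edge j i (hall j hj hjv) (natAdj_symm hij) with h1 | h1
        · exact .inr h1
        · exact .inl h1.2
      · rcases h.edge i j (hall i hi hiv) hij with h1 | h1
        · exact .inl h1
        · exact .inr h1.2
    · rintro (h1 | h1)
      · have := (h.parent i (by omega)).1
        rwa [h1] at this
      · have := (h.parent j (by omega)).1
        rw [h1] at this
        exact natAdj_symm this

/-- The number of marked vertices among `0, …, n - 1`. -/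
def numMarked (n : ℕ) (mark : ℕ → ℕ) : ℕ := ((Finset.range n).filter (mark · ≠ 0)).card

theorem numMarked_update {n w : ℕ} {mark : ℕ → ℕ} (hw : w < n) (h0 : mark w = 0) :
    numMarked n mark + 1 ≤ numMarked n (Function.update mark w 1) := by
  refine Finset.card_lt_card ⟨fun x hx => ?_, fun hs => ?_⟩
  · simp only [Finset.mem_filter] at hx ⊢
    refine ⟨hx.1, ?_⟩
    rw [Function.update_apply]
    split_ifs
    exacts [one_ne_zero, hx.2]
  · have : w ∈ (Finset.range n).filter (mark · ≠ 0) := hs (by simp [hw])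
    simp only [Finset.mem_filter] at this
    exact this.2 h0

theorem peelCmd_spec (hG : G.IsAcyclic) (h : HasGraph G s) (hv : s 5 0 < n)
    (h16 : ∀ k, s 16 k = 0) (h8 : ∀ k, s 8 k = 0) :
    ∃ r, HasParents G (s 5 0) (peelCmd.run s 8) r := by
  have := loop_inv (a := 20) (P := .set 31 (.const 0) (.const 0) ;; candCmd ;;
    .ite (.var 31) (.set 16 (.sub (.var 31) (.const 1)) (.const 1) ;;
      .set 8 (.sub (.var 31) (.const 1)) (.var 32)) .skip)
    (by simp [Valid, writes, candCmd]) s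
    -- As long as an unmarked vertex other than the root is left, acyclicity provides a candidate,
    -- so every round marks a new vertex. After `n + 1` rounds this cannot have gone on, as there
    -- are only `n` vertices.
    (fun m t => (∃ r, PeelInv G (s 5 0) (t 16) (t 8) r) ∧
      ((∀ x < n, x ≠ s 5 0 → t 16 x ≠ 0) ∨ m ≤ numMarked n (t 16))) ?_ ?_
  · rw [h.size] at this
    obtain ⟨⟨r, h1⟩, h2⟩ := this
    refine ⟨r, h1.hasParents (h2.resolve_right fun h3 => ?_)⟩
    have := h3.trans (Finset.card_filter_le (Finset.range n) _)
    rw [Finset.card_range] at this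
    omega
  · refine ⟨⟨fun _ => 0, ?_⟩, .inr (Nat.zero_le _)⟩
    constructor <;> simp [State.write_of_ne, h16, h8]
  · intro j s' hj hb ha ⟨⟨r, hr⟩, hi⟩
    have hb' : ∀ b ∈ [0, 1, 3, 5], s' b = s b := fun b hb' => hb b (by
      revert b; decide)
    simp only [run_seq, run_set, Expr.eval_const]
    set s1 := s'.write 31 0 0 with hs1
    have e : ∀ b, b ≠ 31 → s1 b = s' b := fun b hb => by rw [hs1, State.write_of_ne _ _ _ hb]
    have hg1 : HasGraph G s1 := h.congr (by rw [e _ (by decide), hb' _ (by decide)])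
      (by rw [e _ (by decide), hb' _ (by decide)]) (by rw [e _ (by decide), hb' _ (by decide)])
    have e5 : s1 5 = s 5 := by rw [e _ (by decide), hb' _ (by decide)]
    have e16 : s1 16 = s' 16 := e _ (by decide)
    have f16 : candCmd.run s1 16 = s' 16 := by rw [run_frame _ _ (by decide), e _ (by decide)]
    have f8 : candCmd.run s1 8 = s' 8 := by rw [run_frame _ _ (by decide), e _ (by decide)]
    rcases candCmd_spec hg1 (by simp [hs1, State.write_self]) with ⟨h1, h2⟩ | ⟨w, hw, h1, hp⟩
    · rw [run_ite, if_neg (by simp [h1]), run_skip]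
      simp only [State.write_of_ne, ne_eq, Nat.reduceEqDiff, not_false_eq_true, f16, f8]
      refine ⟨⟨r, hr⟩, .inl fun x hx hxv h0 => ?_⟩
      obtain ⟨w, hw⟩ := exists_isCand (s := s1) hG (by rw [e5]; exact hv)
        ⟨x, hx, by rw [e5]; exact hxv, by rw [e16]; exact h0⟩
      exact h2 w hw
    · rw [run_ite, if_pos (by simp [h1])]
      simp only [run_seq, run_set, Expr.eval_sub, Expr.eval_var, Expr.eval_const, h1,
        State.write_of_ne, State.write_self, ne_eq, Nat.reduceEqDiff, not_false_eq_true,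
        Nat.add_sub_cancel, f16, f8]
      obtain ⟨hwn, hwv, hw0, -⟩ := hw
      rw [e5] at hwv
      rw [e16] at hw0
      rw [IsParent, e16] at hp
      refine ⟨hr.step hwn hwv hw0 hp, ?_⟩
      rcases hi with hi | hi
      · exact absurd hw0 (hi w hwn hwv)
      · right
        have := numMarked_update hwn hw0
        omega

theorem aliveCmd_spec (h0 : s 0 0 = n) :
    (∀ k, k < n → aliveCmd.run s 9 k = 1) ∧ aliveCmd.run s 9 n = s 7 0 ∧
      aliveCmd.run s 8 = if s 7 0 = 0 then s 8 else Function.update (s 8) n (s 5 0 + 1) := by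
  have := loop_map (a := 20) (c := 9)
    (P := .set 9 (.var 20) (.and (.lt (.var 20) (.var 0)) (.const 1)))
    (by simp [Valid, writes]) (by decide) s (fun k => if k < n then 1 else 0) (by
      intro j s' hj hb ha _
      have hb0 := hb 0 (by decide)
      simp only [run_set, State.write_self, Expr.eval_var, ha, Expr.eval_and, Expr.holds_lt, hb0,
        h0]
      simp [Expr.Holds])
  simp only [aliveCmd, run_seq]
  generalize hs1 : (Cmd.loop 20 _).run s = s1 at this ⊢
  have e : ∀ b ∈ [0, 5, 7, 8], s1 b = s b := by
    intro b hb
    rw [← hs1]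
    exact run_frame _ _ (by revert b; decide)
  have e0 := e 0 (by decide)
  have e5 := e 5 (by decide)
  have e7 := e 7 (by decide)
  have e8 := e 8 (by decide)
  simp only [run_ite, run_set, run_skip, Expr.holds_var, Expr.eval_var, Expr.eval_add,
    Expr.eval_const, State.write_of_ne, ne_eq, Nat.reduceEqDiff, not_false_eq_true, e0, e5, e7, h0]
  split_ifs with h7
  · simp only [State.write_self, State.write_of_ne, ne_eq, Nat.reduceEqDiff, not_false_eq_true,
      Function.update_self, this, h0, e8, h7]
    refine ⟨fun k hk => ?_, trivial, trivial⟩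
    rw [Function.update_of_ne hk.ne, if_pos hk.le, if_pos hk]
  · simp only [State.write_self, State.write_of_ne, ne_eq, Nat.reduceEqDiff, not_false_eq_true,
      Function.update_self, this, h0, e8]
    refine ⟨fun k hk => ?_, trivial, trivial⟩
    rw [Function.update_of_ne hk.ne, if_pos hk.le, if_pos hk]

end

end RAM

/-! ### Correctness of the preparation -/

namespace RAM

open Cmd

/-- Read the graph, and store a rooted forest for the colouring algorithm. -/
def setupCmd : Cmd := rowsCmd ;; degCmd ;; maxCmd ;; flagCmd ;; peelCmd ;; aliveCmd

/-- The vertices marked by `alive`. -/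
def aliveSet (n : ℕ) (alive : ℕ → ℕ) : Finset ℕ := (Finset.range (n + 1)).filter (alive · ≠ 0)

section
variable {n : ℕ} {G : SimpleGraph (Fin n)}

theorem mem_aliveSet {alive : ℕ → ℕ} {k : ℕ} : k ∈ aliveSet n alive ↔ k ≤ n ∧ alive k ≠ 0 := by
  simp [aliveSet]

open Classical in
theorem card_natAdj [DecidableRel G.Adj] {k : ℕ} (hk : k < n) :
    ((Finset.range n).filter (natAdj G k)).card = G.degree ⟨k, hk⟩ := by
  rw [← SimpleGraph.card_neighborFinset_eq_degree]
  symm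
  refine Finset.card_bij (fun x _ => (x : ℕ)) ?_ ?_ ?_
  · intro x hx
    rw [SimpleGraph.mem_neighborFinset] at hx
    simp only [Finset.mem_filter, Finset.mem_range]
    exact ⟨x.2, ⟨k, hk⟩, x, hx, rfl, rfl⟩
  · intro x _ y _ hxy; exact Fin.ext hxy
  · intro y hy
    simp only [Finset.mem_filter, Finset.mem_range] at hy
    obtain ⟨-, i', j', h, rfl, rfl⟩ := hy
    exact ⟨j', by rw [SimpleGraph.mem_neighborFinset]; exact h, rfl⟩

/-- The result of `setupCmd`. -/
structure IsSetup (G : SimpleGraph (Fin n)) [DecidableRel G.Adj] (t : State) : Prop where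
  size : t 0 0 = n
  root_lt : t 5 0 < n
  good : ∃ r, ParentForest.IsGood (t 8) r (t 5 0) (aliveSet n (t 9)) (t 17 0)
  alive : ∀ i < n, i ∈ aliveSet n (t 9)
  adj : ∀ i < n, ∀ j < n, natAdj G i j ↔ t 8 i = j + 1 ∨ t 8 j = i + 1
  colors : t 17 0 = G.maxDegree ∨ t 17 0 = G.maxDegree + 1 ∧ G.HasNonadjacentMaxDegree
  zero : ∀ b ∉ [0, 1] ++ setupCmd.writes, ∀ k, t b k = 0

open Classical in
theorem setupCmd_spec [DecidableRel G.Adj] (hG : G.IsAcyclic) (hn : n + 2 ≤ 3 * G.maxDegree) :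
    IsSetup G (setupCmd.run (graphInput G)) := by
  have z : ∀ b k, b ≠ 0 → b ≠ 1 → graphInput G b k = 0 := by
    intro b k h0 h1; simp [graphInput, h0, h1]
  have zframe : ∀ b ∉ [0, 1] ++ setupCmd.writes, ∀ k,
      setupCmd.run (graphInput G) b k = 0 := by
    intro b hb k
    simp only [List.mem_append, not_or] at hb
    rw [run_frame _ _ hb.2, z]
    · rintro rfl; simp at hb
    · rintro rfl; simp at hb
  set s0 := graphInput G with hs0
  set s1 := rowsCmd.run s0 with hs1
  set s2 := degCmd.run s1 with hs2
  set s3 := maxCmd.run s2 with hs3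
  set s4 := flagCmd.run s3 with hs4
  set s5 := peelCmd.run s4 with hs5
  have e1 : HasGraph G s1 := rowsCmd_spec (by simp [hs0, graphInput]) rfl
    (z 3 0 (by decide) (by decide))
  have e2 : HasGraph G s2 := e1.congr (run_frame _ _ (by decide)) (run_frame _ _ (by decide))
    (run_frame _ _ (by decide))
  have e3 : HasGraph G s3 := e2.congr (run_frame _ _ (by decide)) (run_frame _ _ (by decide))
    (run_frame _ _ (by decide))
  have e4 : HasGraph G s4 := e3.congr (run_frame _ _ (by decide)) (run_frame _ _ (by decide))
    (run_frame _ _ (by decide))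
  have e5 : HasGraph G s5 := e4.congr (run_frame _ _ (by decide)) (run_frame _ _ (by decide))
    (run_frame _ _ (by decide))
  have d2 : ∀ k ≤ n, s2 4 k = ((Finset.range n).filter (natAdj G k)).card := fun k hk =>
    degCmd_spec e1 hk
  obtain ⟨m1, m2, m3⟩ := maxCmd_spec e2.size
    (by
      rw [hs2, run_frame _ _ (by decide), hs1, run_frame _ _ (by decide)]
      exact z _ _ (by decide) (by decide))
    (by
      rw [hs2, run_frame _ _ (by decide), hs1, run_frame _ _ (by decide)]
      exact z _ _ (by decide) (by decide))
  rw [← hs3] at m1 m2 m3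
  have hle : G.maxDegree ≤ s3 6 0 := by
    refine G.maxDegree_le_of_forall_degree_le _ fun x => ?_
    rw [← card_natAdj x.2, ← d2 x x.2.le]
    exact m2 x x.2.le
  have m3' : s3 6 0 = s2 4 (s3 5 0) := m3.resolve_left (by omega)
  have hv : s3 5 0 < n := by
    -- The loops also visit the index `n`, which is no vertex of the graph. It counts as having
    -- degree `0`, whereas the maximum degree is positive.
    refine lt_of_le_of_ne m1 fun hv => ?_
    rw [hv, d2 n le_rfl] at m3'
    have : (Finset.range n).filter (natAdj G n) = ∅ := by
      rw [Finset.filter_eq_empty_iff]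
      intro x _ hx
      exact absurd (natAdj_lt hx).1 (lt_irrefl n)
    rw [this, Finset.card_empty] at m3'
    omega
  rw [d2 _ hv.le, card_natAdj hv] at m3'
  have hmax : s3 6 0 = G.maxDegree :=
    le_antisymm (m3' ▸ G.degree_le_maxDegree _) hle
  obtain ⟨f1, f2⟩ := flagCmd_spec e3 (by
    rw [hs3, run_frame _ _ (by decide), hs2, run_frame _ _ (by decide), hs1,
      run_frame _ _ (by decide)]; exact z _ _ (by decide) (by decide))
  rw [← hs4] at f1 f2
  have g5 : s4 5 = s3 5 := run_frame _ _ (by decide)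
  have g4 : s3 4 = s2 4 := run_frame _ _ (by decide)
  obtain ⟨r, hr⟩ := peelCmd_spec (s := s4) hG e4 (by rw [g5]; exact hv)
    (fun k => by
      rw [hs4, run_frame _ _ (by decide), hs3, run_frame _ _ (by decide), hs2,
        run_frame _ _ (by decide), hs1, run_frame _ _ (by decide)]
      exact z _ _ (by decide) (by decide))
    (fun k => by
      rw [hs4, run_frame _ _ (by decide), hs3, run_frame _ _ (by decide), hs2,
        run_frame _ _ (by decide), hs1, run_frame _ _ (by decide)]
      exact z _ _ (by decide) (by decide))
  rw [← hs5, g5] at hr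
  obtain ⟨a1, a2, a3⟩ := aliveCmd_spec e5.size
  have ht : setupCmd.run s0 = aliveCmd.run s5 := rfl
  rw [ht] at zframe ⊢
  set t := aliveCmd.run s5 with htt
  have t0 : t 0 = s5 0 := run_frame _ _ (by decide)
  have t5 : t 5 0 = s3 5 0 := by
    rw [htt, run_frame _ _ (by decide), hs5, run_frame _ _ (by decide), g5]
  have t17 : t 17 0 = G.maxDegree + s4 7 0 := by
    rw [htt, run_frame _ _ (by decide), hs5, run_frame _ _ (by decide), f1, hmax]
  have s57 : s5 7 0 = s4 7 0 := by rw [hs5, run_frame _ _ (by decide)]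
  have s55 : s5 5 0 = s3 5 0 := by rw [hs5, run_frame _ _ (by decide), g5]
  rw [s57, s55] at a3
  rw [s57] at a2
  have hf1 : s4 7 0 ≤ 1 := by
    rcases f2 with f2 | f2
    · rw [f2.1]; omega
    · rw [f2.1]
  have hA : ∀ i, i ∈ aliveSet n (t 9) ↔ i < n + s4 7 0 := by
    intro i
    rw [mem_aliveSet]
    rcases lt_trichotomy i n with hi | rfl | hi
    · rw [a1 i hi]; constructor
      · omega
      · intro _; exact ⟨hi.le, one_ne_zero⟩
    · rw [a2]; omega
    · omega
  have t8 : ∀ i < n, t 8 i = s5 8 i := by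
    intro i hi
    rw [a3]; split_ifs
    · rfl
    · exact Function.update_of_ne hi.ne _ _
  have hadj : ∀ i < n, ∀ j < n, natAdj G i j ↔ t 8 i = j + 1 ∨ t 8 j = i + 1 := by
    intro i hi j hj
    rw [t8 i hi, t8 j hj]; exact hr.adj i hi j hj
  refine ⟨by rw [t0]; exact e5.size, by rw [t5]; exact hv,
    ⟨Function.update r n (r (s3 5 0) + 1), ?_⟩, fun i hi => ?_, hadj, ?_, zframe⟩
  · rw [t17, t5]
    refine ParentForest.isGood_of_adj (n := n) (adj := natAdj G) (r := r) hv ?_ hadj ?_ hA hf1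
      ?_ ?_ ?_ ?_ hn
    · rw [t8 _ hv]; exact hr.root
    · intro i hi h0
      rw [t8 i hi] at h0 ⊢
      exact hr.rank i h0
    · intro hf
      rw [a3, if_neg (by omega), Function.update_self]
    · rw [card_natAdj hv, ← m3', hmax]
    · intro i hi
      rw [card_natAdj hi]; exact G.degree_le_maxDegree _
    · intro hf i hi hiv hdeg
      rcases f2 with f2 | f2
      · refine f2.2 i hi.le ?_ hiv
        rw [g4, d2 i hi.le, hdeg, hmax]
      · omega
  · rw [hA]; omega
  · rw [t17]
    rcases f2 with ⟨f2, -⟩ | ⟨f2, k, hk, h1, h2, h3⟩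
    · left; rw [f2]; rfl
    · right
      rw [f2]
      refine ⟨rfl, ?_⟩
      rw [g4, d2 k hk, hmax] at h1
      have hkn : k < n := by
        refine lt_of_le_of_ne hk fun hkn => ?_
        subst hkn
        have : (Finset.range k).filter (natAdj G k) = ∅ := by
          rw [Finset.filter_eq_empty_iff]
          intro x _ hx
          exact absurd (natAdj_lt hx).1 (lt_irrefl k)
        rw [this, Finset.card_empty] at h1
        omega
      rw [card_natAdj hkn] at h1
      refine ⟨⟨s3 5 0, hv⟩, ⟨k, hkn⟩, fun h => h2 (congrArg Fin.val h).symm, fun h => h3 ?_, ?_, h1⟩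
      · exact ⟨_, _, h, rfl, rfl⟩
      · rw [← m3', hmax]

end

end RAM

/-! ### The record of removals -/

namespace ParentForest

open Finset

/-- The pair `UU e`, `AA e` was removed with the children of both when `e` colours were left. The
vertices removed in this step are those with `lev i = e`. -/
structure IsStep (par r : ℕ → ℕ) (v : ℕ) (A₀ : Finset ℕ) (lev UU AA : ℕ → ℕ) (e : ℕ) : Prop where
  good : IsGood par r v {i ∈ A₀ | lev i ≤ e} e
  lt_inner : e < #(inner par v {i ∈ A₀ | lev i ≤ e})
  pair : IsPair par v {i ∈ A₀ | lev i ≤ e} (UU e) (AA e)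
  prune : {i ∈ A₀ | lev i ≤ e - 1} = prune par (UU e) (AA e) {i ∈ A₀ | lev i ≤ e}

/-- The history of removals that lead from `A₀` with `D` colours to `A` with `d` colours. -/
structure IsHistory (par r : ℕ → ℕ) (v : ℕ) (A₀ : Finset ℕ) (D : ℕ) (A : Finset ℕ)
    (lev UU AA : ℕ → ℕ) (d : ℕ) : Prop where
  good : IsGood par r v A d
  alive : {i ∈ A₀ | lev i ≤ d} = A
  lev_eq : ∀ i, lev i = 0 ∨ d < lev i ∧ lev i ≤ D
  mem : ∀ i, lev i ≠ 0 → i ∈ A₀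
  le : d ≤ D
  steps : ∀ e, d < e → e ≤ D → IsStep par r v A₀ lev UU AA e

variable {par r : ℕ → ℕ} {v d D u a : ℕ} {A A₀ : Finset ℕ} {lev lev' UU AA : ℕ → ℕ}

/-- Level `0` means not yet removed. Relabelling a remaining vertex by `d` changes none of the sets
of vertices of level at most `e` with `e ≥ d`, so the earlier steps stay valid and the new one is
added. -/
theorem IsHistory.step (h : IsHistory par r v A₀ D A lev UU AA d) (hN : d < #(inner par v A))
    (hp : IsPair par v A u a)
    (hlev : ∀ i ∈ A, lev' i = if i ∈ prune par u a A then lev i else d)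
    (hlev' : ∀ i ∉ A, lev' i = lev i) :
    IsHistory par r v A₀ D (prune par u a A) lev' (Function.update UU d u)
      (Function.update AA d a) (d - 1) := by
  have hd : 1 ≤ d := by have := h.good.card_le; omega
  have hsub : prune par u a A ⊆ A := filter_subset _ _
  have hA : ∀ i, i ∈ A ↔ i ∈ A₀ ∧ lev i ≤ d := fun i => by rw [← h.alive]; simp
  have same : ∀ e, d ≤ e → {i ∈ A₀ | lev' i ≤ e} = {i ∈ A₀ | lev i ≤ e} := by
    intro e he
    ext i
    simp only [mem_filter, and_congr_right_iff]
    intro hi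
    by_cases hiA : i ∈ A
    · have := ((hA i).1 hiA).2
      rw [hlev i hiA]
      split_ifs
      · rfl
      · constructor <;> intro _ <;> omega
    · rw [hlev' i hiA]
  have last : {i ∈ A₀ | lev' i ≤ d - 1} = prune par u a A := by
    ext i
    simp only [mem_filter]
    by_cases hiA : i ∈ A
    · have h1 := (hA i).1 hiA
      rw [hlev i hiA]
      have := h.lev_eq i
      split_ifs with hi
      · simp only [hi, iff_true]; exact ⟨h1.1, by omega⟩
      · simp only [hi, iff_false]; omega
    · have : i ∉ prune par u a A := fun h' => hiA (hsub h')
      simp only [this, iff_false]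
      rw [hlev' i hiA]
      rintro ⟨h1, h2⟩
      exact hiA ((hA i).2 ⟨h1, by omega⟩)
  refine ⟨h.good.prune hN hp, last, ?_, ?_, ?_, ?_⟩
  · intro i
    have h1 := h.lev_eq i
    have h2 := h.le
    by_cases hiA : i ∈ A
    · rw [hlev i hiA]
      split_ifs <;> omega
    · rw [hlev' i hiA]; omega
  · intro i hi
    by_cases hiA : i ∈ A
    · exact ((hA i).1 hiA).1
    · exact h.mem i (hlev' i hiA ▸ hi)
  · have := h.le; omega
  · intro e he heD
    by_cases hed : e = d
    · subst hed
      refine ⟨?_, ?_, ?_, ?_⟩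
      · rw [same e le_rfl, h.alive]; exact h.good
      · rw [same e le_rfl, h.alive]; exact hN
      · rw [same e le_rfl, h.alive, Function.update_self, Function.update_self]; exact hp
      · rw [same e le_rfl, h.alive, Function.update_self, Function.update_self, last]
    · have h1 := h.steps e (by omega) heD
      refine ⟨?_, ?_, ?_, ?_⟩
      · rw [same e (by omega)]; exact h1.good
      · rw [same e (by omega)]; exact h1.lt_inner
      · rw [same e (by omega), Function.update_of_ne hed, Function.update_of_ne hed]; exact h1.pair
      · rw [same e (by omega), same (e - 1) (by omega), Function.update_of_ne hed,
          Function.update_of_ne hed]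
        exact h1.prune

end ParentForest

/-! ### Carrying out the removals -/

namespace RAM

open Cmd ParentForest

/-- The vertex in variable `j` is a child of that in variable `i`. -/
def childE (i j : ℕ) : Expr :=
  .and (.get 9 (.var j)) (.eq (.get 8 (.var j)) (.add (.var i) (.const 1)))

/-- Fill array `X`: cell `i` becomes the sum of the values of `e` over those `j` that satisfy `c`,
where `i` and `j` are in variables `20` and `21`. -/
def sumCmd (X : ℕ) (c e : Expr) : Cmd := .loop 20 (
  .set 30 (.const 0) (.const 0) ;;
  .loop 21 (.ite c (.set 30 (.const 0) (.add (.var 30) e)) .skip) ;;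
  .set X (.var 20) (.var 30))

/-- Store the number of children in array `10`, the number of grandchildren in array `11` and the
number of vertices with children, other than the root, in variable `12`. -/
def kidsCmd : Cmd :=
  sumCmd 10 (childE 20 21) (.const 1) ;;
  sumCmd 11 (childE 20 21) (.get 10 (.var 21)) ;;
  .set 12 (.const 0) (.const 0) ;;
  .loop 20 (.ite (.and (.get 9 (.var 20)) (.and (.not (.eq (.var 20) (.var 5)))
    (.get 10 (.var 20)))) (.set 12 (.const 0) (.add (.var 12) (.const 1))) .skip)

/-- Find a vertex and store it, incremented by `1`, in variable `x`. -/
def findCmd (x : ℕ) (c : Expr) : Cmd :=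
  .set x (.const 0) (.const 0) ;;
  .loop 20 (.ite c (.set x (.const 0) (.add (.var 20) (.const 1))) .skip)

/-- Write `e` into the cells of array `X` that satisfy `c`. -/
def fillCmd (X : ℕ) (c e : Expr) : Cmd := .loop 20 (.ite c (.set X (.var 20) e) .skip)

/-- Is the parent of the vertex in variable `20` the root? -/
def rootChildE : Expr := .eq (.get 8 (.var 20)) (.add (.var 5) (.const 1))

/-- Remove a pair of vertices and their children. -/
def pruneCmd : Cmd :=
  findCmd 34 (.and (.and (.get 9 (.var 20)) rootChildE)
    (.lt (.add (.get 10 (.var 20)) (.get 11 (.var 20))) (.const 2))) ;;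
  findCmd 35 (.and (.and (.get 9 (.var 20)) (.and (.not (.eq (.var 20) (.var 5)))
    (.not rootChildE))) (.and (.get 10 (.var 20)) (.not (.get 11 (.var 20))))) ;;
  .set 13 (.var 17) (.sub (.var 34) (.const 1)) ;;
  .set 14 (.var 17) (.sub (.var 35) (.const 1)) ;;
  fillCmd 15 (.and (.get 9 (.var 20)) (.or
    (.or (.eq (.add (.var 20) (.const 1)) (.var 34)) (.eq (.add (.var 20) (.const 1)) (.var 35)))
    (.or (.eq (.get 8 (.var 20)) (.var 34)) (.eq (.get 8 (.var 20)) (.var 35))))) (.var 17) ;;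
  fillCmd 9 (.eq (.get 15 (.var 20)) (.var 17)) (.const 0) ;;
  .set 17 (.const 0) (.sub (.var 17) (.const 1))

/-- Remove pairs as long as there are more vertices with children than colours. -/
def reduceCmd : Cmd := .loop 23 (kidsCmd ;; .ite (.lt (.var 17) (.var 12)) pruneCmd .skip)

section
variable {s : State}

/-- The condition and the summand may read any array except the scratch arrays and `X`. So they
depend only on the two counters, and `f` is this dependence. -/
theorem sumCmd_spec {X : ℕ} {c e : Expr} (hX : X ∉ [0, 20, 21, 30]) (f : ℕ → ℕ → ℕ)
    (hf : ∀ s' : State, (∀ b, b ∉ [20, 21, 30, X] → s' b = s b) →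
      (if c.Holds s' then e.eval s' else 0) = f (s' 20 0) (s' 21 0)) {k : ℕ} (hk : k ≤ s 0 0) :
    (sumCmd X c e).run s X k = ∑ j ∈ Finset.range (s 0 0 + 1), f k j := by
  simp only [List.mem_cons, List.not_mem_nil, or_false, not_or] at hX
  have := loop_map (a := 20) (c := X) (P := .set 30 (.const 0) (.const 0) ;;
    .loop 21 (.ite c (.set 30 (.const 0) (.add (.var 30) e)) .skip) ;;
    .set X (.var 20) (.var 30)) (by simp [Valid, writes]; tauto) hX.2.1 s
    (fun k => ∑ j ∈ Finset.range (s 0 0 + 1), f k j) ?_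
  · rw [sumCmd, this]; exact if_pos hk
  · intro j s' hj hb ha _
    have hb' : ∀ b, b ∉ [20, 21, 30, X] → s' b = s b := fun b hb' => hb b (by
      simp only [writes, List.mem_cons, List.mem_append, List.not_mem_nil, or_false] at hb' ⊢
      tauto)
    have h2 := loop_sum (a := 21) (c := 30)
      (P := .ite c (.set 30 (.const 0) (.add (.var 30) e)) .skip)
      (by simp [Valid, writes]) (by decide) (s'.write 30 0 0) (fun i => f j i) ?_
    · have e0 : s'.write 30 0 0 0 0 = s 0 0 := by
        rw [State.write_of_ne _ _ _ (by decide), hb' 0 (by simp; tauto)]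
      rw [State.write_self, Function.update_self, zero_add, e0] at h2
      simp only [run_seq, run_set, State.write_self, Expr.eval_const, Expr.eval_var, h2]
      rw [run_frame _ _ (b := X) (by simp [writes]; tauto),
        run_frame _ _ (b := 20) (by simp [writes]),
        State.write_of_ne _ _ _ (by tauto), State.write_of_ne _ _ _ (by decide), ha]
    · intro i s'' hi hb'' ha'
      have h20 : s'' 20 0 = j := by
        rw [hb'' 20 (by simp [writes]), State.write_of_ne _ _ _ (by decide), ha]
      have h3 := hf s'' fun b hb2 => by
        simp only [List.mem_cons, List.not_mem_nil, or_false, not_or] at hb2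
        rw [hb'' b (by simp [writes]; tauto), State.write_of_ne _ _ _ (by tauto),
          hb' b (by simp; tauto)]
      rw [h20, ha'] at h3
      rw [run_ite]
      split_ifs with hc
      · rw [if_pos hc] at h3
        simp [run_set, State.write_self, h3]
      · rw [if_neg hc] at h3
        rw [run_skip, ← h3, add_zero]

theorem findCmd_spec {x : ℕ} {c : Expr} (hx : x ≠ 20) (hx0 : x ≠ 0) (p : ℕ → Prop)
    (hc : ∀ s' : State, (∀ b, b ∉ [20, x] → s' b = s b) → (c.Holds s' ↔ p (s' 20 0))) :
    ((findCmd x c).run s x 0 = 0 ∧ ∀ k ≤ s 0 0, ¬ p k) ∨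
      ∃ k ≤ s 0 0, p k ∧ (findCmd x c).run s x 0 = k + 1 := by
  have h0 : s.write x 0 0 0 0 = s 0 0 := by rw [State.write_of_ne _ _ _ hx0.symm]
  have := loop_find (a := 20) (c := x)
    (P := .ite c (.set x (.const 0) (.add (.var 20) (.const 1))) .skip)
    (by simp [Valid, writes]; tauto) hx (s.write x 0 0) p (by rw [State.write_self]; simp) ?_
  · rw [h0] at this
    exact this
  · intro j s' hj hb ha
    have h1 := hc s' fun b hb' => by
      simp only [List.mem_cons, List.not_mem_nil, or_false, not_or] at hb'
      rw [hb b (by simp [writes]; tauto), State.write_of_ne _ _ _ (by tauto)]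
    rw [ha] at h1
    rw [run_ite]
    refine ⟨fun hp => ?_, fun hp => ?_⟩
    · rw [if_pos (h1.2 hp)]; simp [run_set, State.write_self, ha]
    · rw [if_neg (fun h => hp (h1.1 h)), run_skip]

theorem findCmd_spec_of_exists {x : ℕ} {c : Expr} (hx : x ≠ 20) (hx0 : x ≠ 0) (p : ℕ → Prop)
    (hc : ∀ s' : State, (∀ b, b ∉ [20, x] → s' b = s b) → (c.Holds s' ↔ p (s' 20 0)))
    (hex : ∃ k ≤ s 0 0, p k) : ∃ k ≤ s 0 0, p k ∧ (findCmd x c).run s x 0 = k + 1 := by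
  obtain ⟨k, hk, hp⟩ := hex
  exact (findCmd_spec hx hx0 p hc).resolve_left fun h => h.2 k hk hp

/-- The additional assumption on `s'` lets the condition and the value read the old content of the
very cell being filled, as in shifting a colour by one. -/
theorem fillCmd_spec {X : ℕ} {c e : Expr} (hX : X ≠ 20) (hX0 : X ≠ 0) (p : ℕ → Prop) (f : ℕ → ℕ)
    (hc : ∀ s' : State, (∀ b, b ∉ [20, X] → s' b = s b) → s' X (s' 20 0) = s X (s' 20 0) →
      (c.Holds s' ↔ p (s' 20 0)) ∧ e.eval s' = f (s' 20 0)) :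
    (∀ k ≤ s 0 0, p k → (fillCmd X c e).run s X k = f k) ∧
    (∀ k, s 0 0 < k ∨ ¬ p k → (fillCmd X c e).run s X k = s X k) := by
  classical
  have := loop_map (a := 20) (c := X) (P := .ite c (.set X (.var 20) e) .skip)
    (by simp [Valid, writes]; tauto) hX s (fun k => if p k then f k else s X k) ?_
  · rw [fillCmd, this]
    refine ⟨fun k hk hp => by simp [hk, hp], ?_⟩
    rintro k (hk | hk)
    · simp [hk]
    · simp [hk]
  · intro j s' hj hb ha hX'
    obtain ⟨h1, h2⟩ := hc s' (fun b hb' => by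
      simp only [List.mem_cons, List.not_mem_nil, or_false, not_or] at hb'
      rw [hb b (by simp [writes]; tauto)]) (by rw [ha, hX'])
    rw [ha] at h1 h2
    rw [run_ite]
    by_cases hp : p j
    · rw [if_pos (h1.2 hp), if_pos hp, run_set, State.write_self, Expr.eval_var, ha, h2]
    · rw [if_neg (fun h => hp (h1.1 h)), if_neg hp, run_skip, ← hX', Function.update_eq_self]

theorem kidsCmd_spec {n : ℕ} (h0 : s 0 0 = n) :
    (∀ k ≤ n, kidsCmd.run s 10 k = (children (s 8) (aliveSet n (s 9)) k).card) ∧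
    (∀ k ≤ n, kidsCmd.run s 11 k = grand (s 8) (aliveSet n (s 9)) k) ∧
    kidsCmd.run s 12 0 = (ParentForest.inner (s 8) (s 5 0) (aliveSet n (s 9))).card := by
  classical
  set A := aliveSet n (s 9) with hA
  have hch : ∀ k, children (s 8) A k =
      (Finset.range (n + 1)).filter (fun j => s 9 j ≠ 0 ∧ s 8 j = k + 1) := by
    intro k; ext j; simp [hA, aliveSet, and_assoc]
  set s1 := (sumCmd 10 (childE 20 21) (.const 1)).run s with hs1
  have f1 : ∀ b, b ∉ [20, 21, 30, 10] → s1 b = s b := by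
    intro b hb
    refine run_frame _ _ ?_
    simp [sumCmd, writes] at hb ⊢; tauto
  have h1 : ∀ k ≤ n, s1 10 k = (children (s 8) A k).card := by
    intro k hk
    rw [hs1, sumCmd_spec (by decide) (fun i j => if s 9 j ≠ 0 ∧ s 8 j = i + 1 then 1 else 0) ?_
      (by rw [h0]; exact hk), h0, Finset.sum_boole, Nat.cast_id, hch]
    intro s' hb
    simp only [childE, Expr.holds_and, Expr.holds_get, Expr.holds_eq, Expr.eval_get, Expr.eval_var,
      Expr.eval_add, Expr.eval_const, hb 9 (by decide), hb 8 (by decide)]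
  set s2 := (sumCmd 11 (childE 20 21) (.get 10 (.var 21))).run s1 with hs2
  have f2 : ∀ b, b ∉ [20, 21, 30, 11] → s2 b = s1 b := by
    intro b hb
    refine run_frame _ _ ?_
    simp [sumCmd, writes] at hb ⊢; tauto
  have h2 : ∀ k ≤ n, s2 11 k = grand (s 8) A k := by
    intro k hk
    rw [hs2, sumCmd_spec (by decide)
      (fun i j => if s 9 j ≠ 0 ∧ s 8 j = i + 1 then s1 10 j else 0) ?_
      (by rw [f1 0 (by decide), h0]; exact hk), f1 0 (by decide), h0,
      ← Finset.sum_filter, ← hch, grand]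
    · refine Finset.sum_congr rfl fun j hj => h1 j ?_
      exact (mem_aliveSet.1 (mem_children.1 hj).1).1
    intro s' hb
    simp only [childE, Expr.holds_and, Expr.holds_get, Expr.holds_eq, Expr.eval_get, Expr.eval_var,
      Expr.eval_add, Expr.eval_const, hb 9 (by decide), hb 8 (by decide), hb 10 (by decide),
      f1 9 (by decide), f1 8 (by decide)]
  have h3 := loop_sum (a := 20) (c := 12) (P := .ite (.and (.get 9 (.var 20))
      (.and (.not (.eq (.var 20) (.var 5))) (.get 10 (.var 20))))
      (.set 12 (.const 0) (.add (.var 12) (.const 1))) .skip) (by simp [Valid, writes]) (by decide)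
    (s2.write 12 0 0) (fun k => if s 9 k ≠ 0 ∧ k ≠ s 5 0 ∧ s2 10 k ≠ 0 then 1 else 0) ?_
  · have e10 : kidsCmd.run s 10 = s2 10 := by
      simp only [kidsCmd, run_seq, run_set]
      rw [run_frame _ _ (by simp [writes]), State.write_of_ne _ _ _ (by decide)]
    have e11 : kidsCmd.run s 11 = s2 11 := by
      simp only [kidsCmd, run_seq, run_set]
      rw [run_frame _ _ (by simp [writes]), State.write_of_ne _ _ _ (by decide)]
    have e210 : s2 10 = s1 10 := f2 10 (by decide)
    rw [e10, e11]
    refine ⟨fun k hk => by rw [e210]; exact h1 k hk, h2, ?_⟩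
    simp only [kidsCmd, run_seq, run_set]
    refine h3.trans ?_
    rw [State.write_self, Function.update_self, zero_add, State.write_of_ne _ _ _ (by decide),
      f2 0 (by decide), f1 0 (by decide), h0, Finset.sum_boole, Nat.cast_id]
    congr 1
    ext k
    simp only [Finset.mem_filter, Finset.mem_range, ParentForest.inner, hA, mem_aliveSet, e210]
    constructor
    · rintro ⟨hk, h9, h5, h10⟩
      rw [h1 k (by omega)] at h10
      exact ⟨⟨by omega, h9⟩, h5, by rw [← hA]; omega⟩
    · rintro ⟨⟨hk, h9⟩, h5, h10⟩
      rw [h1 k (by omega)]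
      exact ⟨by omega, h9, h5, by rw [← hA] at h10; omega⟩
  · intro j s' hj hb ha
    have g : ∀ b, b ≠ 20 → b ≠ 12 → s' b = s2 b := by
      intro b hb1 hb2
      rw [hb b (by simp [writes, hb1, hb2]), State.write_of_ne _ _ _ hb2]
    simp only [run_ite, Expr.holds_and, Expr.holds_get, Expr.holds_not, Expr.holds_eq,
      Expr.eval_var, ha, g 9 (by decide) (by decide), g 5 (by decide) (by decide),
      g 10 (by decide) (by decide), f2 9 (by decide), f1 9 (by decide), f2 5 (by decide),
      f1 5 (by decide)]
    split_ifs
    · simp [run_set, State.write_self]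
    · rw [run_skip, add_zero]

end

end RAM

namespace RAM

open Cmd ParentForest

section
variable {s : State} {n D : ℕ} {r : ℕ → ℕ} {A₀ : Finset ℕ}

theorem _root_.ParentForest.IsHistory.step_of_arrays {par lev lev' alive alive' UU AA : ℕ → ℕ}
    {v d u a : ℕ} (h : IsHistory par r v A₀ D (aliveSet n alive) lev UU AA d)
    (hN : d < (ParentForest.inner par v (aliveSet n alive)).card)
    (hp : IsPair par v (aliveSet n alive) u a)
    (l1 : ∀ k ≤ n, (alive k ≠ 0 ∧ ((k = u ∨ k = a) ∨ (par k = u + 1 ∨ par k = a + 1))) →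
      lev' k = d)
    (l2 : ∀ k, n < k ∨ ¬ (alive k ≠ 0 ∧ ((k = u ∨ k = a) ∨ (par k = u + 1 ∨ par k = a + 1))) →
      lev' k = lev k)
    (m1 : ∀ k ≤ n, lev' k = d → alive' k = 0)
    (m2 : ∀ k, n < k ∨ ¬ lev' k = d → alive' k = alive k) :
    IsHistory par r v A₀ D (aliveSet n alive') lev' (Function.update UU d u)
      (Function.update AA d a) (d - 1) ∧
      (aliveSet n alive').card + 3 ≤ (aliveSet n alive).card := by
  -- This forces `d ≥ 1`, and existing levels are `0` or larger than `d`. Hence a cell equal to `d`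
  -- marks exactly the vertices removed now.
  have hd := h.good.card_le
  have key : ∀ k ≤ n, alive k ≠ 0 →
      (k ∈ ParentForest.prune par u a (aliveSet n alive) ∧ lev' k = lev k ∧ alive' k ≠ 0) ∨
      (k ∉ ParentForest.prune par u a (aliveSet n alive) ∧ lev' k = d ∧ alive' k = 0) := by
    intro k hk hk'
    simp only [ParentForest.prune, Finset.mem_filter, mem_aliveSet, hk, hk', ne_eq,
      not_false_eq_true, true_and]
    by_cases hc : k = u ∨ k = a ∨ par k = u + 1 ∨ par k = a + 1
    · have h1 := l1 k hk ⟨hk', by omega⟩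
      exact .inr ⟨not_not.2 hc, h1, m1 k hk h1⟩
    · have h1 := l2 k (.inr (by omega))
      have h2 := h.lev_eq k
      exact .inl ⟨hc, h1, by rw [m2 k (.inr (by omega))]; exact hk'⟩
  have dead : ∀ k ≤ n, alive k = 0 → lev' k = lev k ∧ alive' k = 0 := by
    intro k hk hk'
    refine ⟨l2 k (.inr (by omega)), ?_⟩
    by_cases h1 : lev' k = d
    · exact m1 k hk h1
    · rw [m2 k (.inr h1), hk']
  have hA : aliveSet n alive' = ParentForest.prune par u a (aliveSet n alive) := by
    ext i
    have hsub : i ∈ ParentForest.prune par u a (aliveSet n alive) → i ≤ n ∧ alive i ≠ 0 :=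
      fun h => mem_aliveSet.1 (Finset.mem_filter.1 h).1
    rw [mem_aliveSet]
    constructor
    · rintro ⟨hi, hi'⟩
      by_cases h0 : alive i = 0
      · exact absurd (dead i hi h0).2 hi'
      · rcases key i hi h0 with h1 | h1
        exacts [h1.1, absurd h1.2.2 hi']
    · intro hi
      obtain ⟨h1, h2⟩ := hsub hi
      rcases key i h1 h2 with h3 | h3
      exacts [⟨h1, h3.2.2⟩, absurd hi h3.1]
  rw [hA]
  refine ⟨h.step hN hp (fun i hi => ?_) fun i hi => ?_, h.good.card_prune hp⟩
  · obtain ⟨h1, h2⟩ := mem_aliveSet.1 hi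
    rcases key i h1 h2 with h3 | h3
    · rw [if_pos h3.1, h3.2.1]
    · rw [if_neg h3.1, h3.2.1]
  · rw [mem_aliveSet] at hi
    rcases lt_or_ge n i with h1 | h1
    · exact l2 i (.inl h1)
    · exact (dead i h1 (by tauto)).1

/-- Both searches succeed by the counting lemmas `exists_small_branch` and `exists_bottom`. The
level array is written before the vertices are deleted, because its condition refers to the vertices
still present. -/
theorem pruneCmd_spec (h0 : s 0 0 = n)
    (hk : ∀ k ≤ n, s 10 k = (children (s 8) (aliveSet n (s 9)) k).card)
    (hg : ∀ k ≤ n, s 11 k = grand (s 8) (aliveSet n (s 9)) k)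
    (h : IsHistory (s 8) r (s 5 0) A₀ D (aliveSet n (s 9)) (s 15) (s 13) (s 14) (s 17 0))
    (hN : s 17 0 < (ParentForest.inner (s 8) (s 5 0) (aliveSet n (s 9))).card) {t : State}
    (ht : t = pruneCmd.run s) :
    IsHistory (s 8) r (s 5 0) A₀ D (aliveSet n (t 9)) (t 15) (t 13) (t 14) (t 17 0) ∧
      (aliveSet n (t 9)).card + 3 ≤ (aliveSet n (s 9)).card := by
  have mem : ∀ {k}, k ∈ aliveSet n (s 9) ↔ k ≤ n ∧ s 9 k ≠ 0 := mem_aliveSet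
  simp only [pruneCmd, run_seq, run_set, Expr.eval_var, Expr.eval_const, Expr.eval_sub] at ht
  set c1 : Expr := .and (.and (.get 9 (.var 20)) rootChildE)
    (.lt (.add (.get 10 (.var 20)) (.get 11 (.var 20))) (.const 2))
  obtain ⟨u, hu, hpu, eu⟩ := findCmd_spec_of_exists (s := s) (x := 34) (c := c1)
    (by decide) (by decide)
    (fun k => s 9 k ≠ 0 ∧ s 8 k = s 5 0 + 1 ∧ s 10 k + s 11 k < 2) (fun s' hb => by
      simp only [c1, rootChildE, Expr.holds_and, Expr.holds_get, Expr.holds_eq, Expr.holds_lt,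
        Expr.eval_var, Expr.eval_add, Expr.eval_get, Expr.eval_const, hb 9 (by decide),
        hb 8 (by decide), hb 5 (by decide), hb 10 (by decide), hb 11 (by decide), and_assoc])
    (by
      obtain ⟨u, hu, hs⟩ := h.good.exists_small_branch
      rw [mem_children, mem] at hu
      rw [h0]
      refine ⟨u, hu.1.1, hu.1.2, hu.2, ?_⟩
      rw [hk u hu.1.1, hg u hu.1.1]; omega)
  set s1 := (findCmd 34 c1).run s with hs1
  have f1 : ∀ b, b ∉ [20, 34] → s1 b = s b := fun b hb => by
    refine run_frame _ _ ?_
    simp [findCmd, writes] at hb ⊢; tauto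
  set c2 : Expr := .and (.and (.get 9 (.var 20)) (.and (.not (.eq (.var 20) (.var 5)))
    (.not rootChildE))) (.and (.get 10 (.var 20)) (.not (.get 11 (.var 20))))
  obtain ⟨a, ha, hpa, ea⟩ := findCmd_spec_of_exists (s := s1) (x := 35) (c := c2)
    (by decide) (by decide)
    (fun k => s 9 k ≠ 0 ∧ (k ≠ s 5 0 ∧ s 8 k ≠ s 5 0 + 1) ∧ s 10 k ≠ 0 ∧ s 11 k = 0)
    (fun s' hb => by
      simp only [c2, rootChildE, Expr.holds_and, Expr.holds_get, Expr.holds_eq, Expr.holds_not,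
        Expr.eval_var, Expr.eval_add, Expr.eval_get, Expr.eval_const, hb 9 (by decide),
        hb 8 (by decide), hb 5 (by decide), hb 10 (by decide), hb 11 (by decide), and_assoc,
        f1 9 (by decide), f1 8 (by decide), f1 5 (by decide), f1 10 (by decide),
        f1 11 (by decide), not_not, ne_eq])
    (by
      obtain ⟨a, ha, h1, h2, h3, h4⟩ := h.good.exists_bottom hN
      rw [mem] at ha
      rw [f1 0 (by decide), h0]
      refine ⟨a, ha.1, ha.2, ⟨h1, h2⟩, ?_, ?_⟩
      · rw [hk a ha.1]; omega
      · rw [hg a ha.1, h4])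
  set s2 := (findCmd 35 c2).run s1 with hs2
  have f2 : ∀ b, b ∉ [20, 35] → s2 b = s1 b := fun b hb => by
    refine run_frame _ _ ?_
    simp [findCmd, writes] at hb ⊢; tauto
  rw [h0] at hu
  rw [f1 0 (by decide), h0] at ha
  have hp : IsPair (s 8) (s 5 0) (aliveSet n (s 9)) u a := by
    refine ⟨mem.2 ⟨hu, hpu.1⟩, hpu.2.1, ?_, mem.2 ⟨ha, hpa.1⟩, hpa.2.1.1, hpa.2.1.2, ?_, ?_⟩
    · rw [← hk u hu, ← hg u hu]; omega
    · rw [← hk a ha]; omega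
    · rw [← hg a ha]; exact hpa.2.2.2
  set s3 := s2.write 13 (s2 17 0) (s2 34 0 - 1) with hs3
  set s4 := s3.write 14 (s3 17 0) (s3 35 0 - 1) with hs4
  have f4 : ∀ b, b ∉ [20, 34, 35, 13, 14] → s4 b = s b := fun b hb => by
    simp only [List.mem_cons, List.not_mem_nil, or_false, not_or] at hb
    rw [hs4, State.write_of_ne _ _ _ hb.2.2.2.2, hs3, State.write_of_ne _ _ _ hb.2.2.2.1,
      f2 b (by simp; tauto), f1 b (by simp; tauto)]
  have e34 : s4 34 0 = u + 1 := by
    rw [hs4, State.write_of_ne _ _ _ (by decide), hs3, State.write_of_ne _ _ _ (by decide),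
      f2 _ (by decide), eu]
  have e35 : s4 35 0 = a + 1 := by
    rw [hs4, State.write_of_ne _ _ _ (by decide), hs3, State.write_of_ne _ _ _ (by decide), ea]
  have e13 : s4 13 = Function.update (s 13) (s 17 0) u := by
    rw [hs4, State.write_of_ne _ _ _ (by decide), hs3, State.write_self, f2 13 (by decide),
      f1 13 (by decide), f2 17 (by decide), f1 17 (by decide), f2 34 (by decide), eu,
      Nat.add_sub_cancel]
  have e14 : s4 14 = Function.update (s 14) (s 17 0) a := by
    rw [hs4, State.write_self, hs3, State.write_of_ne _ _ _ (by decide),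
      State.write_of_ne _ _ _ (by decide), State.write_of_ne _ _ _ (by decide), f2 14 (by decide),
      f1 14 (by decide), f2 17 (by decide), f1 17 (by decide), ea, Nat.add_sub_cancel]
  set c3 : Expr := .and (.get 9 (.var 20)) (.or
    (.or (.eq (.add (.var 20) (.const 1)) (.var 34)) (.eq (.add (.var 20) (.const 1)) (.var 35)))
    (.or (.eq (.get 8 (.var 20)) (.var 34)) (.eq (.get 8 (.var 20)) (.var 35))))
  obtain ⟨l1, l2⟩ := fillCmd_spec (s := s4) (X := 15) (c := c3) (e := .var 17) (by decide)
    (by decide) (fun k => s 9 k ≠ 0 ∧ ((k = u ∨ k = a) ∨ (s 8 k = u + 1 ∨ s 8 k = a + 1)))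
    (fun _ => s 17 0) (fun s' hb _ => by
      simp only [c3, Expr.holds_and, Expr.holds_or, Expr.holds_get, Expr.holds_eq,
        Expr.eval_var, Expr.eval_add, Expr.eval_get, Expr.eval_const, hb 9 (by decide),
        hb 8 (by decide), hb 34 (by decide), hb 35 (by decide), hb 17 (by decide), e34, e35,
        f4 9 (by decide), f4 8 (by decide), f4 17 (by decide), add_left_inj, and_self])
  set s5 := (fillCmd 15 c3 (.var 17)).run s4 with hs5
  have f5 : ∀ b, b ∉ [20, 15] → s5 b = s4 b := fun b hb => by
    refine run_frame _ _ ?_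
    simp [fillCmd, writes] at hb ⊢; tauto
  set c4 : Expr := .eq (.get 15 (.var 20)) (.var 17)
  obtain ⟨m1, m2⟩ := fillCmd_spec (s := s5) (X := 9) (c := c4) (e := .const 0) (by decide)
    (by decide) (fun k => s5 15 k = s 17 0) (fun _ => 0) (fun s' hb _ => by
      simp only [c4, Expr.holds_eq, Expr.eval_var, Expr.eval_get, Expr.eval_const,
        hb 15 (by decide), hb 17 (by decide), f5 17 (by decide), f4 17 (by decide), and_self])
  set s6 := (fillCmd 9 c4 (.const 0)).run s5 with hs6
  have f6 : ∀ b, b ∉ [20, 9] → s6 b = s5 b := fun b hb => by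
    refine run_frame _ _ ?_
    simp [fillCmd, writes] at hb ⊢; tauto
  have t9 : t 9 = s6 9 := by rw [ht, State.write_of_ne _ _ _ (by decide)]
  have t15 : t 15 = s5 15 := by rw [ht, State.write_of_ne _ _ _ (by decide), f6 15 (by decide)]
  have t13 : t 13 = Function.update (s 13) (s 17 0) u := by
    rw [ht, State.write_of_ne _ _ _ (by decide), f6 _ (by decide), f5 _ (by decide), e13]
  have t14 : t 14 = Function.update (s 14) (s 17 0) a := by
    rw [ht, State.write_of_ne _ _ _ (by decide), f6 _ (by decide), f5 _ (by decide), e14]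
  have t17 : t 17 0 = s 17 0 - 1 := by
    rw [ht, State.write_self, Function.update_self, f6 _ (by decide), f5 _ (by decide),
      f4 _ (by decide)]
  rw [f4 0 (by decide), h0] at l1 l2
  rw [f5 0 (by decide), f4 0 (by decide), h0, f5 9 (by decide), f4 9 (by decide)] at m2
  rw [f5 0 (by decide), f4 0 (by decide), h0] at m1
  rw [f4 15 (by decide)] at l2
  rw [t9, t13, t14, t15, t17]
  exact h.step_of_arrays hN hp l1 l2 m1 m2

theorem reduceCmd_spec (h0 : s 0 0 = n)
    (hgood : IsGood (s 8) r (s 5 0) (aliveSet n (s 9)) (s 17 0)) (hlev : ∀ k, s 15 k = 0)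
    {t : State} (ht : t = reduceCmd.run s) :
    IsHistory (s 8) r (s 5 0) (aliveSet n (s 9)) (s 17 0) (aliveSet n (t 9)) (t 15) (t 13) (t 14)
      (t 17 0) ∧
    (ParentForest.inner (s 8) (s 5 0) (aliveSet n (t 9))).card ≤ t 17 0 := by
  set A₀ := aliveSet n (s 9) with hA₀
  have key := loop_inv (a := 23) (P := kidsCmd ;; .ite (.lt (.var 17) (.var 12)) pruneCmd .skip)
    (by simp [Valid, writes, kidsCmd, sumCmd, pruneCmd, findCmd, fillCmd]) s
    -- Each effective round removes at least three vertices, hence at least one. After `n + 1`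
    -- rounds no vertex would remain, but the root always does, so at some point there are no more
    -- vertices with children than colours.
    (fun m t => IsHistory (s 8) r (s 5 0) A₀ (s 17 0) (aliveSet n (t 9)) (t 15) (t 13) (t 14)
      (t 17 0) ∧ ((ParentForest.inner (s 8) (s 5 0) (aliveSet n (t 9))).card ≤ t 17 0 ∨
        (aliveSet n (t 9)).card + m ≤ n + 1)) ?_ ?_
  · rw [← reduceCmd, ← ht, h0] at key
    refine ⟨key.1, key.2.elim id fun h => ?_⟩
    have : 0 < (aliveSet n (t 9)).card := Finset.card_pos.2 ⟨_, key.1.good.root_mem⟩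
    omega
  · have f : ∀ b, b ≠ 23 → s.write 23 0 0 b = s b := fun b hb => State.write_of_ne _ _ _ hb
    rw [f 9 (by decide), f 15 (by decide), f 13 (by decide), f 14 (by decide), f 17 (by decide)]
    refine ⟨⟨hgood, ?_, fun i => .inl (hlev i), fun i hi => absurd (hlev i) hi, le_rfl,
      fun e h1 h2 => absurd h1 (by omega)⟩, .inr ?_⟩
    · exact Finset.filter_true_of_mem fun i _ => by rw [hlev]; omega
    · exact (Finset.card_filter_le (Finset.range (n + 1)) _).trans (by simp)
  · intro j s' hj hb ha ⟨h1, h2⟩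
    have e0 : s' 0 0 = n := by rw [hb 0 (by decide), h0]
    obtain ⟨k1, k2, k3⟩ := kidsCmd_spec e0
    rw [run_seq]
    set s1 := kidsCmd.run s' with hs1
    have f : ∀ b, b ∉ kidsCmd.writes → s1 b = s' b := fun b hb => run_frame _ _ hb
    have e8 : s1 8 = s 8 := by rw [f 8 (by decide), hb 8 (by decide)]
    have e5 : s1 5 = s 5 := by rw [f 5 (by decide), hb 5 (by decide)]
    rw [hb 8 (by decide), ← e8, ← f 9 (by decide)] at k1 k2
    rw [hb 8 (by decide), hb 5 (by decide), ← f 9 (by decide)] at k3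
    rw [← f 9 (by decide), ← f 15 (by decide), ← f 13 (by decide), ← f 14 (by decide),
      ← f 17 (by decide)] at h1
    rw [← f 9 (by decide), ← f 17 (by decide)] at h2
    rw [run_ite]
    have g : ∀ (t : State) b, b ≠ 23 → t.write 23 0 (j + 1) b = t b :=
      fun t b hb => State.write_of_ne _ _ _ hb
    rw [g _ 9 (by decide), g _ 15 (by decide), g _ 13 (by decide), g _ 14 (by decide),
      g _ 17 (by decide)]
    simp only [Expr.holds_lt, Expr.eval_var, k3]
    split_ifs with hc
    · have := pruneCmd_spec (s := s1) (by rw [f 0 (by decide), e0]) k1 k2 (by rw [e8, e5]; exact h1)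
        (by rw [e8, e5]; exact hc) rfl
      rw [e8, e5] at this
      refine ⟨this.1, .inr ?_⟩
      have := this.2
      omega
    · rw [run_skip]
      exact ⟨h1, .inl (by omega)⟩

end

end RAM

/-! ### Computing the initial colouring -/

namespace RAM

open Cmd ParentForest

/-- Colour the vertices that satisfy `c` with new colours, counted in variable `x`. -/
def numberCmd (x : ℕ) (c : Expr) : Cmd := .loop 20 (.ite c
  (.set x (.const 0) (.add (.var x) (.const 1)) ;; .set 2 (.var 20) (.var x)) .skip)

/-- Compute the initial colouring. -/
def initialCmd : Cmd :=
  kidsCmd ;;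
  .set 36 (.const 0) (.const 0) ;;
  numberCmd 36 (.and (.and (.get 9 (.var 20)) rootChildE) (.get 10 (.var 20))) ;;
  .set 37 (.const 0) (.var 36) ;;
  numberCmd 37 (.and (.and (.get 9 (.var 20)) rootChildE) (.not (.get 10 (.var 20)))) ;;
  .set 38 (.const 0) (.var 36) ;;
  numberCmd 38 (.and (.and (.get 9 (.var 20)) (.and (.not (.eq (.var 20) (.var 5)))
    (.not rootChildE))) (.get 10 (.var 20))) ;;
  fillCmd 2 (.and (.and (.get 9 (.var 20)) (.and (.not (.eq (.var 20) (.var 5)))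
    (.not (.get 8 (.var 20))))) (.not (.get 10 (.var 20)))) (.const 1)

section
variable {s : State} {n : ℕ}

theorem _root_.ParentForest.card_filter_lt_succ (S : Finset ℕ) (j : ℕ) :
    (S.filter (· < j + 1)).card = (S.filter (· < j)).card + if j ∈ S then 1 else 0 := by
  have : S.filter (· < j + 1) = S.filter (· < j) ∪ S.filter (· = j) := by
    ext k; simp only [Finset.mem_filter, Finset.mem_union, Nat.lt_succ_iff_lt_or_eq]; tauto
  rw [this, Finset.card_union_of_disjoint]
  · congr 1
    rw [Finset.filter_eq']
    split_ifs <;> simp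
  · rw [Finset.disjoint_left]; intro k hk hk'
    simp only [Finset.mem_filter] at hk hk'; omega

/-- Indices are visited in increasing order, so an element of `S` finds the counter advanced by the
number of elements up to itself. -/
theorem numberCmd_spec {x : ℕ} {c : Expr} (hx : x ∉ [0, 2, 20]) (h0 : s 0 0 = n) (S : Finset ℕ)
    (hS : ∀ k ∈ S, k ≤ n)
    (hc : ∀ s' : State, (∀ b, b ∉ [20, x, 2] → s' b = s b) → s' 20 0 ≤ n →
      (c.Holds s' ↔ s' 20 0 ∈ S)) :
    (numberCmd x c).run s x 0 = s x 0 + S.card ∧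
      ∀ k, (numberCmd x c).run s 2 k = if k ∈ S then s x 0 + pos S k else s 2 k := by
  simp only [List.mem_cons, List.not_mem_nil, or_false, not_or] at hx
  have key := loop_inv (a := 20) (P := .ite c
      (.set x (.const 0) (.add (.var x) (.const 1)) ;; .set 2 (.var 20) (.var x)) .skip)
    (by simp [Valid, writes]; tauto) s
    (fun m t => t x 0 = s x 0 + (S.filter (· < m)).card ∧
      ∀ k, t 2 k = if k ∈ S ∧ k < m then s x 0 + pos S k else s 2 k) ?_ ?_
  · rw [← numberCmd, h0] at key
    have hS' : S.filter (· < n + 1) = S :=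
      Finset.filter_true_of_mem fun k hk => by have := hS k hk; omega
    refine ⟨by rw [key.1, hS'], fun k => ?_⟩
    rw [key.2 k]
    by_cases hk : k ∈ S
    · have := hS k hk
      rw [if_pos ⟨hk, by omega⟩, if_pos hk]
    · rw [if_neg (fun h => hk h.1), if_neg hk]
  · rw [State.write_of_ne _ _ _ hx.2.2, State.write_of_ne _ _ _ (by decide)]
    simp
  · intro j s' hj hb ha ⟨h1, h2⟩
    have hc' := hc s' (fun b hb' => hb b (by simp [writes] at hb' ⊢; tauto)) (by omega)
    rw [ha] at hc'
    rw [State.write_of_ne _ _ _ hx.2.2, State.write_of_ne _ _ _ (by decide), card_filter_lt_succ,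
      run_ite]
    by_cases hjS : j ∈ S
    · rw [if_pos (hc'.2 hjS), if_pos hjS]
      simp only [run_seq, run_set, Expr.eval_var, Expr.eval_const, Expr.eval_add]
      have hpos : pos S j = (S.filter (· < j)).card + 1 := by
        have := card_filter_lt_succ S j
        rw [if_pos hjS] at this
        rw [← this, pos]; simp only [Nat.lt_succ_iff]
      refine ⟨?_, fun k => ?_⟩
      · rw [State.write_of_ne _ _ _ hx.2.1, State.write_self, Function.update_self, h1, add_assoc]
      · rw [State.write_self, State.write_self, Function.update_self,
          State.write_of_ne _ _ _ (Ne.symm hx.2.2), State.write_of_ne _ _ _ (Ne.symm hx.2.1), ha]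
        by_cases hk : k = j
        · subst hk
          rw [Function.update_self, if_pos ⟨hjS, by omega⟩, hpos]; omega
        · rw [Function.update_of_ne hk, h2]
          have : k < j + 1 ↔ k < j := by omega
          simp only [this]
    · rw [if_neg (fun h => hjS (hc'.1 h)), if_neg hjS, run_skip]
      refine ⟨h1, fun k => ?_⟩
      rw [h2]
      by_cases hk : k = j
      · subst hk; simp [hjS]
      · have : k < j + 1 ↔ k < j := by omega
        simp only [this]

theorem initialCmd_spec (h0 : s 0 0 = n) (hcol : ∀ k, s 2 k = 0) (hv : s 8 (s 5 0) = 0) :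
    IsInitial (s 8) (s 5 0) (aliveSet n (s 9)) (initialCmd.run s 2) := by
  classical
  obtain ⟨hk, -, -⟩ := kidsCmd_spec h0
  set A := aliveSet n (s 9) with hA
  set v := s 5 0 with hvd
  set s1 := kidsCmd.run s with hs1
  set s2 := s1.write 36 0 0 with hs2
  have f2 : ∀ b, b ∉ kidsCmd.writes → b ≠ 36 → s2 b = s b := fun b hb hb' => by
    rw [hs2, State.write_of_ne _ _ _ hb', hs1, run_frame _ _ hb]
  have k2 : s2 10 = s1 10 := State.write_of_ne _ _ _ (by decide)
  set c3 : Expr := .and (.and (.get 9 (.var 20)) rootChildE) (.get 10 (.var 20))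
  set s3 := (numberCmd 36 c3).run s2 with hs3
  have f3 : ∀ b, b ∉ [20, 36, 2] → s3 b = s2 b := fun b hb => by
    refine run_frame _ _ ?_
    simp [numberCmd, writes] at hb ⊢; tauto
  set s4 := s3.write 37 0 (s3 36 0) with hs4
  have f4 : ∀ b, b ∉ [20, 36, 2, 37] → s4 b = s2 b := fun b hb => by
    simp only [List.mem_cons, List.not_mem_nil, or_false, not_or] at hb
    rw [hs4, State.write_of_ne _ _ _ hb.2.2.2, f3 b (by simp; tauto)]
  set c5 : Expr := .and (.and (.get 9 (.var 20)) rootChildE) (.not (.get 10 (.var 20)))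
  set s5 := (numberCmd 37 c5).run s4 with hs5
  have f5 : ∀ b, b ∉ [20, 37, 2] → s5 b = s4 b := fun b hb => by
    refine run_frame _ _ ?_
    simp [numberCmd, writes] at hb ⊢; tauto
  set s6 := s5.write 38 0 (s5 36 0) with hs6
  have f6 : ∀ b, b ∉ [20, 36, 2, 37, 38] → s6 b = s2 b := fun b hb => by
    simp only [List.mem_cons, List.not_mem_nil, or_false, not_or] at hb
    rw [hs6, State.write_of_ne _ _ _ hb.2.2.2.2, f5 b (by simp; tauto), f4 b (by simp; tauto)]
  set c7 : Expr := .and (.and (.get 9 (.var 20)) (.and (.not (.eq (.var 20) (.var 5)))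
    (.not rootChildE))) (.get 10 (.var 20))
  set s7 := (numberCmd 38 c7).run s6 with hs7
  have f7 : ∀ b, b ∉ [20, 36, 2, 37, 38] → s7 b = s2 b := fun b hb => by
    have h : b ∉ [20, 38, 2] := by simp at hb ⊢; tauto
    rw [hs7, run_frame _ _ (by simp [numberCmd, writes] at h ⊢; tauto), f6 b hb]
  set c8 : Expr := .and (.and (.get 9 (.var 20)) (.and (.not (.eq (.var 20) (.var 5)))
    (.not (.get 8 (.var 20))))) (.not (.get 10 (.var 20)))
  have hrun : initialCmd.run s = (fillCmd 2 c8 (.const 1)).run s7 := rfl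
  have g9 : s2 9 = s 9 := f2 9 (by decide) (by decide)
  have g8 : s2 8 = s 8 := f2 8 (by decide) (by decide)
  have g5 : s2 5 = s 5 := f2 5 (by decide) (by decide)
  have g0 : s2 0 0 = n := by rw [f2 0 (by decide) (by decide), h0]
  have n3 := numberCmd_spec (s := s2) (x := 36) (c := c3) (by decide) g0 (innerRoots (s 8) v A)
    (fun k hk => by
      simp only [innerRoots, Finset.mem_filter, mem_children, hA, mem_aliveSet] at hk; omega)
    (fun s' hb hj => by
      have := hk _ hj
      simp only [c3, rootChildE, Expr.holds_and, Expr.holds_get, Expr.holds_eq,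
        Expr.eval_var, Expr.eval_add, Expr.eval_get, Expr.eval_const, hb 9 (by decide),
        hb 8 (by decide), hb 5 (by decide), hb 10 (by decide), g9, g8, g5, k2, this,
        innerRoots, Finset.mem_filter, mem_children, hA, mem_aliveSet, hj, ← hvd, true_and,
        Nat.one_le_iff_ne_zero])
  have n5 := numberCmd_spec (s := s4) (x := 37) (c := c5) (by decide)
    (by rw [f4 0 (by decide), g0]) (leafRoots (s 8) v A)
    (fun k hk => by
      simp only [leafRoots, Finset.mem_filter, mem_children, hA, mem_aliveSet] at hk; omega)
    (fun s' hb hj => by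
      have := hk _ hj
      simp only [c5, rootChildE, Expr.holds_and, Expr.holds_get, Expr.holds_eq, Expr.holds_not,
        Expr.eval_var, Expr.eval_add, Expr.eval_get, Expr.eval_const, hb 9 (by decide),
        hb 8 (by decide), hb 5 (by decide), hb 10 (by decide), f4 9 (by decide), f4 8 (by decide),
        f4 5 (by decide), f4 10 (by decide), g9, g8, g5, k2, this,
        leafRoots, Finset.mem_filter, mem_children, hA, mem_aliveSet, hj, ← hvd, true_and,
        not_not, ne_eq])
  have n7 := numberCmd_spec (s := s6) (x := 38) (c := c7) (by decide)
    (by rw [f6 0 (by decide), g0]) (deepInner (s 8) v A)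
    (fun k hk => by
      simp only [deepInner, Finset.mem_filter, hA, mem_aliveSet] at hk; omega)
    (fun s' hb hj => by
      have := hk _ hj
      simp only [c7, rootChildE, Expr.holds_and, Expr.holds_get, Expr.holds_eq, Expr.holds_not,
        Expr.eval_var, Expr.eval_add, Expr.eval_get, Expr.eval_const, hb 9 (by decide),
        hb 8 (by decide), hb 5 (by decide), hb 10 (by decide), f6 9 (by decide), f6 8 (by decide),
        f6 5 (by decide), f6 10 (by decide), g9, g8, g5, k2, this,
        deepInner, Finset.mem_filter, hA, mem_aliveSet, hj, ← hvd, true_and,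
        ne_eq, Nat.one_le_iff_ne_zero, and_assoc])
  obtain ⟨m1, m2⟩ := fillCmd_spec (s := s7) (X := 2) (c := c8) (e := .const 1) (by decide)
    (by decide) (fun k => s 9 k ≠ 0 ∧ k ≠ v ∧ s 8 k = 0 ∧ s1 10 k = 0) (fun _ => 1)
    (fun s' hb _ => by
      simp only [c8, Expr.holds_and, Expr.holds_get, Expr.holds_eq, Expr.holds_not,
        Expr.eval_var, Expr.eval_const, hb 9 (by decide),
        hb 8 (by decide), hb 5 (by decide), hb 10 (by decide), f7 9 (by decide), f7 8 (by decide),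
        f7 5 (by decide), f7 10 (by decide), g9, g8, g5, k2, ← hvd, and_assoc, not_not, ne_eq,
        and_self])
  rw [← hrun, f7 0 (by decide), g0] at m1 m2
  have x2 : s2 36 0 = 0 := by rw [hs2, State.write_self, Function.update_self]
  have c2 : ∀ k, s2 2 k = 0 := fun k => by rw [f2 2 (by decide) (by decide), hcol]
  rw [← hs3, x2] at n3
  have x3 : s3 36 0 = (innerRoots (s 8) v A).card := by rw [n3.1, zero_add]
  have x4 : s4 37 0 = (innerRoots (s 8) v A).card := by
    rw [hs4, State.write_self, Function.update_self, x3]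
  have x6 : s6 38 0 = (innerRoots (s 8) v A).card := by
    rw [hs6, State.write_self, Function.update_self, f5 36 (by decide), hs4,
      State.write_of_ne _ _ _ (by decide), x3]
  have c3' := n3.2
  have c5' := n5.2
  have c7' := n7.2
  rw [← hs5, x4, hs4, State.write_of_ne _ _ _ (by decide)] at c5'
  rw [← hs7, x6, hs6, State.write_of_ne _ _ _ (by decide)] at c7'
  -- The counters for `leafRoots` and `deepInner` both start at the number of `innerRoots`, so these
  -- two families reuse the same colours. As the three families are disjoint, the order of writing
  -- does not matter.
  have col : ∀ k, s7 2 k = if k ∈ deepInner (s 8) v A then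
      (innerRoots (s 8) v A).card + pos (deepInner (s 8) v A) k
      else if k ∈ leafRoots (s 8) v A then
        (innerRoots (s 8) v A).card + pos (leafRoots (s 8) v A) k
      else if k ∈ innerRoots (s 8) v A then pos (innerRoots (s 8) v A) k else 0 := by
    intro k
    rw [c7', c5', c3', c2, zero_add]
  have kA : ∀ k ∈ A, k ≤ n ∧ s 9 k ≠ 0 ∧ s1 10 k = (children (s 8) A k).card := fun k hkA =>
    ⟨(mem_aliveSet.1 hkA).1, (mem_aliveSet.1 hkA).2, hk k (mem_aliveSet.1 hkA).1⟩
  have dI : ∀ k, k ∈ innerRoots (s 8) v A ↔ k ∈ A ∧ s 8 k = v + 1 ∧ 1 ≤ (children (s 8) A k).card :=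
    fun k => by simp [innerRoots, and_assoc]
  have dL : ∀ k, k ∈ leafRoots (s 8) v A ↔ k ∈ A ∧ s 8 k = v + 1 ∧ (children (s 8) A k).card = 0 :=
    fun k => by simp only [leafRoots, Finset.mem_filter, mem_children, and_assoc]
  have dD : ∀ k, k ∈ deepInner (s 8) v A ↔ k ∈ A ∧ k ≠ v ∧ s 8 k ≠ v + 1 ∧
      1 ≤ (children (s 8) A k).card :=
    fun k => by simp only [deepInner, Finset.mem_filter]
  refine ⟨?_, ?_, ?_, ?_, ?_, ?_⟩
  · rw [m2 v (.inr (by tauto)), col, if_neg, if_neg, if_neg]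
    · rw [dI]; omega
    · rw [dL]; omega
    · rw [dD]; tauto
  · intro i hi
    have hi' := (dI i).1 hi
    rw [m2 i (.inr (by omega)), col, if_neg, if_neg, if_pos hi]
    · rw [dL]; omega
    · rw [dD]; tauto
  · intro i hi
    have hi' := (dL i).1 hi
    rw [m2 i (.inr (by omega)), col, if_neg, if_pos hi]
    rw [dD]; tauto
  · intro i hi
    have hi' := (dD i).1 hi
    have := kA i hi'.1
    rw [m2 i (.inr (by omega)), col, if_pos hi]
  · intro i hi hiv hp hch
    have := kA i hi
    exact m1 i this.1 ⟨this.2.1, hiv, hp, by omega⟩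
  · intro i hi hch
    simp only [low, Finset.mem_filter] at hi
    have := kA i hi.1
    rw [m2 i (.inr (by tauto)), col, if_neg, if_neg, if_neg]
    · rw [dI]; omega
    · rw [dL]; tauto
    · rw [dD]; omega

end

end RAM

/-! ### Running the greedy colouring -/

namespace RAM

open Cmd ParentForest

/-- The colour of the parent of vertex `i`. -/
def parentColE (i : Expr) : Expr := .get 2 (.sub (.get 8 i) (.const 1))

/-- The vertex in variable `21` has a parent other than the root. -/
def lowE : Expr := .and (.get 9 (.var 21)) (.and (.get 8 (.var 21))
  (.not (.eq (.get 8 (.var 21)) (.add (.var 5) (.const 1)))))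

/-- The vertex in variable `x` is alive and uncoloured, and not the root. -/
def uncoloredE (x : ℕ) : Expr := .and (.get 9 (.var x))
  (.and (.not (.eq (.var x) (.var 5))) (.not (.get 2 (.var x))))

/-- Colour an uncoloured vertex whose parent's colour meets as many edges as possible. -/
def greedyStepCmd : Cmd :=
  sumCmd 40 (.and lowE (.or (.eq (.get 2 (.var 21)) (parentColE (.var 20)))
    (.eq (parentColE (.var 21)) (parentColE (.var 20))))) (.const 1) ;;
  sumCmd 42 (.and (uncoloredE 21) (.lt (.get 40 (.var 20)) (.get 40 (.var 21)))) (.const 1) ;;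
  findCmd 34 (.and (uncoloredE 20) (.not (.get 42 (.var 20)))) ;;
  .ite (.var 34) (
    .set 35 (.const 0) (parentColE (.sub (.var 34) (.const 1))) ;;
    sumCmd 41 (.and lowE (.or
      (.and (.eq (.get 2 (.var 21)) (.var 35)) (.eq (parentColE (.var 21)) (.var 20)))
      (.and (.eq (.get 2 (.var 21)) (.var 20)) (.eq (parentColE (.var 21)) (.var 35)))))
      (.const 1) ;;
    findCmd 33 (.and (.and (.var 20) (.not (.lt (.var 17) (.var 20))))
      (.and (.not (.eq (.var 20) (.var 35))) (.not (.get 41 (.var 20))))) ;;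
    .set 2 (.sub (.var 34) (.const 1)) (.sub (.var 33) (.const 1))) .skip

/-- Colour all vertices. -/
def greedyCmd : Cmd := .loop 23 greedyStepCmd

section
variable {s : State} {n : ℕ} {r : ℕ → ℕ}

/-- The uncoloured vertices. -/
def _root_.ParentForest.uncolored (v : ℕ) (A : Finset ℕ) (col : ℕ → ℕ) : Finset ℕ :=
  A.filter fun i => i ≠ v ∧ col i = 0

theorem mem_low_aliveSet {par alive : ℕ → ℕ} {v j : ℕ} :
    j ∈ low par v (aliveSet n alive) ↔ j ≤ n ∧ alive j ≠ 0 ∧ par j ≠ 0 ∧ par j ≠ v + 1 := by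
  simp only [low, Finset.mem_filter, mem_aliveSet, and_assoc]

theorem mem_uncolored_aliveSet {col alive : ℕ → ℕ} {v j : ℕ} :
    j ∈ uncolored v (aliveSet n alive) col ↔ j ≤ n ∧ alive j ≠ 0 ∧ j ≠ v ∧ col j = 0 := by
  simp only [uncolored, Finset.mem_filter, mem_aliveSet, and_assoc]

theorem sum_boole_eq_card {p : ℕ → Prop} [DecidablePred p] {S : Finset ℕ}
    (h : ∀ j, j ∈ S ↔ j ≤ n ∧ p j) :
    ∑ j ∈ Finset.range (n + 1), (if p j then 1 else 0) = S.card := by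
  rw [Finset.sum_boole, Nat.cast_id]
  congr 1; ext j
  rw [h, Finset.mem_filter, Finset.mem_range, Nat.lt_succ_iff]

/-- The root and its `d` children are distinct numbers up to `n`. So a loop up to `n` visits every
colour, and `n + 1` rounds suffice for one round per colour. -/
theorem colors_le {par alive : ℕ → ℕ} {v d : ℕ} (h : IsGood par r v (aliveSet n alive) d) :
    d ≤ n := by
  have hsub : insert v (children par (aliveSet n alive) v) ⊆ Finset.range (n + 1) := by
    intro k hk
    rw [Finset.mem_insert, mem_children] at hk
    have : k ∈ aliveSet n alive := by
      rcases hk with rfl | hk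
      exacts [h.root_mem, hk.1]
    exact Finset.mem_range_succ_iff.2 (mem_aliveSet.1 this).1
  have := Finset.card_le_card hsub
  rw [Finset.card_insert_of_notMem, h.card_root, Finset.card_range] at this
  · omega
  · rw [mem_children, h.par_root]; omega

open Classical in
theorem greedyStepCmd_spec (h0 : s 0 0 = n)
    (hgood : IsGood (s 8) r (s 5 0) (aliveSet n (s 9)) (s 17 0))
    (hc : IsPartial (s 8) (s 5 0) (aliveSet n (s 9)) (s 17 0) (s 2)) :
    (uncolored (s 5 0) (aliveSet n (s 9)) (s 2) = ∅ ∧ greedyStepCmd.run s 2 = s 2) ∨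
    ∃ i ∈ uncolored (s 5 0) (aliveSet n (s 9)) (s 2), ∃ Y, 1 ≤ Y ∧
      greedyStepCmd.run s 2 = Function.update (s 2) i Y ∧
      IsPartial (s 8) (s 5 0) (aliveSet n (s 9)) (s 17 0) (greedyStepCmd.run s 2) := by
  set A := aliveSet n (s 9) with hA
  set v := s 5 0 with hv
  have hlow : ∀ {j}, j ∈ low (s 8) v A ↔ j ≤ n ∧ s 9 j ≠ 0 ∧ s 8 j ≠ 0 ∧ s 8 j ≠ v + 1 :=
    mem_low_aliveSet
  have hunc : ∀ {j}, j ∈ uncolored v A (s 2) ↔ j ≤ n ∧ s 9 j ≠ 0 ∧ j ≠ v ∧ s 2 j = 0 :=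
    mem_uncolored_aliveSet
  have hul : ∀ j ∈ uncolored v A (s 2), j ∈ low (s 8) v A := by
    intro j hj
    simp only [uncolored, Finset.mem_filter] at hj
    -- In a partial colouring only vertices of `low` can be uncoloured, so the greedy lemmas apply
    -- to every uncoloured vertex.
    by_contra hjl
    exact hc.pos j hj.1 hj.2.1 hjl hj.2.2
  have hlu : ∀ j ∈ low (s 8) v A, s 2 j = 0 → j ∈ uncolored v A (s 2) := by
    intro j hj hj0
    have := hlow.1 hj
    refine hunc.2 ⟨this.1, this.2.1, ?_, hj0⟩
    rintro rfl
    exact this.2.2.1 hgood.par_root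
  set c1 : Expr := .and lowE (.or (.eq (.get 2 (.var 21)) (parentColE (.var 20)))
    (.eq (parentColE (.var 21)) (parentColE (.var 20)))) with hc1
  set s1 := (sumCmd 40 c1 (.const 1)).run s with hs1
  have f1 : ∀ b, b ∉ [20, 21, 30, 40] → s1 b = s b := fun b hb => by
    refine run_frame _ _ ?_
    simp [sumCmd, writes] at hb ⊢; tauto
  have h1 : ∀ k ≤ n, s1 40 k = (meets (s 8) v A (s 2) (s 2 (s 8 k - 1))).card := by
    intro k hk
    rw [hs1, sumCmd_spec (by decide) (fun k j => if (s 9 j ≠ 0 ∧ s 8 j ≠ 0 ∧ s 8 j ≠ v + 1) ∧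
      (s 2 j = s 2 (s 8 k - 1) ∨ s 2 (s 8 j - 1) = s 2 (s 8 k - 1)) then 1 else 0) ?_
      (by rw [h0]; exact hk), h0]
    · refine sum_boole_eq_card fun j => ?_
      rw [meets, Finset.mem_filter, hlow]; tauto
    · intro s' hb
      simp only [hc1, lowE, parentColE, Expr.holds_and, Expr.holds_or, Expr.holds_not,
        Expr.holds_get, Expr.holds_eq, Expr.eval_get, Expr.eval_var, Expr.eval_add, Expr.eval_sub,
        Expr.eval_const, hb 9 (by decide), hb 8 (by decide), hb 2 (by decide), hb 5 (by decide),
        ← hv, ne_eq]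
  set c2 : Expr := .and (uncoloredE 21) (.lt (.get 40 (.var 20)) (.get 40 (.var 21))) with hc2
  set s2 := (sumCmd 42 c2 (.const 1)).run s1 with hs2
  have f2 : ∀ b, b ∉ [20, 21, 30, 42] → s2 b = s1 b := fun b hb => by
    refine run_frame _ _ ?_
    simp [sumCmd, writes] at hb ⊢; tauto
  -- The maximum is found by counting: an uncoloured vertex attains it exactly when no uncoloured
  -- vertex has a strictly larger value.
  have h2 : ∀ k ≤ n, s2 42 k =
      ((uncolored v A (s 2)).filter fun j => s1 40 k < s1 40 j).card := by
    intro k hk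
    rw [hs2, sumCmd_spec (by decide) (fun k j => if (s 9 j ≠ 0 ∧ j ≠ v ∧ s 2 j = 0) ∧
      s1 40 k < s1 40 j then 1 else 0) ?_
      (by rw [f1 0 (by decide), h0]; exact hk), f1 0 (by decide), h0]
    · refine sum_boole_eq_card fun j => ?_
      rw [Finset.mem_filter, hunc]; tauto
    · intro s' hb
      simp only [hc2, uncoloredE, Expr.holds_and, Expr.holds_lt, Expr.holds_not,
        Expr.holds_get, Expr.holds_eq, Expr.eval_get, Expr.eval_var,
        Expr.eval_const, hb 9 (by decide), hb 40 (by decide), hb 2 (by decide), hb 5 (by decide),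
        f1 9 (by decide), f1 2 (by decide), f1 5 (by decide),
        ← hv, ne_eq, not_not]
  set c3 : Expr := .and (uncoloredE 20) (.not (.get 42 (.var 20))) with hc3
  have h3 := findCmd_spec (s := s2) (x := 34) (c := c3) (by decide) (by decide)
    (fun k => (s 9 k ≠ 0 ∧ k ≠ v ∧ s 2 k = 0) ∧ s2 42 k = 0) (fun s' hb => by
      simp only [hc3, uncoloredE, Expr.holds_and, Expr.holds_not,
        Expr.holds_get, Expr.holds_eq, Expr.eval_var,
        hb 9 (by decide), hb 42 (by decide), hb 2 (by decide), hb 5 (by decide),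
        f2 9 (by decide), f2 2 (by decide), f2 5 (by decide),
        f1 9 (by decide), f1 2 (by decide), f1 5 (by decide),
        ← hv, ne_eq, not_not])
  set s3 := (findCmd 34 c3).run s2 with hs3
  have f3 : ∀ b, b ∉ [20, 21, 30, 40, 42, 34] → s3 b = s b := fun b hb => by
    simp only [List.mem_cons, List.not_mem_nil, or_false, not_or] at hb
    rw [hs3, run_frame _ _ (by simp [findCmd, writes]; tauto), f2 b (by simp; tauto),
      f1 b (by simp; tauto)]
  rw [f2 0 (by decide), f1 0 (by decide), h0] at h3
  simp only [greedyStepCmd, run_seq]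
  rw [← hc1, ← hc2, ← hc3, ← hs1, ← hs2, ← hs3, run_ite]
  rcases h3 with ⟨h3, h3'⟩ | ⟨i, hin, ⟨hi1, hi2⟩, h3⟩
  · rw [if_neg (by simp [h3]), run_skip, f3 2 (by decide)]
    left
    refine ⟨?_, rfl⟩
    by_contra hne
    obtain ⟨i, hi, hmax⟩ := Finset.exists_max_image _ (s1 40) (Finset.nonempty_iff_ne_empty.2 hne)
    have hi' := hunc.1 hi
    refine h3' i hi'.1 ⟨hi'.2, ?_⟩
    rw [h2 i hi'.1, Finset.card_eq_zero, Finset.filter_eq_empty_iff]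
    intro j hj
    have := hmax j hj
    omega
  · rw [if_pos (by simp [h3])]
    right
    have hi : i ∈ uncolored v A (s 2) := hunc.2 ⟨hin, hi1⟩
    have hil := hul i hi
    rw [h2 i hin, Finset.card_eq_zero, Finset.filter_eq_empty_iff] at hi2
    refine ⟨i, hi, ?_⟩
    set X := s 2 (s 8 i - 1) with hX
    simp only [run_seq, run_set]
    set s4 := s3.write 35 ((Expr.const 0).eval s3)
      ((parentColE (.sub (.var 34) (.const 1))).eval s3) with hs4
    have x4 : s4 35 0 = X := by
      simp only [hs4, State.write_self, parentColE, Expr.eval_get, Expr.eval_sub, Expr.eval_var,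
        Expr.eval_const, h3, f3 2 (by decide), f3 8 (by decide), Function.update_self,
        Nat.add_sub_cancel, ← hX]
    have f4 : ∀ b, b ∉ [20, 21, 30, 40, 42, 34, 35] → s4 b = s b := fun b hb => by
      simp only [List.mem_cons, List.not_mem_nil, or_false, not_or] at hb
      rw [hs4, State.write_of_ne _ _ _ (by tauto), f3 b (by simp; tauto)]
    have x4' : s4 34 0 = i + 1 := by rw [hs4, State.write_of_ne _ _ _ (by decide), h3]
    set c5 : Expr := .and lowE (.or
      (.and (.eq (.get 2 (.var 21)) (.var 35)) (.eq (parentColE (.var 21)) (.var 20)))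
      (.and (.eq (.get 2 (.var 21)) (.var 20)) (.eq (parentColE (.var 21)) (.var 35)))) with hc5
    set s5 := (sumCmd 41 c5 (.const 1)).run s4 with hs5
    have h5 : ∀ k ≤ n, s5 41 k = ((low (s 8) v A).filter fun j =>
        (s 2 j = X ∧ s 2 (s 8 j - 1) = k) ∨ (s 2 j = k ∧ s 2 (s 8 j - 1) = X)).card := by
      intro k hk
      rw [hs5, sumCmd_spec (by decide) (fun k j => if (s 9 j ≠ 0 ∧ s 8 j ≠ 0 ∧ s 8 j ≠ v + 1) ∧
        ((s 2 j = X ∧ s 2 (s 8 j - 1) = k) ∨ (s 2 j = k ∧ s 2 (s 8 j - 1) = X)) then 1 else 0) ?_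
        (by rw [f4 0 (by decide), h0]; exact hk), f4 0 (by decide), h0]
      · refine sum_boole_eq_card fun j => ?_
        rw [Finset.mem_filter, hlow]; tauto
      · intro s' hb
        simp only [hc5, lowE, parentColE, Expr.holds_and, Expr.holds_or, Expr.holds_not,
          Expr.holds_get, Expr.holds_eq, Expr.eval_get, Expr.eval_var, Expr.eval_add,
          Expr.eval_sub, Expr.eval_const, hb 9 (by decide), hb 8 (by decide), hb 2 (by decide),
          hb 5 (by decide), hb 35 (by decide), f4 9 (by decide), f4 8 (by decide),
          f4 2 (by decide), f4 5 (by decide), x4, ← hv, ne_eq]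
    have f5 : ∀ b, b ∉ [20, 21, 30, 41] → s5 b = s4 b := fun b hb => by
      refine run_frame _ _ ?_
      simp [sumCmd, writes] at hb ⊢; tauto
    -- Array `41` counts the edges outside the root with the colours `X` and `k`, so a zero entry
    -- means that the pair is free.
    have hzero : ∀ k ≤ n, s5 41 k = 0 ↔ IsUnused (s 8) v A (s 2) X k := by
      intro k hk
      rw [h5 k hk, Finset.card_eq_zero, Finset.filter_eq_empty_iff]
      exact forall₂_congr fun j _ => not_or
    have hi0 : s 2 i = 0 := hi1.2.2
    have hdn : s 17 0 ≤ n := colors_le hgood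
    set c6 : Expr := .and (.and (.var 20) (.not (.lt (.var 17) (.var 20))))
      (.and (.not (.eq (.var 20) (.var 35))) (.not (.get 41 (.var 20)))) with hc6
    obtain ⟨Y, hYn, ⟨hY1, hYd, hYX, hY0⟩, h6⟩ := findCmd_spec_of_exists (s := s5) (x := 33)
      (c := c6) (by decide) (by decide)
      (fun k => k ≠ 0 ∧ k ≤ s 17 0 ∧ k ≠ X ∧ s5 41 k = 0) (fun s' hb => by
        simp only [hc6, Expr.holds_and, Expr.holds_not, Expr.holds_lt, Expr.holds_var,
          Expr.holds_get, Expr.holds_eq, Expr.eval_var,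
          hb 17 (by decide), hb 35 (by decide), hb 41 (by decide),
          f5 17 (by decide), f4 17 (by decide), f5 35 (by decide), x4, ne_eq, not_not, not_lt,
          and_assoc])
      (by
        obtain ⟨Y, h1, h2, h3, h4⟩ := hc.exists_unused hgood hil hi0
        rw [f5 0 (by decide), f4 0 (by decide), h0]
        exact ⟨Y, by omega, by omega, h2, h3, (hzero Y (by omega)).2 h4⟩)
    rw [f5 0 (by decide), f4 0 (by decide), h0] at hYn
    set s6 := (findCmd 33 c6).run s5 with hs6
    have f6 : ∀ b, b ∉ [20, 33] → s6 b = s5 b := fun b hb => by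
      refine run_frame _ _ ?_
      simp [findCmd, writes] at hb ⊢; tauto
    have hrun : (s6.write 2 (((Expr.var 34).sub (.const 1)).eval s6)
        (((Expr.var 33).sub (.const 1)).eval s6)) 2 = Function.update (s 2) i Y := by
      simp only [State.write_self, Expr.eval_sub, Expr.eval_var, Expr.eval_const, h6,
        f6 34 (by decide), f5 34 (by decide), x4', f6 2 (by decide), f5 2 (by decide),
        f4 2 (by decide), Nat.add_sub_cancel]
    rw [hrun]
    refine ⟨Y, by omega, rfl, hc.update hgood hil hi0 (fun j hj hj0 => ?_) (by omega) hYd hYX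
      ((hzero Y hYn).1 hY0)⟩
    have := hi2 (hlu j hj hj0)
    rw [h1 i hin, h1 j (hlow.1 hj).1] at this
    exact not_lt.1 this

theorem greedyCmd_spec (h0 : s 0 0 = n)
    (hgood : IsGood (s 8) r (s 5 0) (aliveSet n (s 9)) (s 17 0))
    (hc : IsPartial (s 8) (s 5 0) (aliveSet n (s 9)) (s 17 0) (s 2)) :
    IsHarm (s 8) (s 5 0) (aliveSet n (s 9)) (s 17 0) (greedyCmd.run s 2) := by
  set A := aliveSet n (s 9) with hA
  have key := loop_inv (a := 23) (P := greedyStepCmd)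
    (by simp [Valid, writes, greedyStepCmd, sumCmd, findCmd]) s
    -- Every round colours one more vertex or finds none uncoloured, and there are at most `n + 1`
    -- vertices.
    (fun m t => IsPartial (s 8) (s 5 0) A (s 17 0) (t 2) ∧
      (uncolored (s 5 0) A (t 2) = ∅ ∨ (uncolored (s 5 0) A (t 2)).card + m ≤ n + 1)) ?_ ?_
  · rw [← greedyCmd, h0] at key
    refine key.1.isHarm (fun i hi hiv hi0 => ?_) hgood
    have hmem : i ∈ uncolored (s 5 0) A (greedyCmd.run s 2) := Finset.mem_filter.2 ⟨hi, hiv, hi0⟩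
    rcases key.2 with h | h
    · rw [h] at hmem; exact absurd hmem (Finset.notMem_empty _)
    · have := Finset.card_pos.2 ⟨_, hmem⟩
      omega
  · rw [State.write_of_ne _ _ _ (by decide)]
    refine ⟨hc, .inr ?_⟩
    have h1 := Finset.card_filter_le A fun i => i ≠ s 5 0 ∧ s 2 i = 0
    have h2 := Finset.card_filter_le (Finset.range (n + 1)) fun i => s 9 i ≠ 0
    rw [Finset.card_range] at h2
    exact h1.trans h2
  · intro j s' hj hb ha ⟨h1, h2⟩
    rw [State.write_of_ne _ _ _ (by decide)]
    have e : ∀ b ∈ [0, 5, 8, 9, 17], s' b = s b := by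
      intro b hb'
      refine hb b ?_
      simp only [List.mem_cons, List.not_mem_nil, or_false] at hb'
      rcases hb' with rfl | rfl | rfl | rfl | rfl <;> decide
    have hA' : A = aliveSet n (s' 9) := by rw [e 9 (by decide)]
    rw [hA', ← e 5 (by decide), ← e 8 (by decide), ← e 17 (by decide)] at h1 hgood ⊢
    rw [hA', ← e 5 (by decide)] at h2
    rcases greedyStepCmd_spec (by rw [e 0 (by decide), h0]) hgood h1 with
      ⟨h3, h4⟩ | ⟨i, hi, Y, hY, h3, h4⟩
    · rw [h4]; exact ⟨h1, .inl h3⟩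
    · refine ⟨h4, .inr ?_⟩
      have hlt : uncolored (s' 5 0) (aliveSet n (s' 9)) (greedyStepCmd.run s' 2) ⊂
          uncolored (s' 5 0) (aliveSet n (s' 9)) (s' 2) := by
        rw [h3]
        refine (Finset.ssubset_iff_of_subset ?_).2 ⟨i, hi, ?_⟩
        · intro k hk
          simp only [uncolored, Finset.mem_filter] at hk ⊢
          refine ⟨hk.1, hk.2.1, ?_⟩
          by_cases hki : k = i
          · subst hki
            have := hk.2.2
            rw [Function.update_self] at this; omega
          · have := hk.2.2
            rwa [Function.update_of_ne hki] at this
        · simp only [uncolored, Finset.mem_filter, Function.update_self]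
          omega
      have := Finset.card_lt_card hlt
      rcases h2 with h2 | h2
      · rw [h2] at hi; exact absurd hi (Finset.notMem_empty _)
      · omega

end

end RAM

/-! ### Undoing the removals -/

namespace ParentForest

variable {par r : ℕ → ℕ} {v d u a : ℕ} {A A₀ : Finset ℕ} {lev UU AA : ℕ → ℕ}

/-- Otherwise `u` would have both a child, `a`, and a grandchild, a child of `a`. -/
theorem IsPair.notMem_children (hp : IsPair par v A u a) : a ∉ children par A u := by
  intro h1
  have h2 : (children par A a).card ≤ grand par A u :=
    Finset.single_le_sum (f := fun i => (children par A i).card) (fun _ _ => Nat.zero_le _) h1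
  have h3 : 1 ≤ (children par A u).card := Finset.card_pos.2 ⟨_, h1⟩
  have := hp.small_u
  have := hp.inner_a
  omega

/-- Level `d` consists of `u`, `a` and their children, and neither `u` nor `a` is a child of one of
them. So the program recognises the freed vertices from the recorded levels alone. -/
theorem IsStep.mem_freed (h : IsStep par r v A₀ lev UU AA d) (hmem : ∀ i, lev i ≠ 0 → i ∈ A₀)
    {i : ℕ} : i ∈ freed par (UU d) (AA d) {i ∈ A₀ | lev i ≤ d} ↔
      lev i = d ∧ i ≠ UU d ∧ i ≠ AA d := by
  have hg := h.good
  have hp := h.pair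
  have hpr := h.prune
  generalize UU d = u at *
  generalize AA d = a at *
  have hd : 1 ≤ d := by have := hg.card_le; omega
  have hmA : i ∈ A₀.filter (lev · ≤ d) ↔ i ∈ A₀ ∧ lev i ≤ d := Finset.mem_filter
  have hmp : i ∈ A₀.filter (lev · ≤ d - 1) ↔ i ∈ A₀ ∧ lev i ≤ d - 1 := Finset.mem_filter
  rw [hpr] at hmp
  have hlev : lev i = d ↔ i ∈ A₀.filter (lev · ≤ d) ∧
      i ∉ ParentForest.prune par u a (A₀.filter (lev · ≤ d)) := by
    rw [hmA, hmp]
    constructor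
    · intro h'; exact ⟨⟨hmem i (by omega), by omega⟩, by omega⟩
    · rintro ⟨⟨h1, h2⟩, h3⟩
      have : ¬ lev i ≤ d - 1 := fun h4 => h3 ⟨h1, h4⟩
      omega
  rw [hlev]
  simp only [freed, ParentForest.prune, Finset.mem_union, mem_children]
  rw [Finset.mem_filter (s := A₀.filter (lev · ≤ d))]
  constructor
  · intro h1
    have hiA : i ∈ A₀.filter (lev · ≤ d) := by tauto
    refine ⟨⟨hiA, by tauto⟩, ?_, ?_⟩
    · rintro rfl
      have h2 := hp.par_u
      have h3 := hp.ne_a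
      have h4 := hg.par_root
      rcases h1 with h1 | h1
      · have : i = v := by omega
        rw [this] at h2; omega
      · omega
    · rintro rfl
      rcases h1 with h1 | h1
      · exact hp.notMem_children (mem_children.2 h1)
      · have := hg.rank i h1.1 (by omega)
        rw [h1.2] at this; simp at this
  · tauto

end ParentForest

namespace RAM

open Cmd ParentForest

/-- The vertex in variable `20` was removed as a child when the colour in variable `17` was used. -/
def freedE : Expr := .and (.eq (.get 15 (.var 20)) (.var 17))
  (.and (.not (.eq (.var 20) (.get 13 (.var 17)))) (.not (.eq (.var 20) (.get 14 (.var 17)))))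

/-- Colour the vertices that were removed last. -/
def extendCmd : Cmd :=
  .set 17 (.const 0) (.add (.var 17) (.const 1)) ;;
  .set 34 (.const 0) (parentColE (.get 14 (.var 17))) ;;
  .set 36 (.const 0) (.const 0) ;;
  numberCmd 36 freedE ;;
  fillCmd 2 (.and freedE (.not (.lt (.get 2 (.var 20)) (.var 34))))
    (.add (.get 2 (.var 20)) (.const 1)) ;;
  fillCmd 2 (.or (.eq (.var 20) (.get 13 (.var 17))) (.eq (.var 20) (.get 14 (.var 17))))
    (.var 17)

/-- Colour all vertices that were removed. -/
def unwindCmd : Cmd := .loop 23 (.ite (.lt (.var 17) (.var 18)) extendCmd .skip)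

section
variable {s : State} {n : ℕ} {r : ℕ → ℕ} {A₀ : Finset ℕ}

/-- The freed vertices are numbered `1, 2, …`, and numbers from `x` on are raised by one, where `x`
is the colour of the parent of `a`. This skips `x`, stays injective and reaches at most `e - 1`, as
there are at most `e - 2` freed vertices. -/
theorem extendCmd_spec (h0 : s 0 0 = n) (hA : ∀ i ∈ A₀, i ≤ n)
    (hmem : ∀ i, s 15 i ≠ 0 → i ∈ A₀) {v e : ℕ} (he : e = s 17 0 + 1)
    (h : IsStep (s 8) r v A₀ (s 15) (s 13) (s 14) e)
    (hc : IsHarm (s 8) v {i ∈ A₀ | s 15 i ≤ e - 1} (e - 1) (s 2)) {t : State}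
    (ht : t = extendCmd.run s) :
    t 17 0 = e ∧ IsHarm (s 8) v {i ∈ A₀ | s 15 i ≤ e} e (t 2) := by
  have hfreed : ∀ {i}, _ ↔ _ := fun {i} => h.mem_freed hmem (i := i)
  have hcard := h.good.card_freed h.lt_inner h.pair
  set S := freed (s 8) (s 13 e) (s 14 e) {i ∈ A₀ | s 15 i ≤ e} with hS
  have hSn : ∀ i ∈ S, i ≤ n := fun i hi => hA i (hmem i (by have := (hfreed (i := i)).1 hi; omega))
  have hu : s 13 e ∈ A₀ := (Finset.mem_filter.1 h.pair.mem_u).1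
  have ha : s 14 e ∈ A₀ := (Finset.mem_filter.1 h.pair.mem_a).1
  simp only [extendCmd, run_seq, run_set] at ht
  set s1 := s.write 17 ((Expr.const 0).eval s) (((Expr.var 17).add (.const 1)).eval s) with hs1
  have x1 : s1 17 0 = e := by
    rw [hs1, State.write_self, he]; exact Function.update_self ..
  have f1 : ∀ b, b ≠ 17 → s1 b = s b := fun b hb => State.write_of_ne _ _ _ hb
  set x := s 2 (s 8 (s 14 e) - 1) with hx
  set s2 := s1.write 34 ((Expr.const 0).eval s1) ((parentColE (.get 14 (.var 17))).eval s1) with hs2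
  have x2 : s2 34 0 = x := by
    rw [hs2, State.write_self]
    simp only [parentColE, Expr.eval_get, Expr.eval_sub, Expr.eval_var, Expr.eval_const, x1,
      f1 2 (by decide), f1 8 (by decide), f1 14 (by decide), Function.update_self, ← hx]
  set s3 := s2.write 36 ((Expr.const 0).eval s2) ((Expr.const 0).eval s2) with hs3
  have f3 : ∀ b, b ∉ [17, 34, 36] → s3 b = s b := fun b hb => by
    simp only [List.mem_cons, List.not_mem_nil, or_false, not_or] at hb
    rw [hs3, State.write_of_ne _ _ _ hb.2.2, hs2, State.write_of_ne _ _ _ hb.2.1, f1 b hb.1]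
  have x317 : s3 17 0 = e := by
    rw [hs3, State.write_of_ne _ _ _ (by decide), hs2, State.write_of_ne _ _ _ (by decide), x1]
  have x334 : s3 34 0 = x := by rw [hs3, State.write_of_ne _ _ _ (by decide), x2]
  have x336 : s3 36 0 = 0 := by rw [hs3, State.write_self]; exact Function.update_self ..
  obtain ⟨-, n4⟩ := numberCmd_spec (s := s3) (x := 36) (c := freedE) (by decide)
    (by rw [f3 0 (by decide), h0]) S hSn (fun s' hb _ => by
      rw [hfreed]
      simp only [freedE, Expr.holds_and, Expr.holds_not, Expr.holds_eq, Expr.eval_get,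
        Expr.eval_var, hb 15 (by decide), hb 13 (by decide), hb 14 (by decide), hb 17 (by decide),
        f3 15 (by decide), f3 13 (by decide), f3 14 (by decide), x317, ne_eq])
  set s4 := (numberCmd 36 freedE).run s3 with hs4
  have f4 : ∀ b, b ∉ [20, 36, 2] → s4 b = s3 b := fun b hb => by
    refine run_frame _ _ ?_
    simp [numberCmd, writes] at hb ⊢; tauto
  rw [x336, f3 2 (by decide)] at n4
  obtain ⟨p1, p2⟩ := fillCmd_spec (s := s4) (X := 2)
    (c := .and freedE (.not (.lt (.get 2 (.var 20)) (.var 34))))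
    (e := .add (.get 2 (.var 20)) (.const 1)) (by decide)
    (by decide) (fun k => k ∈ S ∧ x ≤ s4 2 k) (fun k => s4 2 k + 1)
    (fun s' hb hX => by
      rw [hfreed]
      simp only [freedE, Expr.holds_and, Expr.holds_not, Expr.holds_eq, Expr.eval_get,
        Expr.holds_lt, Expr.eval_add, Expr.eval_const, hX, not_lt,
        Expr.eval_var, hb 15 (by decide), hb 13 (by decide), hb 14 (by decide), hb 17 (by decide),
        hb 34 (by decide), f4 15 (by decide), f4 13 (by decide), f4 14 (by decide),
        f4 17 (by decide), f4 34 (by decide), f3 15 (by decide), f3 13 (by decide),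
        f3 14 (by decide), x317, x334, ne_eq, and_self])
  set s5 := (fillCmd 2 (.and freedE (.not (.lt (.get 2 (.var 20)) (.var 34))))
    (.add (.get 2 (.var 20)) (.const 1))).run s4 with hs5
  have f5 : ∀ b, b ∉ [20, 2] → s5 b = s4 b := fun b hb => by
    refine run_frame _ _ ?_
    simp [fillCmd, writes] at hb ⊢; tauto
  rw [f4 0 (by decide), f3 0 (by decide), h0] at p1 p2
  obtain ⟨q1, q2⟩ := fillCmd_spec (s := s5) (X := 2)
    (c := .or (.eq (.var 20) (.get 13 (.var 17))) (.eq (.var 20) (.get 14 (.var 17))))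
    (e := .var 17) (by decide)
    (by decide) (fun k => k = s 13 e ∨ k = s 14 e) (fun _ => e)
    (fun s' hb _ => by
      simp only [Expr.holds_or, Expr.holds_eq, Expr.eval_get,
        Expr.eval_var, hb 13 (by decide), hb 14 (by decide), hb 17 (by decide),
        f5 13 (by decide), f5 14 (by decide), f5 17 (by decide), f4 13 (by decide),
        f4 14 (by decide), f4 17 (by decide), f3 13 (by decide),
        f3 14 (by decide), x317, and_self])
  rw [← ht, f5 0 (by decide), f4 0 (by decide), f3 0 (by decide), h0] at q1 q2
  have x5 : t 17 0 = e := by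
    rw [ht, run_frame _ _ (by simp [fillCmd, writes]), f5 17 (by decide), f4 17 (by decide), x317]
  have colS : ∀ i ∈ S, t 2 i = if x ≤ pos S i then pos S i + 1 else pos S i := by
    intro i hi
    have h1 := (hfreed (i := i)).1 hi
    have h2 := n4 i
    rw [if_pos hi, zero_add] at h2
    rw [q2 i (.inr (by tauto))]
    split_ifs with hxi
    · rw [p1 i (hSn i hi) ⟨hi, by omega⟩, h2]
    · rw [p2 i (.inr (by rw [h2]; tauto)), h2]
  have hd : 1 ≤ e := by omega
  refine ⟨x5, h.good |> fun hg => IsHarm.extend hg h.pair (h.prune ▸ hc) hd ?_ ?_ ?_ ?_ ?_ ?_ ?_⟩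
  · intro i hi
    rw [← h.prune, Finset.mem_filter] at hi
    have hiS : i ∉ S := fun h' => by have := (hfreed (i := i)).1 h'; omega
    have hiu : ¬ (i = s 13 e ∨ i = s 14 e) := by
      have hi' := hi
      rw [← Finset.mem_filter (p := fun i => s 15 i ≤ e - 1), h.prune, ParentForest.prune,
        Finset.mem_filter] at hi'
      tauto
    rw [q2 i (.inr hiu), p2 i (.inr (by tauto)), n4 i, if_neg hiS]
  · exact q1 _ (hA _ hu) (.inl rfl)
  · exact q1 _ (hA _ ha) (.inr rfl)
  · intro i hi
    have := one_le_pos hi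
    rw [colS i hi]; split_ifs <;> omega
  · intro i hi
    have := pos_le S i
    rw [colS i hi]; split_ifs <;> omega
  · intro i hi
    rw [colS i hi]; split_ifs <;> omega
  · intro i hi j hj hij
    rw [colS i hi, colS j hj] at hij
    have : pos S i = pos S j := by split_ifs at hij <;> omega
    exact pos_inj hi hj this

theorem unwindCmd_spec {par lev UU AA : ℕ → ℕ} {v d D : ℕ} (h0 : s 0 0 = n) (hD : s 18 0 = D)
    (hDn : D ≤ n) (hA : ∀ i ∈ A₀, i ≤ n) (h8 : s 8 = par) (h13 : s 13 = UU) (h14 : s 14 = AA)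
    (h15 : s 15 = lev) (h17 : s 17 0 = d) {A : Finset ℕ}
    (h : IsHistory par r v A₀ D A lev UU AA d) (hc : IsHarm par v A d (s 2)) :
    IsHarm par v A₀ D (unwindCmd.run s 2) := by
  have hA₀ : A₀.filter (lev · ≤ D) = A₀ := Finset.filter_true_of_mem fun i _ => by
    have := h.lev_eq i; omega
  have key := loop_inv (a := 23) (P := .ite (.lt (.var 17) (.var 18)) extendCmd .skip)
    (by simp [Valid, writes, extendCmd, numberCmd, fillCmd]) s
    -- Each round restores one colour until all `D` are back; since `D ≤ n`, the `n + 1` rounds are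
    -- enough.
    (fun m t => t 17 0 ≤ D ∧ (t 17 0 = D ∨ d + m ≤ t 17 0) ∧ d ≤ t 17 0 ∧
      IsHarm par v (A₀.filter (lev · ≤ t 17 0)) (t 17 0) (t 2)) ?_ ?_
  · rw [← unwindCmd, h0] at key
    have e : unwindCmd.run s 17 0 = D := by omega
    rw [e, hA₀] at key
    exact key.2.2.2
  · rw [State.write_of_ne _ _ _ (by decide), State.write_of_ne _ _ _ (by decide), h17, h.alive]
    exact ⟨h.le, .inr le_rfl, le_rfl, hc⟩
  · intro j s' hj hb ha ⟨h1, h2, h3, h4⟩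
    have e : ∀ b, b ∉ [23, 17, 34, 36, 20, 2] → s' b = s b := by
      intro b hb'
      refine hb b ?_
      simp [writes, extendCmd, numberCmd, fillCmd] at hb' ⊢; tauto
    rw [State.write_of_ne _ _ _ (by decide), State.write_of_ne _ _ _ (by decide), run_ite]
    by_cases hlt : s' 17 0 < D
    · rw [if_pos (by simpa [e 18 (by decide), hD] using hlt)]
      have e8 : s' 8 = par := by rw [e 8 (by decide), h8]
      have e13 : s' 13 = UU := by rw [e 13 (by decide), h13]
      have e14 : s' 14 = AA := by rw [e 14 (by decide), h14]
      have e15 : s' 15 = lev := by rw [e 15 (by decide), h15]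
      obtain ⟨g1, g2⟩ := extendCmd_spec (s := s') (r := r) (A₀ := A₀) (v := v)
        (by rw [e 0 (by decide), h0]) hA (by rw [e15]; exact h.mem) rfl
        (by rw [e8, e13, e14, e15]; exact h.steps _ (by omega) (by omega))
        (by rw [e8, e15, Nat.add_sub_cancel]; exact h4) rfl
      rw [e8, e15] at g2
      rw [g1]
      exact ⟨by omega, by omega, by omega, g2⟩
    · rw [if_neg (by simpa [e 18 (by decide), hD] using hlt), run_skip]
      exact ⟨h1, by omega, h3, h4⟩

end

end RAM

/-! ### The complete colouring program -/

namespace RAM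

open Cmd ParentForest

/-- Colour a forest of large maximum degree. -/
def colorCmd : Cmd :=
  setupCmd ;; .set 18 (.const 0) (.var 17) ;; reduceCmd ;; initialCmd ;; greedyCmd ;; unwindCmd

theorem colorCmd_valid : colorCmd.Valid := by
  simp [colorCmd, setupCmd, rowsCmd, degCmd, maxCmd, flagCmd, candCmd, peelCmd, aliveCmd, reduceCmd,
    pruneCmd, kidsCmd, sumCmd, findCmd, fillCmd, initialCmd, numberCmd, greedyCmd, greedyStepCmd,
    unwindCmd, extendCmd, Valid, writes]

section
variable {n : ℕ} {G : SimpleGraph (Fin n)} [DecidableRel G.Adj]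

theorem colorCmd_isHarm (hG : G.IsAcyclic) (hn : n + 2 ≤ 3 * G.maxDegree) {s : State}
    (hs : s = setupCmd.run (graphInput G)) :
    IsHarm (s 8) (s 5 0) (aliveSet n (s 9)) (s 17 0) (colorCmd.run (graphInput G) 2) := by
  have h := setupCmd_spec hG hn
  rw [← hs] at h
  obtain ⟨r, hr⟩ := h.good
  set s1 := s.write 18 0 (s 17 0) with hs1
  have f1 : ∀ b, b ≠ 18 → s1 b = s b := fun b hb => State.write_of_ne _ _ _ hb
  obtain ⟨h2, h2'⟩ := reduceCmd_spec (s := s1) (n := n) (r := r)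
    (by rw [f1 0 (by decide), h.size])
    (by rw [f1 8 (by decide), f1 5 (by decide), f1 9 (by decide), f1 17 (by decide)]; exact hr)
    (by rw [f1 15 (by decide)]; exact h.zero 15 (by decide)) rfl
  rw [f1 8 (by decide), f1 5 (by decide), f1 9 (by decide), f1 17 (by decide)] at h2
  rw [f1 8 (by decide), f1 5 (by decide)] at h2'
  set s2 := reduceCmd.run s1 with hs2
  have f2 : ∀ b ∈ [0, 2, 5, 8, 18], s2 b = s1 b := by
    intro b hb
    refine run_frame _ _ ?_
    simp only [List.mem_cons, List.not_mem_nil, or_false] at hb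
    rcases hb with rfl | rfl | rfl | rfl | rfl <;> decide
  have e8 : s2 8 = s 8 := by rw [f2 8 (by decide), f1 8 (by decide)]
  have e5 : s2 5 = s 5 := by rw [f2 5 (by decide), f1 5 (by decide)]
  have e0 : s2 0 0 = n := by rw [f2 0 (by decide), f1 0 (by decide), h.size]
  have h3 := initialCmd_spec (s := s2) e0
    (by rw [f2 2 (by decide), f1 2 (by decide)]; exact h.zero 2 (by decide))
    (by rw [e8, e5]; exact hr.par_root)
  set s3 := initialCmd.run s2 with hs3
  have f3 : ∀ b ∈ [0, 5, 8, 9, 13, 14, 15, 17, 18], s3 b = s2 b := by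
    intro b hb
    refine run_frame _ _ ?_
    simp only [List.mem_cons, List.not_mem_nil, or_false] at hb
    rcases hb with rfl | rfl | rfl | rfl | rfl | rfl | rfl | rfl | rfl <;> decide
  have h4 := greedyCmd_spec (s := s3) (n := n) (r := r) (by rw [f3 0 (by decide), e0])
    (by
      rw [f3 8 (by decide), f3 5 (by decide), f3 9 (by decide), f3 17 (by decide), e8, e5]
      exact h2.good)
    (by
      rw [f3 8 (by decide), f3 5 (by decide), f3 9 (by decide), f3 17 (by decide)]
      refine h3.isPartial (r := r) ?_ ?_
      · rw [e8, e5]; exact h2.good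
      · rw [e8, e5]; exact h2')
  rw [f3 8 (by decide), f3 5 (by decide), f3 9 (by decide), f3 17 (by decide), e8, e5] at h4
  set s4 := greedyCmd.run s3 with hs4
  have f4 : ∀ b ∈ [0, 5, 8, 9, 13, 14, 15, 17, 18], s4 b = s2 b := by
    intro b hb
    rw [← f3 b hb]
    refine run_frame _ _ ?_
    simp only [List.mem_cons, List.not_mem_nil, or_false] at hb
    rcases hb with rfl | rfl | rfl | rfl | rfl | rfl | rfl | rfl | rfl <;> decide
  have hrun : colorCmd.run (graphInput G) = unwindCmd.run s4 := by
    rw [hs4, hs3, hs2, hs1, hs]; rfl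
  rw [hrun]
  exact unwindCmd_spec (n := n) (by rw [f4 0 (by decide), e0])
    (by rw [f4 18 (by decide), f2 18 (by decide), hs1, State.write_self, Function.update_self])
    (colors_le hr) (fun i hi => (mem_aliveSet.1 hi).1) (by rw [f4 8 (by decide), e8])
    (f4 13 (by decide)) (f4 14 (by decide)) (f4 15 (by decide)) (by rw [f4 17 (by decide)]) h2 h4

/-- Restricting to the vertices below `n` drops the extra leaf, if there is one. Each edge is
indexed by its lower end, so injectivity of the colour pairs in `IsHarm` becomes harmoniousness. -/
theorem colorCmd_spec (hG : G.IsAcyclic) (hn : n + 2 ≤ 3 * G.maxDegree) :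
    ∃ D, (D = G.maxDegree ∨ D = G.maxDegree + 1 ∧ G.HasNonadjacentMaxDegree) ∧
      ∃ C : G.Coloring (Fin (D + 1)), C.IsHarmonious ∧
        ∀ i : Fin n, colorCmd.run (graphInput G) 2 i = C i := by
  have h := setupCmd_spec hG hn
  have hc := colorCmd_isHarm hG hn rfl
  generalize setupCmd.run (graphInput G) = s at h hc
  generalize colorCmd.run (graphInput G) 2 = col at hc ⊢
  have hmem : ∀ i : Fin n, (i : ℕ) ∈ aliveSet n (s 9) := fun i => h.alive i i.2
  have hadj : ∀ i j : Fin n, G.Adj i j → s 8 i = j + 1 ∨ s 8 j = i + 1 := fun i j hij =>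
    (h.adj i i.2 j j.2).1 ⟨i, j, hij, rfl, rfl⟩
  refine ⟨s 17 0, h.colors, SimpleGraph.Coloring.mk
    (fun i => ⟨col i, Nat.lt_succ_iff.2 (hc.le i (hmem i))⟩) ?_, ?_, fun i => rfl⟩
  · intro i j hij heq
    have heq : col i = col j := congrArg Fin.val heq
    rcases hadj i j hij with h1 | h1
    · have := hc.proper i (hmem i) (by omega)
      rw [h1, Nat.add_sub_cancel] at this
      exact this heq
    · have := hc.proper j (hmem j) (by omega)
      rw [h1, Nat.add_sub_cancel] at this
      exact this heq.symm
  · have key : ∀ e ∈ G.edgeSet, ∃ i j : Fin n, e = s(i, j) ∧ s 8 i = j + 1 := by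
      intro e
      induction e using Sym2.inductionOn with
      | _ i j =>
        intro he
        rcases hadj i j he with h1 | h1
        · exact ⟨i, j, rfl, h1⟩
        · exact ⟨j, i, Sym2.eq_swap, h1⟩
    intro e he e' he' heq
    obtain ⟨i, j, rfl, h1⟩ := key e he
    obtain ⟨i', j', rfl, h2⟩ := key e' he'
    have h3 : s(col i, col j) = s(col i', col j') := by
      have := congrArg (Sym2.map Fin.val) heq
      rw [Sym2.map_mk, Sym2.map_mk, Sym2.map_mk, Sym2.map_mk] at this
      exact this
    have h4 := hc.inj i (hmem i) i' (hmem i') (by omega) (by omega)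
      (by rw [h1, h2, Nat.add_sub_cancel, Nat.add_sub_cancel]; exact h3)
    have hij : j = j' := by
      rw [h4, h2] at h1
      exact Fin.ext (by omega)
    rw [Fin.ext h4, hij]

end

end RAM

/-! ### Optimality and invariance under isomorphism -/

namespace SimpleGraph

variable {V W : Type*} {G : SimpleGraph V} {H : SimpleGraph W}

theorem harmoniousNumber_le {k : ℕ} {C : G.Coloring (Fin k)} (hC : C.IsHarmonious) :
    G.harmoniousNumber ≤ k := Nat.sInf_le ⟨C, hC⟩

theorem exists_isHarmonious {k : ℕ} {C : G.Coloring (Fin k)} (hC : C.IsHarmonious) :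
    ∃ C : G.Coloring (Fin G.harmoniousNumber), C.IsHarmonious :=
  Nat.sInf_mem (s := {k | ∃ C : G.Coloring (Fin k), C.IsHarmonious}) ⟨k, C, hC⟩

theorem maxDegree_lt_harmoniousNumber [Fintype V] [DecidableRel G.Adj] [Nonempty V] {k : ℕ}
    {C : G.Coloring (Fin k)} (hC : C.IsHarmonious) : G.maxDegree < G.harmoniousNumber := by
  obtain ⟨C', hC'⟩ := exists_isHarmonious hC
  obtain ⟨v, hv⟩ := G.exists_maximal_degree_vertex
  rw [hv]
  exact hC'.degree_lt v

theorem HasNonadjacentMaxDegree.add_two_le_harmoniousNumber [Fintype V] [DecidableRel G.Adj]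
    {k : ℕ} {C : G.Coloring (Fin k)} (hC : C.IsHarmonious) (h : G.HasNonadjacentMaxDegree)
    (hpos : 0 < G.maxDegree) : G.maxDegree + 2 ≤ G.harmoniousNumber := by
  obtain ⟨C', hC'⟩ := exists_isHarmonious hC
  obtain ⟨u, v, huv, hadj, hu, hv⟩ := h
  exact hC'.add_two_le huv hadj hu hv hpos

theorem Coloring.IsHarmonious.comp_iso {α : Type*} (f : G ≃g H) {C : H.Coloring α}
    (hC : C.IsHarmonious) : Coloring.IsHarmonious (C.comp f.toHom) := by
  intro e he e' he' heq
  have hmap : ∀ e ∈ G.edgeSet, Sym2.map f e ∈ H.edgeSet := by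
    intro e
    induction e using Sym2.inductionOn with
    | _ x y => exact fun h => f.map_rel_iff.2 h
  refine Sym2.map.injective f.injective (hC _ (hmap e he) _ (hmap e' he') ?_)
  rw [Sym2.map_map, Sym2.map_map]
  exact heq

theorem Iso.harmoniousNumber_eq (f : G ≃g H) : G.harmoniousNumber = H.harmoniousNumber := by
  unfold harmoniousNumber
  congr 1
  ext k
  exact ⟨fun ⟨C, hC⟩ => ⟨_, hC.comp_iso f.symm⟩, fun ⟨C, hC⟩ => ⟨_, hC.comp_iso f⟩⟩

theorem Iso.hasNonadjacentMaxDegree [Fintype V] [Fintype W] [DecidableRel G.Adj]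
    [DecidableRel H.Adj] (f : G ≃g H) (h : G.HasNonadjacentMaxDegree) :
    H.HasNonadjacentMaxDegree := by
  obtain ⟨u, v, huv, hadj, hu, hv⟩ := h
  refine ⟨f u, f v, f.injective.ne huv, fun h => hadj (f.map_rel_iff.1 h), ?_, ?_⟩
  · rw [f.degree_eq, hu, f.maxDegree_eq]
  · rw [f.degree_eq, hv, f.maxDegree_eq]

end SimpleGraph

namespace RAM

section
variable {n : ℕ} {G : SimpleGraph (Fin n)} [DecidableRel G.Adj]

theorem exists_optimal_coloring (hG : G.IsAcyclic) (hn : n + 2 ≤ 3 * G.maxDegree) :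
    (G.HasNonadjacentMaxDegree → G.harmoniousNumber = G.maxDegree + 2) ∧
    (¬ G.HasNonadjacentMaxDegree → G.harmoniousNumber = G.maxDegree + 1) ∧
    ∃ C : G.Coloring (Fin G.harmoniousNumber), C.IsHarmonious ∧
        ∀ i : Fin n, colorCmd.run (graphInput G) 2 i = C i := by
  obtain ⟨D, hD, C, hC, hcol⟩ := colorCmd_spec hG hn
  have hpos : 0 < G.maxDegree := by omega
  have : Nonempty (Fin n) := by
    by_contra hne
    rw [not_nonempty_iff] at hne
    have := G.maxDegree_of_subsingleton
    omega
  have h1 := SimpleGraph.harmoniousNumber_le hC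
  have h2 := SimpleGraph.maxDegree_lt_harmoniousNumber hC
  have h3 := fun h => SimpleGraph.HasNonadjacentMaxDegree.add_two_le_harmoniousNumber hC h hpos
  -- The program spends the additional colour only when two non-adjacent vertices of maximum degree
  -- exist, and exactly then the lower bound is larger by one.
  have hh : D + 1 = G.harmoniousNumber := by
    rcases hD with rfl | ⟨rfl, h⟩
    · omega
    · have := h3 h; omega
  refine ⟨fun h => ?_, fun h => ?_, ?_⟩
  · have := h3 h; omega
  · rcases hD with rfl | ⟨rfl, h'⟩
    · omega
    · exact absurd h' h
  · rw [← hh]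
    exact ⟨C, hC, hcol⟩

end

end RAM

theorem theorem1 :
    (∀ (V : Type*) [Fintype V] (T : SimpleGraph V) [DecidableRel T.Adj],
      T.IsAcyclic → ((Fintype.card V : ℝ) + 2) / 3 ≤ (T.maxDegree : ℝ) →
        (T.HasNonadjacentMaxDegree → T.harmoniousNumber = T.maxDegree + 2) ∧
        (¬ T.HasNonadjacentMaxDegree → T.harmoniousNumber = T.maxDegree + 1)) ∧
    ∃ (P : RAM.Program) (p : Polynomial ℕ),
      ∀ (n : ℕ) (T : SimpleGraph (Fin n)) [DecidableRel T.Adj],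
        T.IsAcyclic → ((n : ℝ) + 2) / 3 ≤ (T.maxDegree : ℝ) →
          RAM.ComputesOptimalHarmoniousColoring P T (p.eval n) := by
  have cast : ∀ n d : ℕ, ((n : ℝ) + 2) / 3 ≤ d → n + 2 ≤ 3 * d := by
    intro n d h
    rw [div_le_iff₀ (by norm_num)] at h
    have : ((n + 2 : ℕ) : ℝ) ≤ ((3 * d : ℕ) : ℝ) := by push_cast; linarith
    exact_mod_cast this
  refine ⟨fun V _ T _ hT hd => ?_, RAM.colorCmd.compile, RAM.colorCmd.time,
    fun n T _ hT hd => ?_⟩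
  · classical
    -- The program deals with graphs on `Fin n`, so the formula for an arbitrary vertex type is
    -- transported along a numbering of the vertices.
    let f : T ≃g T.map (Fintype.equivFin V).toEmbedding := SimpleGraph.Iso.map _ T
    have := RAM.exists_optimal_coloring (f.isAcyclic_iff.1 hT) (by
      rw [← f.maxDegree_eq]; exact cast _ _ hd)
    rw [f.harmoniousNumber_eq, f.maxDegree_eq]
    exact ⟨fun h => this.1 (f.hasNonadjacentMaxDegree h),
      fun h => this.2.1 fun h' => h (f.symm.hasNonadjacentMaxDegree h')⟩
  · obtain ⟨t, ht, hr⟩ := RAM.Cmd.runs_compile RAM.colorCmd_valid (RAM.graphInput T)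
    exact ⟨t, ht, _, hr, (RAM.exists_optimal_coloring hT (cast _ _ hd)).2.2⟩
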